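/- **Bounded arithmetic.** Let $L_{BA}$ be the first-order language with equality, the predicate $\le$, and the function constants $0$, $1$, $x+y$, $\lfloor x/2\rfloor$, $|x|$ (binary length), $x\#y$ ($=2^{|x||y|}$), $x\cdot 2^{|y|}$, $x\mathbin{\dot{-}} y$ (truncated subtraction) and $x[i,j)$ (the number with the binary digits $x_{j-1}\cdots x_i$ of $x$). The $\Sigma^b_0$-formulas of $L_{BA}$ are those built from atomic formulas by boolean connectives and sharply bounded quantifiers $\forall y\le|t|$, $\exists y\le |t|$ ($y$ not in $t$). Write $\|x\|=||x||$, $pi=p+p+i$ for $i\in\{0,1\}$, and $s<t$ for $s\le t\wedge s\ne t$. **Inductively defined predicates of $AID$.** Such a predicate $A(\bar x,p)$, $\bar x=x_1,\dots,x_n$, is given by a linear form $\ell\|\bar x\|=\sum_{i=1}^n c_i\|x_i\|+d$ ($c_i,d\in\mathbb N$), $\Sigma^b_0$-formulas $B(\bar x,p),D_1(\bar x,p),\dots,D_m(\bar x,p)$ of $L_{BA}$ and a boolean propositional formula $I(d_1,\dots,d_m,p_0,p_1)$. Its defining axioms are * (A.0) $A(\bar x,p)\to 0\neq|p|\le \ell\|\bar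 x\|$; * (A.1) $0\ne|p|=\ell\|\bar x\|\to[A(\bar x,p)\leftrightarrow B(\bar x,p)]$; * (A.2) $0\ne|p|<\ell\|\bar x\|\to[A(\bar x,p)\leftrightarrow I(D_1(\bar x,p),\dots,D_m(\bar x,p),A(\bar x,p0),A(\bar x,p1))]$. **The function symbols of Clote's $ALV$** are obtained from the initial ones $0$, $s_0(x)=2x$, $s_1(x)=2x+1$, projections, $Bit(i,x)$, $|x|$, $x\#y$, $and$, $or$, $tree$ by composition and by concatenation recursion on notation (CRN), which forms $f$ from $g,h_0,h_1$ with $$f(0,\bar x)=g(\bar x),\qquad f(s_j n,\bar x)=s_{sg(h_j(n,\bar x))}(f(n,\bar x))\quad(j\in\{0,1\},\ s_jn\neq 0),$$ where $sg(0)=0$ and $sg(z)=1$ for $z\ne0$. The constants of $L_{BA}$ are read as fixed function symbols of $ALV$: $0$, $|x|$ and $\#$ are initial; $1$, $\lfloor x/2\rfloor$, $x\cdot2^{|y|}$, $+$ (carry lookahead), $\mathbin{\dot{-}}$ (borrow lookahead) and $x[i,j)$ are defined explicitly by composition and CRN. The atomic formula $s\le t$ is read as $s\mathbin{\dot{-}}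 t=0$. **$QALV$** is the classical first-order theory with equality whose non-logical symbols are the function symbols of $ALV$ and whose axioms are the universal closures of: * $s_0(0)=0$, and the defining equations of projections, compositions and functions defined by CRN; * $|0|=0$; $|s_jx|=|x|+1$ if $s_jx\ne0$; $Bit(i,0)=0$; $Bit(0,s_jx)=j$; $Bit(i+1,s_jx)=Bit(i,x)$; $0\#y=1$; $s_jx\#y=(x\#y)\cdot2^{|y|}$ if $s_jx\neq 0$; * $and(0)=or(0)=0$; $and(x)=or(x)=1$ for $x=1,2,3$; and, for $x\ne0$ and $a,b\in\{0,1\}$, $and(s_bs_ax)=s_{a\wedge b}(and(x))$, $or(s_bs_ax)=s_{a\vee b}(or(x))$; * $tree(x)=Bit(0,x)$ if $x<16$ (i.e. $\lfloor x/16\rfloor=0$), and $tree(x)=tree(or(and(x)))$ otherwise; * $0\ne1$, and $\lfloor x/2\rfloor=0\to(x=0\vee x=1)$; * induction on notation $\varphi(0)\wedge\forall x(\varphi(x)\to\varphi(s_0x)\wedge\varphi(s_1x))\to\forall x\,\varphi(x)$ for quantifier-free $\varphi$ (with parameters). **Theorem.** For every inductively defined predicate $A(\bar x,p)$ of $AID$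 there is an $(n+1)$-ary function symbol $f_A$ of $ALV$, of the form $f_A(\bar x,p)=tree(g_A(\bar x,p))$ where $g_A$ is built without $tree$ from the other initial functions by composition and CRN, such that $QALV$ proves * $f_A(\bar x,p)=0\vee f_A(\bar x,p)=1$, and * each of the axioms (A.0), (A.1), (A.2) with $f_A(\cdot,\cdot)=1$ in place of $A(\cdot,\cdot)$. -/

import Mathlib

open FirstOrder.Language

/-! ## First-order provability -/

namespace FOL

variable {L : FirstOrder.Language.{0, 0}}

/-- `φ[t]`: substitute the term `t` for the variable bound by the outermost quantifier of `∀' φ`. -/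
def inst (φ : L.BoundedFormula ℕ 1) (t : L.Term ℕ) : L.Formula ℕ :=
  φ.toFormula.subst (Sum.elim Term.var fun _ => t)

/-- Rename every free variable `k` to `k + 1`, so that the variable `0` becomes fresh. -/
def shift (φ : L.Formula ℕ) : L.Formula ℕ :=
  Formula.relabel Nat.succ φ

/-- The body of `∀' φ` with the bound variable replaced by the fresh variable `0`. -/
def body (φ : L.BoundedFormula ℕ 1) : L.Formula ℕ :=
  φ.toFormula.subst (Sum.elim (fun k => Term.var (k + 1)) fun _ => Term.var 0)

/-- Natural deduction for classical first-order logic with equality; the free variables are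
indexed by `ℕ`, and `Γ` is the set of open assumptions. The primitive connectives are `⊥`, `⟹`
and `∀'`. -/
inductive Derives : Set (L.Formula ℕ) → L.Formula ℕ → Prop
  | assumption {Γ : Set (L.Formula ℕ)} {φ : L.Formula ℕ} : φ ∈ Γ → Derives Γ φ
  | impIntro {Γ : Set (L.Formula ℕ)} {φ ψ : L.Formula ℕ} :
      Derives (insert φ Γ) ψ → Derives Γ (φ.imp ψ)
  | impElim {Γ : Set (L.Formula ℕ)} {φ ψ : L.Formula ℕ} :
      Derives Γ (φ.imp ψ) → Derives Γ φ → Derives Γ ψ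
  | byContra {Γ : Set (L.Formula ℕ)} {φ : L.Formula ℕ} :
      Derives (insert φ.not Γ) ⊥ → Derives Γ φ
  | allIntro {Γ : Set (L.Formula ℕ)} {φ : L.BoundedFormula ℕ 1} :
      Derives (shift '' Γ) (body φ) → Derives Γ φ.all
  | allElim {Γ : Set (L.Formula ℕ)} {φ : L.BoundedFormula ℕ 1} (t : L.Term ℕ) :
      Derives Γ φ.all → Derives Γ (inst φ t)
  | eqRefl {Γ : Set (L.Formula ℕ)} (t : L.Term ℕ) : Derives Γ (t.equal t)
  | eqSubst {Γ : Set (L.Formula ℕ)} (φ : L.BoundedFormula ℕ 1) {s t : L.Term ℕ} :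
      Derives Γ (s.equal t) → Derives Γ (inst φ s) → Derives Γ (inst φ t)

/-- A sentence, as a formula over the variables indexed by `ℕ` (none of which occurs in it). -/
def ofSentence (σ : L.Sentence) : L.Formula ℕ :=
  Formula.relabel (Empty.elim : Empty → ℕ) σ

/-- `T` proves the sentence `σ`. -/
def Proves (T : L.Theory) (σ : L.Sentence) : Prop :=
  Derives (ofSentence '' T) (ofSentence σ)

/-- The universal closure of a formula in the variables `0, …, k - 1`. -/
def univClosure {k : ℕ} (φ : L.Formula (Fin k)) : L.Sentence :=
  (BoundedFormula.relabel (Sum.inr : Fin k → Empty ⊕ Fin k) φ).alls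

/-- `φ` with its last variable replaced by the term `t`. -/
def substLast {k : ℕ} {β : Type} (φ : L.Formula (Fin (k + 1))) (v : Fin k → L.Term β)
    (t : L.Term β) : L.Formula β :=
  φ.subst (Fin.snoc (α := fun _ => L.Term β) v t)

/-- Turn the last variable of `φ` into a bound variable, ready to be quantified. -/
def bindLast {k : ℕ} (φ : L.Formula (Fin (k + 1))) : L.BoundedFormula (Fin k) 1 :=
  BoundedFormula.relabel
    (Fin.snoc (α := fun _ => Fin k ⊕ Fin 1) (fun i => Sum.inl i) (Sum.inr 0)) φ

end FOL

/-! ## The language of weak bounded arithmetic and its sharply bounded formulas -/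

namespace BA

/-- Function constants: `0`, `1`, `x + y`, `⌊x/2⌋`, `|x|`, `x # y`, `x · 2^|y|`, `x ∸ y` and
`x[i, j)`. -/
inductive Func : ℕ → Type
  | zero : Func 0
  | one : Func 0
  | add : Func 2
  | half : Func 1
  | len : Func 1
  | smash : Func 2
  | pad : Func 2
  | monus : Func 2
  | part : Func 3

/-- The only predicate constant besides equality. -/
inductive Rel : ℕ → Type
  | le : Rel 2

end BA

/-- The base language of weak bounded arithmetic. -/
def LBA : FirstOrder.Language.{0, 0} := ⟨BA.Func, BA.Rel⟩

namespace BA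

variable {α : Type}

def zero : LBA.Term α := Term.func (L := LBA) Func.zero ![]
def one : LBA.Term α := Term.func (L := LBA) Func.one ![]
def add (s t : LBA.Term α) : LBA.Term α := Term.func (L := LBA) Func.add ![s, t]
def len (t : LBA.Term α) : LBA.Term α := Term.func (L := LBA) Func.len ![t]

/-- The atomic formula `s ≤ t`. -/
def le {n : ℕ} (s t : LBA.Term (α ⊕ Fin n)) : LBA.BoundedFormula α n :=
  BoundedFormula.rel (L := LBA) Rel.le ![s, t]

/-- The atomic formula `s ≤ t`, without bound variables in the terms. -/
def leF (s t : LBA.Term α) : LBA.Formula α :=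
  Relations.formula (L := LBA) Rel.le ![s, t]

/-- `s < t`, that is, `s ≤ t` and `s ≠ t`. -/
def ltF (s t : LBA.Term α) : LBA.Formula α := leF s t ⊓ (s.equal t).not

/-- `t`, seen in the scope of one more quantifier. -/
def lift {n : ℕ} (t : LBA.Term (α ⊕ Fin n)) : LBA.Term (α ⊕ Fin (n + 1)) :=
  t.relabel (Sum.map id Fin.castSucc)

/-- `y ≤ |t|` for the variable `y` that the next quantifier binds; `y` does not occur in `t`. -/
def bound {n : ℕ} (t : LBA.Term (α ⊕ Fin n)) : LBA.BoundedFormula α (n + 1) :=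
  le (Term.var (Sum.inr (Fin.last n))) (len (lift t))

/-- The `Σ₀ᵇ`-formulas: the least class of formulas that contains the atomic ones and is closed
under boolean connectives (all of them are made of `⊥` and `⟹`) and under the sharply bounded
quantifiers `∀ y ≤ |t|` and `∃ y ≤ |t|`. -/
inductive IsSigma0 : {n : ℕ} → LBA.BoundedFormula α n → Prop
  | falsum {n : ℕ} : IsSigma0 (⊥ : LBA.BoundedFormula α n)
  | equal {n : ℕ} (s t : LBA.Term (α ⊕ Fin n)) : IsSigma0 (BoundedFormula.equal s t)
  | le {n : ℕ} (s t : LBA.Term (α ⊕ Fin n)) : IsSigma0 (le s t)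
  | imp {n : ℕ} {φ ψ : LBA.BoundedFormula α n} :
      IsSigma0 φ → IsSigma0 ψ → IsSigma0 (φ.imp ψ)
  | ball {n : ℕ} (t : LBA.Term (α ⊕ Fin n)) {φ : LBA.BoundedFormula α (n + 1)} :
      IsSigma0 φ → IsSigma0 ((bound t).imp φ).all
  | bex {n : ℕ} (t : LBA.Term (α ⊕ Fin n)) {φ : LBA.BoundedFormula α (n + 1)} :
      IsSigma0 φ → IsSigma0 (bound t ⊓ φ).ex

/-- The numeral `1 + ⋯ + 1` with `d` summands. -/
def numeral : ℕ → LBA.Term α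
  | 0 => zero
  | d + 1 => add (numeral d) one

/-- The term `c · t`, that is, the sum `t + ⋯ + t` with `c` summands. -/
def smul (t : LBA.Term α) : ℕ → LBA.Term α
  | 0 => zero
  | c + 1 => add (smul t c) t

/-- The linear form `∑ᵢ cᵢ · ‖tᵢ‖ + d`, where `‖t‖ = ||t||`. -/
def linearForm : {n : ℕ} → (Fin n → ℕ) → (Fin n → LBA.Term α) → ℕ → LBA.Term α
  | 0, _, _, d => numeral d
  | _ + 1, c, t, d =>
      add (smul (len (len (t 0))) (c 0)) (linearForm (fun i => c i.succ) (fun i => t i.succ) d)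

/-- Append a binary digit: `p0 = p + p + 0`. -/
def app0 (t : LBA.Term α) : LBA.Term α := add (add t t) zero
/-- Append a binary digit: `p1 = p + p + 1`. -/
def app1 (t : LBA.Term α) : LBA.Term α := add (add t t) one

end BA

/-! ## The function symbols of Clote's system -/

/-- The function symbols of `ALV`, with their arities: the initial functions (`0`, the binary
successors `s₀ x = 2x` and `s₁ x = 2x + 1`, projections, `Bit(i, x)`, `|x|`, `x # y`, the
auxiliary functions `and`, `or` of `tree`, and `tree`), closed under composition and
concatenation recursion on notation. -/
inductive ALV : ℕ → Type
  | zero : ALV 0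
  | s0 : ALV 1
  | s1 : ALV 1
  | proj (n : ℕ) (i : Fin n) : ALV n
  | bit : ALV 2
  | len : ALV 1
  | smash : ALV 2
  | andF : ALV 1
  | orF : ALV 1
  | tree : ALV 1
  | comp {k n : ℕ} (f : ALV k) (g : Fin k → ALV n) : ALV n
  | crn {n : ℕ} (g : ALV n) (h0 h1 : ALV (n + 1)) : ALV (n + 1)

namespace ALV

/-- The symbol is built without `tree`. -/
def TreeFree : {n : ℕ} → ALV n → Prop
  | _, tree => False
  | _, comp f g => f.TreeFree ∧ ∀ i, (g i).TreeFree
  | _, crn g h0 h1 => g.TreeFree ∧ h0.TreeFree ∧ h1.TreeFree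
  | _, _ => True

/-! ### Explicit symbols for the functions of bounded arithmetic

A value is read as a truth value: `0` is false, everything else is true. A string is also read
as a unary number: a bound variable `y` of a recursion on notation runs through the proper
prefixes of a string, and `|y|` through the numbers below the length of the string. -/

/-- The constant functions `0` and `1`. -/
def zeroC (n : ℕ) : ALV n := comp zero ![]
def oneC (n : ℕ) : ALV n := comp s1 ![zeroC n]

/-- `(y, x) ↦ x · 2^|y|`: append a digit `0` to `x` for each digit of `y`. -/
def padRec : ALV 2 := crn (proj 1 0) (zeroC 2) (zeroC 2)

/-- `x · 2^|y|` -/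
def pad : ALV 2 := comp padRec ![proj 2 1, proj 2 0]

/-- `⌊x/2⌋`: `⌊0/2⌋ = 0`, and `⌊x/2⌋` for `x = s_j n` is `⌊n/2⌋` followed by the last digit
of `n`. -/
def half : ALV 1 := crn zero (comp bit ![zeroC 1, proj 1 0]) (comp bit ![zeroC 1, proj 1 0])

/-- Negation: the last digit of `1 · 2^|a|`. -/
def neg {n : ℕ} (a : ALV n) : ALV n := comp bit ![zeroC n, comp padRec ![a, oneC n]]

/-- Disjunction: append a digit to `a` which is `0` iff `b = 0`. -/
def disj {n : ℕ} (a b : ALV n) : ALV n :=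
  comp (crn (proj 2 0) (proj 3 2) (proj 3 2)) ![oneC n, a, b]

def conj {n : ℕ} (a b : ALV n) : ALV n := neg (disj (neg a) (neg b))

def exor {n : ℕ} (a b : ALV n) : ALV n := conj (disj a b) (neg (conj a b))

/-- `(y, z) ↦ ∃ y' (y' is a proper prefix of y and a(y', z))`, for `a` that depends on the
length of its first argument only: `∃ j < |y|`. -/
def exPrefix {n : ℕ} (a : ALV (n + 1)) : ALV (n + 1) := crn (zeroC n) a a

/-- The string `1 ⋯ 1` of length `|y|`. -/
def ones : ALV 1 := crn zero (oneC 1) (oneC 1)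

/-- `|u| < |v|` -/
def lenLt {n : ℕ} (u v : ALV n) : ALV n := comp bit ![comp len ![u], comp ones ![v]]

/-- The digit of `x` at the position `|y|`. -/
def bitAt {n : ℕ} (y x : ALV n) : ALV n := comp bit ![comp len ![y], x]

/-- `(d, z) ↦` the number whose digit at the position `i` is `1` iff `i < |d|` and `e(y, z)` for
`|y| = i`. First the string `1 e₀ e₁ ⋯` is produced, and then it is reversed. -/
def compr {n : ℕ} (e : ALV (n + 1)) : ALV (n + 1) :=
  comp
    (crn (zeroC (n + 1))
      (bitAt (proj (n + 2) 0) (comp (crn (oneC n) e e) fun i => proj (n + 2) i.succ))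
      (bitAt (proj (n + 2) 0) (comp (crn (oneC n) e e) fun i => proj (n + 2) i.succ)))
    (Fin.cons (proj (n + 1) 0) fun i => proj (n + 1) i)

/-- `(y, x, z) ↦` the carry into the position `i = |y|`: there is a position `j < i` where a
carry is generated, and it is propagated at all the positions between `j` and `i`. -/
def carry (gen prop : ALV 3) : ALV 3 :=
  comp
    (exPrefix (n := 3)
      -- the arguments are `y', y, x, z`
      (conj (comp gen ![proj 4 0, proj 4 2, proj 4 3])
        (neg (comp
          (exPrefix (n := 3)
            -- the arguments are `y'', y', x, z`
            (conj (lenLt (proj 4 1) (proj 4 0))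
              (neg (comp prop ![proj 4 0, proj 4 2, proj 4 3]))))
          ![proj 4 1, proj 4 0, proj 4 2, proj 4 3]))))
    ![proj 3 0, proj 3 0, proj 3 1, proj 3 2]

/-- The digits of the second and of the third argument at the position `|y|`. -/
def bx : ALV 3 := bitAt (proj 3 0) (proj 3 1)
def bz : ALV 3 := bitAt (proj 3 0) (proj 3 2)

/-- A string that is longer than `x` and than `z`. -/
def long {n : ℕ} (x z : ALV n) : ALV n := comp padRec ![x, comp s1 ![z]]

/-- `x + z`, by carry lookahead. -/
def add : ALV 2 :=
  comp (compr (n := 2) (exor (exor bx bz) (carry (conj bx bz) (disj bx bz))))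
    ![long (proj 2 0) (proj 2 1), proj 2 0, proj 2 1]

/-- The borrow into the position `|y|` in the subtraction `x - z`. -/
def borrow : ALV 3 := carry (conj (neg bx) bz) (disj (neg bx) bz)

/-- `x ∸ z`: the digits of `x - z` if no borrow is left at the end, and `0` otherwise. -/
def monus : ALV 2 :=
  comp
    (compr (n := 2)
      (conj (exor (exor bx bz) borrow)
        (neg (comp borrow ![long (proj 3 1) (proj 3 2), proj 3 1, proj 3 2]))))
    ![long (proj 2 0) (proj 2 1), proj 2 0, proj 2 1]

/-- `x[i, j)`: its digit at the position `k` is the digit of `x` at the position `i + k` if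
`i + k < j`, and `0` otherwise. -/
def part : ALV 3 :=
  comp
    (compr (n := 3)
      -- the arguments are `y, x, i, j` with `|y| = k`
      (conj (comp bit ![comp add ![proj 4 2, comp len ![proj 4 0]], proj 4 1])
        (comp monus ![proj 4 3, comp add ![proj 4 2, comp len ![proj 4 0]]])))
    ![proj 3 0, proj 3 0, proj 3 1, proj 3 2]

/-- The function symbol of `ALV` for each function constant of bounded arithmetic. -/
def ofBA : {n : ℕ} → BA.Func n → ALV n
  | _, .zero => zero
  | _, .one => oneC 0
  | _, .add => add
  | _, .half => half
  | _, .len => len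
  | _, .smash => smash
  | _, .pad => pad
  | _, .monus => monus
  | _, .part => part

end ALV

/-! ## The theory `QALV` -/

/-- The language of `QALV`: the function symbols of `ALV`, and equality. -/
def LALV : FirstOrder.Language.{0, 0} := ⟨ALV, fun _ => Empty⟩

namespace QALV

variable {α : Type}

def app {n : ℕ} (f : ALV n) (t : Fin n → LALV.Term α) : LALV.Term α := Term.func (L := LALV) f t

def zero : LALV.Term α := app ALV.zero ![]
def s0 (t : LALV.Term α) : LALV.Term α := app ALV.s0 ![t]
def s1 (t : LALV.Term α) : LALV.Term α := app ALV.s1 ![t]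
def one : LALV.Term α := s1 zero
def half (t : LALV.Term α) : LALV.Term α := app ALV.half ![t]
def len (t : LALV.Term α) : LALV.Term α := app ALV.len ![t]
def bit (i t : LALV.Term α) : LALV.Term α := app ALV.bit ![i, t]
def smash (s t : LALV.Term α) : LALV.Term α := app ALV.smash ![s, t]
def pad (s t : LALV.Term α) : LALV.Term α := app ALV.pad ![s, t]
/-- `t + 1` -/
def succ (t : LALV.Term α) : LALV.Term α := app ALV.add ![t, one]
def andF (t : LALV.Term α) : LALV.Term α := app ALV.andF ![t]
def orF (t : LALV.Term α) : LALV.Term α := app ALV.orF ![t]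
def tree (t : LALV.Term α) : LALV.Term α := app ALV.tree ![t]

/-- The variables of the axioms. -/
def x : LALV.Term (Fin 1) := Term.var 0
def u : LALV.Term (Fin 2) := Term.var 0
def v : LALV.Term (Fin 2) := Term.var 1

/-- `s ≠ t` -/
def ne (s t : LALV.Term α) : LALV.Formula α := (s.equal t).not

/-- `⌊⌊⌊⌊x/2⌋/2⌋/2⌋/2⌋ = ⌊x/16⌋` -/
def half4 (t : LALV.Term α) : LALV.Term α := half (half (half (half t)))

/-- The symbol `f = crn g h₀ h₁` applied to `(t, x₁, …, xₙ)`; the variable `0` is the recursion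
variable, and the variables `1, …, n` are the parameters. -/
def appRec {n : ℕ} (f : ALV (n + 1)) (t : LALV.Term (Fin (n + 1))) : LALV.Term (Fin (n + 1)) :=
  app f (Fin.cons t fun i => Term.var i.succ)

/-- `(h(m, x) = 0 → f(r, x) = s₀ f(m, x)) ∧ (h(m, x) ≠ 0 → f(r, x) = s₁ f(m, x))`, where `m` is
the variable `0`: this is `f(r, x) = s_i(f(m, x))` with `i = sg(h(m, x))`. -/
def crnStep {n : ℕ} (f h : ALV (n + 1)) (r : LALV.Term (Fin (n + 1))) :
    LALV.Formula (Fin (n + 1)) :=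
  (((appRec h (Term.var 0)).equal zero).imp
      ((appRec f r).equal (s0 (appRec f (Term.var 0))))) ⊓
    ((ne (appRec h (Term.var 0)) zero).imp
      ((appRec f r).equal (s1 (appRec f (Term.var 0)))))

/-- The axiom of induction on notation for `φ`, on the last variable of `φ`:
`φ(0) ∧ ∀ x (φ(x) → φ(s₀ x) ∧ φ(s₁ x)) → ∀ x φ(x)`; the other variables are parameters. -/
def notationInduction {k : ℕ} (φ : LALV.Formula (Fin (k + 1))) : LALV.Formula (Fin k) :=
  (FOL.substLast φ Term.var zero ⊓
      (FOL.bindLast (φ.imp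
        (FOL.substLast φ (fun i => Term.var i.castSucc) (s0 (Term.var (Fin.last k))) ⊓
          FOL.substLast φ (fun i => Term.var i.castSucc) (s1 (Term.var (Fin.last k)))))).all).imp
    (FOL.bindLast φ).all

/-- The axioms of `QALV`, as formulas whose universal closures are meant. -/
inductive Axiom : {k : ℕ} → LALV.Formula (Fin k) → Prop
  /- the successors: `s_i x = 2x + i` -/
  | s0_zero : Axiom (k := 0) ((s0 zero).equal zero)
  /- projections and composition -/
  | proj (n : ℕ) (i : Fin n) : Axiom ((app (ALV.proj n i) Term.var).equal (Term.var i))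
  | comp {k n : ℕ} (f : ALV k) (g : Fin k → ALV n) :
      Axiom ((app (ALV.comp f g) Term.var).equal (app f fun i => app (g i) Term.var))
  /- concatenation recursion on notation -/
  | crn_zero {n : ℕ} (g : ALV n) (h0 h1 : ALV (n + 1)) :
      Axiom ((app (ALV.crn g h0 h1) (Fin.cons zero Term.var)).equal (app g Term.var))
  | crn_s0 {n : ℕ} (g : ALV n) (h0 h1 : ALV (n + 1)) :
      Axiom ((ne (Term.var 0) zero).imp
        (crnStep (ALV.crn g h0 h1) h0 (s0 (Term.var 0))))
  | crn_s1 {n : ℕ} (g : ALV n) (h0 h1 : ALV (n + 1)) :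
      Axiom (crnStep (ALV.crn g h0 h1) h1 (s1 (Term.var 0)))
  /- the length `|x|` -/
  | len_zero : Axiom (k := 0) ((len zero).equal zero)
  | len_s0 : Axiom ((ne x zero).imp ((len (s0 x)).equal (succ (len x))))
  | len_s1 : Axiom ((len (s1 x)).equal (succ (len x)))
  /- the digit `Bit(i, x)` -/
  | bit_zero : Axiom ((bit x zero).equal zero)
  | bit_zero_s0 : Axiom ((bit zero (s0 x)).equal zero)
  | bit_zero_s1 : Axiom ((bit zero (s1 x)).equal one)
  | bit_succ_s0 : Axiom ((bit (succ u) (s0 v)).equal (bit u v))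
  | bit_succ_s1 : Axiom ((bit (succ u) (s1 v)).equal (bit u v))
  /- smash: `x # y = 2^(|x| |y|)` -/
  | smash_zero : Axiom ((smash zero x).equal one)
  | smash_s0 : Axiom ((ne u zero).imp ((smash (s0 u) v).equal (pad (smash u v) v)))
  | smash_s1 : Axiom ((smash (s1 u) v).equal (pad (smash u v) v))
  /- the auxiliary functions `and` and `or` -/
  | and_zero : Axiom (k := 0) ((andF zero).equal zero)
  | and_1 : Axiom (k := 0) ((andF one).equal one)
  | and_2 : Axiom (k := 0) ((andF (s0 one)).equal one)
  | and_3 : Axiom (k := 0) ((andF (s1 one)).equal one)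
  | and_00 : Axiom ((ne x zero).imp ((andF (s0 (s0 x))).equal (s0 (andF x))))
  | and_10 : Axiom ((ne x zero).imp ((andF (s0 (s1 x))).equal (s0 (andF x))))
  | and_01 : Axiom ((ne x zero).imp ((andF (s1 (s0 x))).equal (s0 (andF x))))
  | and_11 : Axiom ((ne x zero).imp ((andF (s1 (s1 x))).equal (s1 (andF x))))
  | or_zero : Axiom (k := 0) ((orF zero).equal zero)
  | or_1 : Axiom (k := 0) ((orF one).equal one)
  | or_2 : Axiom (k := 0) ((orF (s0 one)).equal one)
  | or_3 : Axiom (k := 0) ((orF (s1 one)).equal one)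
  | or_00 : Axiom ((ne x zero).imp ((orF (s0 (s0 x))).equal (s0 (orF x))))
  | or_10 : Axiom ((ne x zero).imp ((orF (s0 (s1 x))).equal (s1 (orF x))))
  | or_01 : Axiom ((ne x zero).imp ((orF (s1 (s0 x))).equal (s1 (orF x))))
  | or_11 : Axiom ((ne x zero).imp ((orF (s1 (s1 x))).equal (s1 (orF x))))
  /- `tree`: the parity of `x` if `x < 16`, and `tree(or(and(x)))` otherwise -/
  | tree_small : Axiom (((half4 x).equal zero).imp ((tree x).equal (bit zero x)))
  | tree_large : Axiom ((ne (half4 x) zero).imp ((tree x).equal (tree (orF (andF x)))))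
  /- the two additional axioms -/
  | zero_ne_one : Axiom (k := 0) (ne zero one)
  | half_zero : Axiom (((half x).equal zero).imp (x.equal zero ⊔ x.equal one))
  /- induction on notation for quantifier-free formulas -/
  | induction {k : ℕ} (φ : LALV.Formula (Fin (k + 1))) : φ.IsQF → Axiom (notationInduction φ)

/-- The first-order theory `QALV`. -/
def theory : LALV.Theory := {σ | ∃ (k : ℕ) (φ : LALV.Formula (Fin k)), Axiom φ ∧ σ = FOL.univClosure φ}

/-! ### Formulas of bounded arithmetic as formulas of `QALV` -/

/-- A term of bounded arithmetic, read in `QALV`. -/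
def ofTerm : LBA.Term α → LALV.Term α
  | .var a => .var a
  | .func f ts => app (ALV.ofBA f) fun i => ofTerm (ts i)

/-- A formula of bounded arithmetic, read in `QALV`; `s ≤ t` is read as `s ∸ t = 0`. -/
def ofFormula : {n : ℕ} → LBA.BoundedFormula α n → LALV.BoundedFormula α n
  | _, .falsum => .falsum
  | _, .equal s t => .equal (ofTerm s) (ofTerm t)
  | _, .rel BA.Rel.le ts => .equal (app ALV.monus ![ofTerm (ts 0), ofTerm (ts 1)]) zero
  | _, .imp φ ψ => .imp (ofFormula φ) (ofFormula ψ)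
  | _, .all φ => .all (ofFormula φ)

end QALV

/-! ## Inductively defined predicates -/

/-- Boolean propositional formulas over a set of atoms. -/
inductive BoolFormula (A : Type) : Type
  | atom (a : A) : BoolFormula A
  | tru : BoolFormula A
  | fls : BoolFormula A
  | neg (I : BoolFormula A) : BoolFormula A
  | and (I J : BoolFormula A) : BoolFormula A
  | or (I J : BoolFormula A) : BoolFormula A
  | imp (I J : BoolFormula A) : BoolFormula A

/-- Replace simultaneously the atoms of a boolean formula by formulas. -/
def BoolFormula.subst {A α : Type} {L : FirstOrder.Language.{0, 0}} (v : A → L.Formula α) :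
    BoolFormula A → L.Formula α
  | atom a => v a
  | tru => ⊤
  | fls => ⊥
  | neg I => (I.subst v).not
  | and I J => I.subst v ⊓ J.subst v
  | or I J => I.subst v ⊔ J.subst v
  | imp I J => (I.subst v).imp (J.subst v)

/-- The items `ℓ, B, D₁, …, D_m, I` that an inductively defined predicate `A(x₁, …, xₙ, p)` of
`AID` is given by. In `B` and `Dᵢ` the variables `0, …, n - 1` are `x₁, …, xₙ`, and the last
variable `n` is `p`. The atoms of `I` are `d₁, …, d_m` (on the left) and `p₀, p₁` (on the
right). -/
structure IndPred where
  n : ℕ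
  /-- the coefficients of the linear form `ℓ‖x‖ = ∑ᵢ cᵢ ‖xᵢ‖ + d` -/
  c : Fin n → ℕ
  d : ℕ
  B : LBA.Formula (Fin (n + 1))
  B_sigma0 : BA.IsSigma0 B
  m : ℕ
  D : Fin m → LBA.Formula (Fin (n + 1))
  D_sigma0 : ∀ i, BA.IsSigma0 (D i)
  I : BoolFormula (Fin m ⊕ Fin 2)

namespace IndPred

variable (A : IndPred)

/-- The term `p`. -/
def p : LBA.Term (Fin (A.n + 1)) := Term.var (Fin.last A.n)

/-- The term `ℓ‖x‖`. -/
def ell : LBA.Term (Fin (A.n + 1)) :=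
  BA.linearForm A.c (fun i => Term.var i.castSucc) A.d

/-- `0 ≠ |p|` -/
def pos : LBA.Formula (Fin (A.n + 1)) := (BA.zero.equal (BA.len A.p)).not

/-- The formula `f(x, t) = 1` of `QALV`. -/
def holds (f : ALV (A.n + 1)) (t : LBA.Term (Fin (A.n + 1))) : LALV.Formula (Fin (A.n + 1)) :=
  (QALV.app f (Fin.snoc (α := fun _ => LALV.Term (Fin (A.n + 1)))
    (fun i => Term.var i.castSucc) (QALV.ofTerm t))).equal QALV.one

/-- `A(x, p) → 0 ≠ |p| ≤ ℓ‖x‖`, where `A(x, p)` is read as `f(x, p) = 1`. -/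
def ax0 (f : ALV (A.n + 1)) : LALV.Formula (Fin (A.n + 1)) :=
  (A.holds f A.p).imp (QALV.ofFormula (A.pos ⊓ BA.leF (BA.len A.p) A.ell))

/-- `0 ≠ |p| = ℓ‖x‖ → [A(x, p) ↔ B(x, p)]`, where `A(x, p)` is read as `f(x, p) = 1`. -/
def ax1 (f : ALV (A.n + 1)) : LALV.Formula (Fin (A.n + 1)) :=
  (QALV.ofFormula (A.pos ⊓ (BA.len A.p).equal A.ell)).imp
    ((A.holds f A.p).iff (QALV.ofFormula A.B))

/-- `0 ≠ |p| < ℓ‖x‖ → [A(x, p) ↔ I(D(x, p), A(x, p0), A(x, p1))]`, where `A(x, p)` is read as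
`f(x, p) = 1`. -/
def ax2 (f : ALV (A.n + 1)) : LALV.Formula (Fin (A.n + 1)) :=
  (QALV.ofFormula (A.pos ⊓ BA.ltF (BA.len A.p) A.ell)).imp
    ((A.holds f A.p).iff
      (A.I.subst (Sum.elim (fun i => QALV.ofFormula (A.D i))
        ![A.holds f (BA.app0 A.p), A.holds f (BA.app1 A.p)])))

/-- `f(x, p) = 0 ∨ f(x, p) = 1` -/
def zeroOne (f : ALV (A.n + 1)) : LALV.Formula (Fin (A.n + 1)) :=
  (QALV.app f Term.var).equal QALV.zero ⊔ (QALV.app f Term.var).equal QALV.one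

end IndPred

/-!
The proof is semantic. By the completeness theorem for the calculus of the statement
(`FOL.proves_of_forall_models`) it is enough to check the four sentences in every model `M` of
`QALV`. A model is studied like a nonstandard model of arithmetic: every property that is given by a
quantifier-free formula with parameters admits induction on notation (`Mdl.notation_induction`;
class inference on `Mdl.QD` finds the formulas), and a quantifier over the prefixes of a string can
be expressed by a recursion (`Mdl.tv_exPrefix`). From the explicit definitions of addition and
subtraction one obtains the rippling of carries and borrows (`Mdl.carry_sB`), the recursion equations
of `+` on binary digits, and the linear order. `Σ₀ᵇ`-formulas are decided by symbols without `tree`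
(`Mdl.exists_sigma0_symbol`), and a string whose length is `ℓ‖x‖`, as well as one whose length is
exponential in `ℓ‖x‖`, are values of such symbols (`Mdl.logTerm_linearForm`).

The function `tree` evaluates a complete binary tree of alternating disjunctions and conjunctions,
whose leaves are the digits of its argument. The value of `A(x, p)` is expressed as a game. At a node
`q` with a claimed value, the first player names values `e₀`, `e₁` for `q0` and `q1`, and the second
player chooses the child at which the play goes on; the first player has to respect
`I(D(x, q), e₀, e₁)` all the way, and at the end `B` decides. One step is a block of four digits of a
position: `∨ e₀`, `∧ b` for the chosen child, `∨ e₁`, and an idle `∧`. It does no harm that `e₁` is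
named after `b`, since with `b = 0` only the consistency of the block is at stake
(`Mdl.tv_game_verify`).

The tree for a node `p` is evaluated level by level from the leaves to the root
(`Mdl.ev_value_inner`). This uses that the value function satisfies the recursion at the nodes that
are longer than `p`: then the truth values at the inner positions of the game are those of the
quantifier-free property "the position is consistent, and the value function agrees with the claimed
value" (`ALV.verify`), so that quantifier-free induction applies. The recursion is therefore derived
at all nodes by the maximum principle (`Mdl.exists_greatest`) applied to a greatest counterexample
(`Mdl.tv_value_iff`).
-/

/-! ### Simultaneous substitution -/

namespace FOL

section Substitution

variable {L : FirstOrder.Language.{0, 0}} {α β γ : Type}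

/-- `t`, seen in the scope of one more quantifier. -/
def liftTerm {n : ℕ} (t : L.Term (α ⊕ Fin n)) : L.Term (α ⊕ Fin (n + 1)) :=
  t.relabel (Sum.map id Fin.castSucc)

/-- Extend a substitution under a quantifier; the newly bound variable stays fixed. -/
def up {n m : ℕ} (σ : α ⊕ Fin n → L.Term (β ⊕ Fin m)) :
    α ⊕ Fin (n + 1) → L.Term (β ⊕ Fin (m + 1)) :=
  Sum.elim (fun a => liftTerm (σ (Sum.inl a)))
    (Fin.snoc (α := fun _ => L.Term (β ⊕ Fin (m + 1))) (fun i => liftTerm (σ (Sum.inr i)))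
      (Term.var (Sum.inr (Fin.last m))))

/-- Simultaneous substitution for the free variables and the variables bound from outside. All the
syntactic operations on formulas that occur in the deduction rules are instances of it. -/
def msub : {n m : ℕ} → L.BoundedFormula α n → (α ⊕ Fin n → L.Term (β ⊕ Fin m)) →
    L.BoundedFormula β m
  | _, _, .falsum, _ => .falsum
  | _, _, .equal s t, σ => .equal (s.subst σ) (t.subst σ)
  | _, _, .rel R ts, σ => .rel R fun i => (ts i).subst σ
  | _, _, .imp φ ψ, σ => .imp (msub φ σ) (msub ψ σ)
  | _, _, .all φ, σ => .all (msub φ (up σ))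

theorem subst_subst (t : L.Term α) (σ : α → L.Term β) (τ : β → L.Term γ) :
    (t.subst σ).subst τ = t.subst fun a => (σ a).subst τ := by
  induction t with
  | var => rfl
  | func f ts ih => simp [Term.subst, ih]

theorem relabel_subst (t : L.Term α) (g : α → β) (τ : β → L.Term γ) :
    (t.relabel g).subst τ = t.subst fun a => τ (g a) := by
  induction t with
  | var => rfl
  | func f ts ih => simp [Term.subst, Term.relabel, ih]

theorem subst_relabel (t : L.Term α) (σ : α → L.Term β) (g : β → γ) :
    (t.subst σ).relabel g = t.subst fun a => (σ a).relabel g := by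
  induction t with
  | var => rfl
  | func f ts ih => simp [Term.subst, Term.relabel, ih]

theorem relabel_eq_subst (t : L.Term α) (g : α → β) :
    t.relabel g = t.subst fun a => Term.var (g a) := by
  induction t with
  | var => rfl
  | func f ts ih => simp [Term.subst, Term.relabel, ih]

theorem subst_var (t : L.Term α) : t.subst Term.var = t := by
  induction t with
  | var => rfl
  | func f ts ih => simp [Term.subst, ih]

theorem liftTerm_subst_up {n m : ℕ} (t : L.Term (α ⊕ Fin n))
    (σ : α ⊕ Fin n → L.Term (β ⊕ Fin m)) :
    (liftTerm t).subst (up σ) = liftTerm (t.subst σ) := by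
  rw [liftTerm, liftTerm, relabel_subst, subst_relabel]
  congr 1
  funext x
  rcases x with x | x <;> simp [up, liftTerm]

theorem up_comp {n m k : ℕ} (σ : α ⊕ Fin n → L.Term (β ⊕ Fin m))
    (τ : β ⊕ Fin m → L.Term (γ ⊕ Fin k)) :
    (fun x => (up σ x).subst (up τ)) = up fun x => (σ x).subst τ := by
  funext x
  rcases x with x | x
  · simp [up, ← liftTerm_subst_up]
  · refine Fin.lastCases ?_ (fun i => ?_) x
    · simp [up, Term.subst]
    · simp [up, ← liftTerm_subst_up]

theorem msub_msub {n m k : ℕ} (φ : L.BoundedFormula α n) (σ : α ⊕ Fin n → L.Term (β ⊕ Fin m))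
    (τ : β ⊕ Fin m → L.Term (γ ⊕ Fin k)) :
    msub (msub φ σ) τ = msub φ fun x => (σ x).subst τ := by
  induction φ generalizing m k with
  | falsum => rfl
  | equal => simp [msub, subst_subst]
  | rel => simp [msub, subst_subst]
  | imp _ _ ih1 ih2 => simp [msub, ih1, ih2]
  | all _ ih => simp [msub, ih, up_comp]

theorem up_var {n : ℕ} : up (L := L) (fun x : α ⊕ Fin n => Term.var x) = Term.var := by
  funext x
  rcases x with x | x
  · rfl
  · refine Fin.lastCases ?_ (fun i => ?_) x
    · simp [up]
    · simp [up, liftTerm]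

theorem msub_var {n : ℕ} (φ : L.BoundedFormula α n) : msub φ (fun x => Term.var x) = φ := by
  induction φ with
  | falsum => rfl
  | equal => simp [msub, subst_var]
  | rel => simp [msub, subst_var]
  | imp _ _ ih1 ih2 => simp [msub, ih1, ih2]
  | all _ ih => simp [msub, up_var, ih]

theorem subst_eq_msub {n : ℕ} (φ : L.BoundedFormula α n) (f : α → L.Term β) :
    φ.subst f = msub φ (Sum.elim (fun a => (f a).relabel Sum.inl) fun i => Term.var (Sum.inr i)) := by
  induction φ with
  | falsum => rfl
  | equal => rfl
  | rel => rfl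
  | imp _ _ ih1 ih2 => exact congrArg₂ BoundedFormula.imp ih1 ih2
  | all φ ih =>
    refine congrArg BoundedFormula.all (ih.trans ?_)
    congr 1
    funext x
    rcases x with x | x
    · simp only [up, liftTerm, Sum.elim_inl, Term.relabel_relabel]
      rfl
    · refine Fin.lastCases ?_ (fun i => ?_) x
      · simp [up]
      · simp [up, liftTerm]

theorem relabel_eq_msub {n k : ℕ} (φ : L.BoundedFormula α k) (g : α → β ⊕ Fin n) :
    φ.relabel g = msub φ fun x => Term.var (BoundedFormula.relabelAux g k x) := by
  induction φ with
  | falsum => rfl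
  | equal =>
    exact congrArg₂ BoundedFormula.equal (relabel_eq_subst _ _) (relabel_eq_subst _ _)
  | rel => exact congrArg _ (funext fun i => relabel_eq_subst _ _)
  | imp _ _ ih1 ih2 => exact congrArg₂ BoundedFormula.imp ih1 ih2
  | @all k φ ih =>
    rw [BoundedFormula.relabel_all]
    refine congrArg BoundedFormula.all (ih.trans ?_)
    congr 1
    funext x
    rcases x with x | x
    · simp only [up, liftTerm, BoundedFormula.relabelAux, Function.comp_apply, Sum.map_inl,
        Sum.elim_inl]
      rcases g x with y | y <;> rfl
    · refine Fin.lastCases ?_ (fun i => ?_) x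
      · simp only [up, BoundedFormula.relabelAux, Function.comp_apply, Sum.map_inr, id_eq,
          Equiv.sumAssoc_apply_inr, finSumFinEquiv_apply_right, Sum.elim_inr, Fin.snoc_last]
        rfl
      · simp only [up, liftTerm, BoundedFormula.relabelAux, Function.comp_apply, Sum.map_inr,
          id_eq, Equiv.sumAssoc_apply_inr, finSumFinEquiv_apply_right, Sum.elim_inr,
          Fin.snoc_castSucc]
        rfl

theorem toFormula_eq_msub {n : ℕ} (φ : L.BoundedFormula α n) :
    φ.toFormula = msub φ fun x => Term.var (Sum.inl x) := by
  induction φ with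
  | falsum => rfl
  | equal =>
    exact congrArg₂ BoundedFormula.equal (relabel_eq_subst _ _) (relabel_eq_subst _ _)
  | rel => exact congrArg _ (funext fun i => relabel_eq_subst _ _)
  | imp _ _ ih1 ih2 => exact congrArg₂ BoundedFormula.imp ih1 ih2
  | @all n φ ih =>
    refine congrArg BoundedFormula.all ?_
    rw [ih, relabel_eq_msub, msub_msub]
    congr 1
    funext x
    rcases x with x | x
    · rfl
    · refine Fin.lastCases ?_ (fun i => ?_) x
      · simp only [up, Term.subst, BoundedFormula.relabelAux, Function.comp_apply, Sum.map_inl,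
          Sum.elim_inr, Fin.snoc_last, finSumFinEquiv_symm_last]
        rfl
      · simp only [up, Term.subst, BoundedFormula.relabelAux, Function.comp_apply, Sum.map_inl,
          Sum.elim_inr, Fin.snoc_castSucc]
        have : finSumFinEquiv.symm (Fin.castSucc i) = (Sum.inl i : Fin n ⊕ Fin 1) :=
          finSumFinEquiv_symm_apply_castAdd i
        rw [this]
        rfl

end Substitution

section Deduction

variable {L : FirstOrder.Language.{0, 0}}

/-- Rename the free variables. -/
def rename {n : ℕ} (f : ℕ → ℕ) (φ : L.BoundedFormula ℕ n) : L.BoundedFormula ℕ n :=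
  msub φ fun x => Term.var (Sum.map f id x)

theorem inst_eq_msub (φ : L.BoundedFormula ℕ 1) (t : L.Term ℕ) :
    inst φ t = msub φ (Sum.elim (fun k => Term.var (Sum.inl k)) fun _ => t.relabel Sum.inl) := by
  rw [inst, subst_eq_msub, toFormula_eq_msub, msub_msub]
  congr 1
  funext x
  rcases x with x | x <;> rfl

theorem body_eq_msub (φ : L.BoundedFormula ℕ 1) :
    body φ = msub φ (Sum.elim (fun k => Term.var (Sum.inl (k + 1)))
      fun _ => Term.var (Sum.inl 0)) := by
  rw [body, subst_eq_msub, toFormula_eq_msub, msub_msub]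
  congr 1
  funext x
  rcases x with x | x <;> rfl

theorem shift_eq_rename (φ : L.Formula ℕ) : shift φ = rename Nat.succ φ := by
  refine (relabel_eq_msub φ _).trans ?_
  refine congrArg (msub φ) ?_
  funext x
  rcases x with x | x
  · rfl
  · exact x.elim0

theorem rename_inst (f : ℕ → ℕ) (φ : L.BoundedFormula ℕ 1) (t : L.Term ℕ) :
    rename f (inst φ t) = inst (rename f φ) (t.relabel f) := by
  rw [rename, rename, inst_eq_msub, inst_eq_msub, msub_msub, msub_msub]
  congr 1
  funext x
  rcases x with x | x
  · rfl
  · simp only [Sum.elim_inr, Term.subst, Sum.map_inr]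
    rw [relabel_subst, Term.relabel_relabel, relabel_eq_subst]
    rfl

theorem rename_equal (f : ℕ → ℕ) (s t : L.Term ℕ) :
    rename f (s.equal t) = (s.relabel f).equal (t.relabel f) := by
  refine congrArg₂ BoundedFormula.equal ?_ ?_ <;>
  · rw [relabel_subst, Term.relabel_relabel, relabel_eq_subst]
    rfl

theorem rename_rename {n : ℕ} (f g : ℕ → ℕ) (φ : L.BoundedFormula ℕ n) :
    rename g (rename f φ) = rename (g ∘ f) φ := by
  rw [rename, rename, msub_msub, rename]
  congr 1
  funext x
  rcases x with x | x <;> rfl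

theorem rename_body (f : ℕ → ℕ) (φ : L.BoundedFormula ℕ 1) :
    rename (fun k => Nat.casesOn k 0 fun j => f j + 1) (body φ) = body (rename f φ) := by
  rw [rename, rename, body_eq_msub, body_eq_msub, msub_msub, msub_msub]
  congr 1
  funext x
  rcases x with x | x <;> rfl

theorem rename_all {f : ℕ → ℕ} (φ : L.BoundedFormula ℕ 1) :
    rename (n := 0) f φ.all = (rename f φ).all := by
  rw [rename, rename, msub]
  congr 2
  funext x
  rcases x with x | x
  · rfl
  · refine Fin.lastCases ?_ (fun i => i.elim0) x
    rfl

theorem Derives.weaken {Γ Δ : Set (L.Formula ℕ)} {φ : L.Formula ℕ} (h : Derives Γ φ)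
    (hs : Γ ⊆ Δ) : Derives Δ φ := by
  induction h generalizing Δ with
  | assumption h => exact .assumption (hs h)
  | impIntro _ ih => exact .impIntro (ih (Set.insert_subset_insert hs))
  | impElim _ _ ih1 ih2 => exact .impElim (ih1 hs) (ih2 hs)
  | byContra _ ih => exact .byContra (ih (Set.insert_subset_insert hs))
  | allIntro _ ih => exact .allIntro (ih (Set.image_mono hs))
  | allElim t _ ih => exact .allElim t (ih hs)
  | eqRefl t => exact .eqRefl t
  | eqSubst φ _ _ ih1 ih2 => exact .eqSubst φ (ih1 hs) (ih2 hs)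

theorem Derives.rename {Γ : Set (L.Formula ℕ)} {φ : L.Formula ℕ} (h : Derives Γ φ) (f : ℕ → ℕ) :
    Derives (FOL.rename f '' Γ) (FOL.rename f φ) := by
  induction h generalizing f with
  | assumption h => exact .assumption ⟨_, h, rfl⟩
  | impIntro _ ih =>
    refine .impIntro ?_
    have := ih f
    rw [Set.image_insert_eq] at this
    exact this
  | impElim _ _ ih1 ih2 => exact .impElim (ih1 f) (ih2 f)
  | byContra _ ih =>
    refine .byContra ?_
    have := ih f
    rw [Set.image_insert_eq] at this
    exact this
  | @allIntro Γ φ _ ih =>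
    rw [rename_all]
    refine .allIntro ?_
    have := ih fun k => Nat.casesOn k 0 fun j => f j + 1
    rw [rename_body] at this
    convert this using 1
    simp only [Set.image_image, shift_eq_rename, rename_rename]
    rfl
  | allElim t _ ih =>
    rw [rename_inst]
    refine .allElim _ ?_
    rw [← rename_all]
    exact ih f
  | eqRefl t =>
    rw [rename_equal]
    exact .eqRefl _
  | @eqSubst Γ φ s t _ _ ih1 ih2 =>
    rw [rename_inst]
    refine .eqSubst (s := s.relabel f) _ ?_ ?_
    · rw [← rename_equal]
      exact ih1 f
    · rw [← rename_inst]
      exact ih2 f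

/-- A derivation from the union of an increasing chain uses one of its members only. -/
theorem Derives.of_iUnion {Γ : Set (L.Formula ℕ)} {φ : L.Formula ℕ} (h : Derives Γ φ)
    (Δ : ℕ → Set (L.Formula ℕ)) (hm : Monotone Δ) (hΓ : Γ ⊆ ⋃ n, Δ n) :
    ∃ n, Derives (Δ n) φ := by
  induction h generalizing Δ with
  | assumption h =>
    obtain ⟨n, hn⟩ := Set.mem_iUnion.1 (hΓ h)
    exact ⟨n, .assumption hn⟩
  | @impIntro Γ φ ψ _ ih =>
    obtain ⟨n, hn⟩ := ih (fun n => insert φ (Δ n))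
      (fun a b hab => Set.insert_subset_insert (hm hab)) (by
        rw [← Set.insert_iUnion]
        exact Set.insert_subset_insert hΓ)
    exact ⟨n, .impIntro hn⟩
  | impElim _ _ ih1 ih2 =>
    obtain ⟨n, hn⟩ := ih1 Δ hm hΓ
    obtain ⟨k, hk⟩ := ih2 Δ hm hΓ
    exact ⟨max n k, .impElim (hn.weaken (hm (le_max_left _ _)))
      (hk.weaken (hm (le_max_right _ _)))⟩
  | @byContra Γ φ _ ih =>
    obtain ⟨n, hn⟩ := ih (fun n => insert φ.not (Δ n))
      (fun a b hab => Set.insert_subset_insert (hm hab)) (by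
        rw [← Set.insert_iUnion]
        exact Set.insert_subset_insert hΓ)
    exact ⟨n, .byContra hn⟩
  | allIntro _ ih =>
    obtain ⟨n, hn⟩ := ih (fun n => shift '' Δ n) (fun a b hab => Set.image_mono (hm hab)) (by
        rw [← Set.image_iUnion]
        exact Set.image_mono hΓ)
    exact ⟨n, .allIntro hn⟩
  | allElim t _ ih =>
    obtain ⟨n, hn⟩ := ih Δ hm hΓ
    exact ⟨n, .allElim t hn⟩
  | eqRefl t => exact ⟨0, .eqRefl t⟩
  | eqSubst φ _ _ ih1 ih2 =>
    obtain ⟨n, hn⟩ := ih1 Δ hm hΓ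
    obtain ⟨k, hk⟩ := ih2 Δ hm hΓ
    exact ⟨max n k, .eqSubst φ (hn.weaken (hm (le_max_left _ _)))
      (hk.weaken (hm (le_max_right _ _)))⟩

/-- A derivation of `φ` from `Γ` and a derivation of `ψ` from `φ` and `Γ` compose. -/
theorem Derives.cut {Γ : Set (L.Formula ℕ)} {φ ψ : L.Formula ℕ} (h : Derives (insert φ Γ) ψ)
    (h' : Derives Γ φ) : Derives Γ ψ :=
  .impElim (.impIntro h) h'

/-- Only variables below `N` matter for the result of a renaming of `φ`. -/
def VarsBelow (N : ℕ) {n : ℕ} (φ : L.BoundedFormula ℕ n) : Prop :=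
  ∀ f g : ℕ → ℕ, (∀ k < N, f k = g k) → rename f φ = rename g φ

theorem exists_term_varsBelow {n : ℕ} (t : L.Term (ℕ ⊕ Fin n)) :
    ∃ N, ∀ f g : ℕ → ℕ, (∀ k < N, f k = g k) →
      t.relabel (Sum.map f id) = t.relabel (Sum.map g id) := by
  induction t with
  | var x =>
    rcases x with x | x
    · exact ⟨x + 1, fun f g h => by simp [h x (Nat.lt_succ_self x)]⟩
    · exact ⟨0, fun f g h => rfl⟩
  | @func k F ts ih =>
    choose N hN using ih
    refine ⟨Finset.univ.sup N, fun f g h => congrArg (Term.func F) (funext fun i => ?_)⟩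
    exact hN i f g fun k hk => h k (hk.trans_le (Finset.le_sup (Finset.mem_univ i)))

theorem up_rename {n : ℕ} (f : ℕ → ℕ) :
    up (L := L) (fun x : ℕ ⊕ Fin n => Term.var (Sum.map f id x)) =
      fun x => Term.var (Sum.map f id x) := by
  funext x
  rcases x with x | x
  · rfl
  · refine Fin.lastCases ?_ (fun i => ?_) x
    · simp [up]
    · simp [up, liftTerm]

theorem exists_varsBelow {n : ℕ} (φ : L.BoundedFormula ℕ n) : ∃ N, VarsBelow N φ := by
  induction φ with
  | falsum => exact ⟨0, fun f g h => rfl⟩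
  | equal s t =>
    obtain ⟨N, hN⟩ := exists_term_varsBelow s
    obtain ⟨K, hK⟩ := exists_term_varsBelow t
    refine ⟨max N K, fun f g h => ?_⟩
    simp only [rename, msub, ← relabel_eq_subst]
    rw [hN f g fun k hk => h k (hk.trans_le (le_max_left _ _)),
      hK f g fun k hk => h k (hk.trans_le (le_max_right _ _))]
  | @rel n l R ts =>
    choose N hN using fun i => exists_term_varsBelow (ts i)
    refine ⟨Finset.univ.sup N, fun f g h => ?_⟩
    simp only [rename, msub, ← relabel_eq_subst]
    refine congrArg _ (funext fun i => ?_)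
    exact hN i f g fun k hk => h k (hk.trans_le (Finset.le_sup (Finset.mem_univ i)))
  | imp _ _ ih1 ih2 =>
    obtain ⟨N, hN⟩ := ih1
    obtain ⟨K, hK⟩ := ih2
    exact ⟨max N K, fun f g h => congrArg₂ BoundedFormula.imp
      (hN f g fun k hk => h k (hk.trans_le (le_max_left _ _)))
      (hK f g fun k hk => h k (hk.trans_le (le_max_right _ _)))⟩
  | all φ ih =>
    obtain ⟨N, hN⟩ := ih
    refine ⟨N, fun f g h => ?_⟩
    simp only [rename, msub, up_rename]
    exact congrArg _ (hN f g h)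

theorem VarsBelow.mono {N K n : ℕ} (h : N ≤ K) {φ : L.BoundedFormula ℕ n} (hφ : VarsBelow N φ) :
    VarsBelow K φ :=
  fun f g hfg => hφ f g fun k hk => hfg k (hk.trans_le h)

/-- Generalization on a variable that does not occur in the assumptions. -/
theorem Derives.all_of_fresh {Γ : Set (L.Formula ℕ)} {χ : L.BoundedFormula ℕ 1} {N : ℕ}
    (hΓ : ∀ φ ∈ Γ, VarsBelow N φ) (hχ : VarsBelow N χ)
    (h : Derives Γ (inst χ (Term.var N))) : Derives Γ χ.all := by
  set f : ℕ → ℕ := fun k => if k = N then 0 else k + 1 with hf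
  have hfg : ∀ k < N, f k = Nat.succ k := fun k hk => by simp [hf, hk.ne]
  refine .allIntro ?_
  have := h.rename f
  rw [rename_inst, hχ f Nat.succ hfg] at this
  convert this using 1
  · refine Set.image_congr fun φ hφ => ?_
    rw [shift_eq_rename, hΓ φ hφ f Nat.succ hfg]
  · rw [body_eq_msub, inst_eq_msub, FOL.rename, msub_msub]
    congr 1
    funext x
    rcases x with x | x
    · rfl
    · simp [Term.subst, Term.relabel, hf]

end Deduction

end FOL

/-! ### Completeness of natural deduction -/

namespace FOL

section Completeness

variable {L : FirstOrder.Language.{0, 0}}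

/-- `Γ` is consistent, and infinitely many variables do not occur in it. -/
def Good (Γ : Set (L.Formula ℕ)) : Prop :=
  ¬ Derives Γ ⊥ ∧ ∃ N, ∀ φ ∈ Γ, VarsBelow N φ

theorem varsBelow_not {N n : ℕ} {φ : L.BoundedFormula ℕ n} (h : VarsBelow N φ) :
    VarsBelow N φ.not :=
  fun f g hfg => congrArg BoundedFormula.not (h f g hfg)

/-- One step of the Henkin construction: decide `ψ`, and provide a counterexample if `ψ` is a
refuted universal formula. -/
theorem Good.step {Γ : Set (L.Formula ℕ)} (h : Good Γ) (ψ : L.Formula ℕ) :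
    ∃ Δ, Γ ⊆ Δ ∧ Good Δ ∧ (ψ ∈ Δ ∨ ψ.not ∈ Δ) ∧
      ∀ χ : L.BoundedFormula ℕ 1, ψ = χ.all → ψ ∈ Δ ∨ ∃ t, (inst χ t).not ∈ Δ := by
  obtain ⟨hc, N, hN⟩ := h
  by_cases hψ : Derives (insert ψ Γ) ⊥
  · have hn : Derives Γ ψ.not := .impIntro hψ
    have hc' : ¬ Derives (insert ψ.not Γ) ⊥ := fun h => hc (h.cut hn)
    obtain ⟨K, hK⟩ := exists_varsBelow ψ
    have hNK : ∀ φ ∈ insert ψ.not Γ, VarsBelow (max N K) φ := by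
      rintro φ (rfl | hφ)
      · exact varsBelow_not (hK.mono (le_max_right _ _))
      · exact (hN φ hφ).mono (le_max_left _ _)
    by_cases hall : ∃ χ : L.BoundedFormula ℕ 1, ψ = χ.all
    · obtain ⟨χ, rfl⟩ := hall
      obtain ⟨J, hJ⟩ := exists_varsBelow χ
      set P := max (max N K) J
      refine ⟨insert (inst χ (Term.var P)).not (insert (BoundedFormula.all χ).not Γ),
        (Set.subset_insert _ _).trans (Set.subset_insert _ _), ⟨fun hd => ?_, ?_⟩,
        .inr (Set.mem_insert_of_mem _ (Set.mem_insert _ _)), ?_⟩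
      · have hall := Derives.all_of_fresh (N := P)
          (fun φ hφ => (hNK φ hφ).mono (le_max_left _ _)) (hJ.mono (le_max_right _ _))
          (Derives.byContra hd)
        exact hc' (.impElim (.assumption (Set.mem_insert _ _)) hall)
      · obtain ⟨Q, hQ⟩ := exists_varsBelow (inst χ (Term.var P))
        refine ⟨max P Q, ?_⟩
        rintro φ (rfl | hφ)
        · exact varsBelow_not (hQ.mono (le_max_right _ _))
        · exact (hNK φ hφ).mono ((le_max_left _ _).trans (le_max_left _ _))
      · rintro χ' h
        obtain rfl : χ = χ' := by injection h
        exact .inr ⟨_, Set.mem_insert _ _⟩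
    · exact ⟨insert ψ.not Γ, Set.subset_insert _ _, ⟨hc', _, hNK⟩, .inr (Set.mem_insert _ _),
        fun χ h => absurd ⟨χ, h⟩ hall⟩
  · obtain ⟨K, hK⟩ := exists_varsBelow ψ
    refine ⟨insert ψ Γ, Set.subset_insert _ _, ⟨hψ, max N K, ?_⟩, .inl (Set.mem_insert _ _),
      fun χ h => .inl (Set.mem_insert _ _)⟩
    rintro φ (rfl | hφ)
    · exact hK.mono (le_max_right _ _)
    · exact (hN φ hφ).mono (le_max_left _ _)

/-- A maximal consistent set in which every refuted universal formula has a counterexample. -/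
structure Henkin (Δ : Set (L.Formula ℕ)) : Prop where
  consistent : ¬ Derives Δ ⊥
  complete : ∀ ψ, ψ ∈ Δ ∨ ψ.not ∈ Δ
  witness : ∀ χ : L.BoundedFormula ℕ 1, χ.all ∈ Δ ∨ ∃ t, (inst χ t).not ∈ Δ

theorem Good.exists_henkin [Countable (L.Formula ℕ)] {Γ : Set (L.Formula ℕ)} (h : Good Γ) :
    ∃ Δ, Γ ⊆ Δ ∧ Henkin Δ := by
  have : Nonempty (L.Formula ℕ) := ⟨⊥⟩
  obtain ⟨e, he⟩ := exists_surjective_nat (L.Formula ℕ)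
  choose f hf hg hd hw using fun (Γ : {Γ : Set (L.Formula ℕ) // Good Γ}) => Γ.2.step
  let S : ℕ → {Γ : Set (L.Formula ℕ) // Good Γ} :=
    fun n => Nat.rec ⟨Γ, h⟩ (fun n Γ => ⟨f Γ (e n), hg Γ (e n)⟩) n
  have hm : Monotone fun n => (S n).1 := monotone_nat_of_le_succ fun n => hf (S n) (e n)
  refine ⟨⋃ n, (S n).1, Set.subset_iUnion (fun n => (S n).1) 0, ⟨fun hd => ?_, fun ψ => ?_,
    fun χ => ?_⟩⟩
  · obtain ⟨n, hn⟩ := hd.of_iUnion _ hm subset_rfl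
    exact (S n).2.1 hn
  · obtain ⟨n, rfl⟩ := he ψ
    exact (hd (S n) (e n)).imp (fun h => Set.mem_iUnion.2 ⟨n + 1, h⟩)
      fun h => Set.mem_iUnion.2 ⟨n + 1, h⟩
  · obtain ⟨n, hn⟩ := he χ.all
    refine (hw (S n) (e n) χ hn).imp (fun h => Set.mem_iUnion.2 ⟨n + 1, hn ▸ h⟩) ?_
    rintro ⟨t, ht⟩
    exact ⟨t, Set.mem_iUnion.2 ⟨n + 1, ht⟩⟩

theorem Henkin.mem_iff {Δ : Set (L.Formula ℕ)} (hΔ : Henkin Δ) {φ : L.Formula ℕ} :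
    φ ∈ Δ ↔ Derives Δ φ := by
  refine ⟨.assumption, fun h => (hΔ.complete φ).resolve_right fun hn => hΔ.consistent ?_⟩
  exact .impElim (.assumption hn) h

theorem inst_equal_lift (s t : L.Term ℕ) (w : L.Term (ℕ ⊕ Fin 1)) :
    inst (BoundedFormula.equal (s.relabel Sum.inl) w) t =
      s.equal (w.subst (Sum.elim Term.var fun _ => t)) := by
  rw [inst_eq_msub]
  refine congrArg₂ BoundedFormula.equal ?_ ?_
  · exact (relabel_subst _ _ _).trans (relabel_eq_subst _ _).symm
  · rw [subst_relabel]
    congr 1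
    funext x
    rcases x with x | x <;> rfl

theorem Derives.eq_rewrite {Γ : Set (L.Formula ℕ)} {s t u : L.Term ℕ} (w : L.Term (ℕ ⊕ Fin 1))
    (h : Derives Γ (s.equal t))
    (hu : Derives Γ (u.equal (w.subst (Sum.elim Term.var fun _ => s)))) :
    Derives Γ (u.equal (w.subst (Sum.elim Term.var fun _ => t))) := by
  rw [← inst_equal_lift] at hu ⊢
  exact .eqSubst _ h hu

theorem Derives.eq_trans {Γ : Set (L.Formula ℕ)} {s t u : L.Term ℕ} (h : Derives Γ (s.equal t))
    (h' : Derives Γ (t.equal u)) : Derives Γ (s.equal u) :=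
  Derives.eq_rewrite (s := t) (Term.var (Sum.inr 0)) h' h

theorem Derives.eq_symm {Γ : Set (L.Formula ℕ)} {s t : L.Term ℕ} (h : Derives Γ (s.equal t)) :
    Derives Γ (t.equal s) := by
  have := Derives.eqSubst (Γ := Γ)
    (BoundedFormula.equal (Term.var (Sum.inr 0)) (s.relabel Sum.inl)) h
  have key : ∀ r : L.Term ℕ, inst (BoundedFormula.equal (Term.var (Sum.inr 0))
      (s.relabel Sum.inl)) r = r.equal s := by
    intro r
    rw [inst_eq_msub]
    exact congrArg₂ BoundedFormula.equal rfl
      ((relabel_subst _ _ _).trans (relabel_eq_subst _ _).symm)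
  rw [key, key] at this
  exact this (.eqRefl s)

theorem Derives.eq_congr {Γ : Set (L.Formula ℕ)} {n : ℕ} (F : L.Functions n)
    {s t : Fin n → L.Term ℕ} (h : ∀ i, Derives Γ ((s i).equal (t i))) :
    Derives Γ ((Term.func F s).equal (Term.func F t)) := by
  classical
  suffices H : ∀ S : Finset (Fin n),
      Derives Γ ((Term.func F s).equal (Term.func F (S.piecewise t s))) by
    simpa using H Finset.univ
  intro S
  induction S using Finset.induction_on with
  | empty => simpa using Derives.eqRefl _
  | insert i S hi ih =>
    have key : ∀ r, Term.subst (Term.func F fun j => if j = i then Term.var (Sum.inr 0) else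
        (S.piecewise t s j).relabel Sum.inl) (Sum.elim Term.var fun _ : Fin 1 => r) =
        Term.func F fun j => if j = i then r else S.piecewise t s j := by
      intro r
      refine congrArg (Term.func F) (funext fun j => ?_)
      by_cases hj : j = i
      · simp [hj, Term.subst]
      · simp only [hj, if_false]
        exact (relabel_subst _ _ _).trans (subst_var _)
    have := Derives.eq_rewrite (u := Term.func F s) (Term.func F fun j =>
      if j = i then Term.var (Sum.inr 0) else (S.piecewise t s j).relabel Sum.inl) (h i)
    rw [key, key] at this
    convert this ?_ using 3
    · funext j
      by_cases hj : j = i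
      · subst hj
        simp
      · simp [Finset.piecewise, hj]
    · convert ih using 3
      funext j
      by_cases hj : j = i
      · subst hj
        simp [hi]
      · simp [hj]

/-- Terms are identified if `Δ` proves them equal. -/
def termSetoid (Δ : Set (L.Formula ℕ)) : Setoid (L.Term ℕ) where
  r s t := Derives Δ (s.equal t)
  iseqv := ⟨.eqRefl, .eq_symm, .eq_trans⟩

/-- The universe of the term model. -/
def TermModel (Δ : Set (L.Formula ℕ)) : Type := Quotient (termSetoid Δ)

/-- The class of a term in the term model. -/
def TermModel.mk (Δ : Set (L.Formula ℕ)) (t : L.Term ℕ) : TermModel Δ :=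
  Quotient.mk (termSetoid Δ) t

theorem TermModel.mk_eq {Δ : Set (L.Formula ℕ)} {s t : L.Term ℕ} :
    TermModel.mk Δ s = TermModel.mk Δ t ↔ Derives Δ (s.equal t) :=
  Quotient.eq (r := termSetoid Δ)

noncomputable instance [∀ n, IsEmpty (L.Relations n)] (Δ : Set (L.Formula ℕ)) :
    L.Structure (TermModel Δ) where
  funMap F x := TermModel.mk Δ (Term.func F fun i => (x i).out)
  RelMap R := isEmptyElim R

theorem TermModel.realize_term [∀ n, IsEmpty (L.Relations n)] {Δ : Set (L.Formula ℕ)}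
    {α : Type} (t : L.Term α)
    (σ : α → L.Term ℕ) :
    t.realize (fun a => TermModel.mk Δ (σ a)) = TermModel.mk Δ (t.subst σ) := by
  induction t with
  | var => rfl
  | func F ts ih =>
    refine TermModel.mk_eq.2 (.eq_congr F fun i => ?_)
    exact TermModel.mk_eq.1 (Eq.trans (Quotient.out_eq _) (ih i))

/-- Substitute the terms `xs` for the variables bound from outside. -/
def plug {n : ℕ} (xs : Fin n → L.Term ℕ) : ℕ ⊕ Fin n → L.Term (ℕ ⊕ Fin 0) :=
  fun x => (Sum.elim Term.var xs x).relabel Sum.inl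

theorem inst_msub_up {n : ℕ} (φ : L.BoundedFormula ℕ (n + 1)) (xs : Fin n → L.Term ℕ)
    (t : L.Term ℕ) :
    inst (msub φ (up (plug xs))) t =
      msub φ (plug (Fin.snoc (α := fun _ => L.Term ℕ) xs t)) := by
  rw [inst_eq_msub, msub_msub]
  congr 1
  funext x
  have key : ∀ s : L.Term ℕ, (liftTerm (n := 0) (s.relabel Sum.inl)).subst
      (Sum.elim (fun k => Term.var (Sum.inl k)) fun _ => t.relabel Sum.inl) =
      (s.relabel Sum.inl : L.Term (ℕ ⊕ Fin 0)) := by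
    intro s
    rw [liftTerm, Term.relabel_relabel]
    exact (relabel_subst _ _ _).trans (relabel_eq_subst _ _).symm
  rcases x with x | x
  · exact key _
  · refine Fin.lastCases ?_ (fun i => ?_) x
    · simp [up, plug, Term.subst]
    · simpa [up, plug] using key (xs i)

theorem Henkin.realize_iff [∀ n, IsEmpty (L.Relations n)] {Δ : Set (L.Formula ℕ)}
    (hΔ : Henkin Δ) {n : ℕ}
    (φ : L.BoundedFormula ℕ n) (xs : Fin n → L.Term ℕ) :
    φ.Realize (fun k => TermModel.mk Δ (Term.var k)) (fun i => TermModel.mk Δ (xs i)) ↔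
      msub φ (plug xs) ∈ Δ := by
  induction φ with
  | falsum => exact ⟨False.elim, fun h => hΔ.consistent (.assumption h)⟩
  | equal s t =>
    have key : ∀ s : L.Term (ℕ ⊕ Fin _), s.realize (Sum.elim (fun k => TermModel.mk Δ (Term.var k))
        fun i => TermModel.mk Δ (xs i)) = TermModel.mk Δ (s.subst (Sum.elim Term.var xs)) := by
      intro s
      rw [← TermModel.realize_term]
      congr 1
      funext x
      rcases x with x | x <;> rfl
    simp only [BoundedFormula.Realize, key, TermModel.mk_eq, hΔ.mem_iff, msub]
    rw [Term.equal, Term.bdEqual, subst_relabel, subst_relabel]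
    rfl
  | rel R => exact isEmptyElim R
  | imp φ ψ ih1 ih2 =>
    simp only [BoundedFormula.realize_imp, ih1, ih2, msub]
    rw [hΔ.mem_iff (φ := (msub φ _).imp _)]
    constructor
    · intro h
      by_cases hφ : msub φ (plug xs) ∈ Δ
      · exact .impIntro ((hΔ.mem_iff.1 (h hφ)).weaken (Set.subset_insert _ _))
      · have := (hΔ.complete _).resolve_left hφ
        refine .impIntro (.byContra (.impElim (φ := msub φ (plug xs)) (.assumption ?_)
          (.assumption ?_)))
        · exact Set.mem_insert_of_mem _ (Set.mem_insert_of_mem _ this)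
        · exact Set.mem_insert_of_mem _ (Set.mem_insert _ _)
    · intro h hφ
      exact hΔ.mem_iff.2 (.impElim h (.assumption hφ))
  | all φ ih =>
    simp only [BoundedFormula.realize_all, msub]
    constructor
    · intro h
      refine (hΔ.witness (msub φ (up (plug xs)))).resolve_right ?_
      rintro ⟨t, ht⟩
      rw [inst_msub_up] at ht
      refine hΔ.consistent (.impElim (.assumption ht) (.assumption ((ih _).1 ?_)))
      convert h (TermModel.mk Δ t) using 1
      funext i
      refine Fin.lastCases ?_ (fun i => ?_) i <;> simp
    · intro h a
      obtain ⟨t, rfl⟩ : ∃ t, TermModel.mk Δ t = a := Quotient.exists_rep a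
      have := (ih (Fin.snoc (α := fun _ => L.Term ℕ) xs t)).2 (by
        rw [← inst_msub_up, hΔ.mem_iff]
        exact .allElim t (.assumption h))
      convert this using 1
      funext i
      refine Fin.lastCases ?_ (fun i => ?_) i <;> simp

theorem ofSentence_varsBelow (σ : L.Sentence) : VarsBelow 0 (ofSentence σ) := by
  intro f g _
  rw [rename, rename, ofSentence, Formula.relabel, relabel_eq_msub]
  refine (msub_msub (m := 0) _ _ _).trans (Eq.trans ?_ (msub_msub (m := 0) _ _ _).symm)
  congr 1
  funext x
  rcases x with x | x
  · exact x.elim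
  · exact x.elim0

/-- Gödel's completeness theorem for countable languages without relation symbols. -/
theorem proves_of_forall_models [∀ n, IsEmpty (L.Relations n)] [Countable (L.Formula ℕ)]
    {T : L.Theory} {σ : L.Sentence}
    (h : ∀ (M : Type) [L.Structure M] [Nonempty M], M ⊨ T → M ⊨ σ) : Proves T σ := by
  by_contra hσ
  have hG : Good (insert (ofSentence σ).not (ofSentence '' T)) := by
    refine ⟨fun hd => hσ (.byContra hd), 0, ?_⟩
    rintro φ (rfl | ⟨τ, -, rfl⟩)
    · exact varsBelow_not (ofSentence_varsBelow σ)
    · exact ofSentence_varsBelow τ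
  obtain ⟨Δ, hsub, hΔ⟩ := hG.exists_henkin
  have : Nonempty (TermModel Δ) := ⟨TermModel.mk Δ (Term.var 0)⟩
  have key : ∀ τ : L.Sentence, TermModel Δ ⊨ τ ↔ ofSentence τ ∈ Δ := by
    intro τ
    have h1 := hΔ.realize_iff (ofSentence τ) Fin.elim0
    have h2 : msub (ofSentence τ) (plug Fin.elim0) = ofSentence τ := by
      refine Eq.trans ?_ (msub_var _)
      congr 1
      funext x
      rcases x with x | x
      · rfl
      · exact x.elim0
    rw [h2] at h1
    rw [← h1]
    have : (ofSentence τ).Realize (fun k => TermModel.mk Δ (Term.var k)) ↔ TermModel Δ ⊨ τ := by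
      rw [ofSentence, Formula.realize_relabel, Sentence.Realize, Unique.eq_default (_ ∘ _)]
    rw [← this, Formula.Realize]
    congr!
  have hT : TermModel Δ ⊨ T :=
    ⟨fun τ hτ => (key τ).2 (hsub (Set.mem_insert_of_mem _ ⟨τ, hτ, rfl⟩))⟩
  exact hΔ.consistent (.impElim (.assumption (hsub (Set.mem_insert _ _)))
    (.assumption ((key σ).1 (h _ hT))))

end Completeness

end FOL

/-! ### Countability of the language -/

namespace ALV

/-- A numerical code of a symbol of `ALV`. -/
def code : {n : ℕ} → ALV n → ℕ
  | _, zero => Nat.pair 0 0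
  | _, s0 => Nat.pair 1 0
  | _, s1 => Nat.pair 2 0
  | _, proj _ i => Nat.pair 3 i
  | _, bit => Nat.pair 4 0
  | _, len => Nat.pair 5 0
  | _, smash => Nat.pair 6 0
  | _, andF => Nat.pair 7 0
  | _, orF => Nat.pair 8 0
  | _, tree => Nat.pair 9 0
  | _, comp (k := k) f g =>
      Nat.pair 10 (Nat.pair k (Nat.pair f.code (Encodable.encode (List.ofFn fun i => (g i).code))))
  | _, crn g h0 h1 => Nat.pair 11 (Nat.pair g.code (Nat.pair h0.code h1.code))

theorem code_injective {n : ℕ} (F G : ALV n) (h : F.code = G.code) : F = G := by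
  induction F with
  | @comp k n f g ihf ihg =>
    cases G with
    | @comp k' _ f' g' =>
      simp only [code, Nat.pair_eq_pair, Encodable.encode_inj, true_and] at h
      obtain ⟨rfl, hf, hg⟩ := h
      have hg := List.ofFn_injective hg
      rw [ihf f' hf, funext fun i => ihg i (g' i) (congrFun hg i)]
    | _ => simp [code, Nat.pair_eq_pair] at h
  | crn g h0 h1 ihg ih0 ih1 =>
    cases G with
    | crn g0 h0 h1 =>
      simp only [code, Nat.pair_eq_pair, true_and] at h
      rw [ihg _ h.1, ih0 _ h.2.1, ih1 _ h.2.2]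
    | _ => simp [code, Nat.pair_eq_pair] at h
  | proj n i =>
    cases G with
    | proj _ j =>
      simp only [code, Nat.pair_eq_pair, true_and] at h
      rw [Fin.ext h]
    | _ => simp [code, Nat.pair_eq_pair] at h
  | _ =>
    cases G with
    | _ => first | rfl | simp [code, Nat.pair_eq_pair] at h

instance (n : ℕ) : Countable (ALV n) :=
  Function.Injective.countable (f := code) fun F G => code_injective F G

end ALV

instance : Countable LALV.Symbols :=
  haveI : Countable (Σ l, LALV.Functions l) := inferInstanceAs (Countable (Σ l, ALV l))
  haveI : Countable (Σ l, LALV.Relations l) := inferInstanceAs (Countable (Σ _ : ℕ, Empty))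
  inferInstanceAs (Countable ((Σ l, LALV.Functions l) ⊕ (Σ l, LALV.Relations l)))

instance (n : ℕ) : IsEmpty (LALV.Relations n) := inferInstanceAs (IsEmpty Empty)

/-- To prove the universal closure of `φ` in `T`, it suffices to verify `φ` in all models. -/
theorem FOL.proves_univClosure {T : LALV.Theory} {k : ℕ} (φ : LALV.Formula (Fin k))
    (h : ∀ (M : Type) [LALV.Structure M] [Nonempty M], M ⊨ T → ∀ v : Fin k → M, φ.Realize v) :
    FOL.Proves T (FOL.univClosure φ) := by
  refine FOL.proves_of_forall_models fun M _ _ hM => ?_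
  rw [univClosure, Sentence.Realize, BoundedFormula.realize_alls]
  intro v
  exact (Formula.realize_relabel_sumInr φ).2 (h M hM v)

/-! ### Models of the theory -/

/-- A model of `QALV`. -/
structure Mdl where
  carrier : Type
  [str : LALV.Structure carrier]
  model : carrier ⊨ QALV.theory

namespace Mdl

instance : CoeSort Mdl Type := ⟨Mdl.carrier⟩
instance (M : Mdl) : LALV.Structure M := M.str

variable {M : Mdl}

/-- The value of a symbol of `ALV` in a model. -/
def ev {n : ℕ} (F : ALV n) (v : Fin n → M) : M := Structure.funMap (L := LALV) (M := M) F v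

theorem realize_app {n : ℕ} {α : Type} (F : ALV n) (t : Fin n → LALV.Term α) (v : α → M) :
    (QALV.app F t).realize v = ev F fun i => (t i).realize v := rfl

theorem realize_axiom {k : ℕ} {φ : LALV.Formula (Fin k)} (h : QALV.Axiom φ) (v : Fin k → M) :
    φ.Realize v := by
  have := M.model.realize_of_mem _ ⟨k, φ, h, rfl⟩
  rw [FOL.univClosure, Sentence.Realize, BoundedFormula.realize_alls] at this
  exact (Formula.realize_relabel_sumInr φ).1 (this v)

end Mdl

namespace Mdl

variable {M : Mdl}

/-! ### Quantifier-free definability and induction on notation -/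

/-- `f` is given by a term with parameters. The instances below let class inference build the term;
the ones named `eta` cover functions that have been eta-reduced. The finite set `s` contains the
parameters; the term is over the variables `none` (the argument) and `some m` (the parameter `m`). -/
class TD (f : M → M) : Prop where
  out : ∃ (s : Finset M) (t : LALV.Term (Option M)), ∀ (x : M) (v : M → M), (∀ m ∈ s, v m = m) →
    t.realize (fun o => o.elim x v) = f x

/-- A vector of functions that are given by terms with parameters. -/
class TDv {n : ℕ} (a : M → Fin n → M) : Prop where
  out : ∀ i, TD fun x => a x i

/-- `P` is given by a quantifier-free formula with parameters. -/
class QD (P : M → Prop) : Prop where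
  out : ∃ (s : Finset M) (φ : LALV.Formula (Option M)), φ.IsQF ∧
    ∀ (x : M) (v : M → M), (∀ m ∈ s, v m = m) → (φ.Realize (fun o => o.elim x v) ↔ P x)

instance TD.id : TD fun x : M => x := ⟨∅, Term.var none, fun _ _ _ => rfl⟩

instance TD.const (c : M) : TD fun _ : M => c :=
  ⟨{c}, Term.var (some c), fun _ _ h => h c (Finset.mem_singleton_self c)⟩

instance TD.ev {n : ℕ} (F : ALV n) (a : M → Fin n → M) [h : TDv a] : TD fun x => ev F (a x) := by
  classical
  choose s t ht using fun i => (h.out i).out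
  refine ⟨Finset.univ.biUnion s, QALV.app F t, fun x v hv => ?_⟩
  rw [realize_app]
  congr 1
  funext i
  exact ht i x v fun m hm => hv m (Finset.mem_biUnion.2 ⟨i, Finset.mem_univ i, hm⟩)

instance TDv.const {n : ℕ} (v : Fin n → M) : TDv fun _ : M => v := ⟨fun _ => TD.const _⟩

instance TDv.cons {n : ℕ} (f : M → M) (a : M → Fin n → M) [TD f] [h : TDv a] :
    TDv fun x => (Fin.cons (f x) (a x) : Fin (n + 1) → M) :=
  ⟨fun i => by
    refine Fin.cases ?_ (fun i => ?_) i
    · simpa using ‹TD f›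
    · simpa using h.out i⟩

instance TDv.vecCons {n : ℕ} (f : M → M) (a : M → Fin n → M) [TD f] [TDv a] :
    TDv fun x => Matrix.vecCons (f x) (a x) :=
  TDv.cons f a

instance TDv.snoc {n : ℕ} (f : M → M) (a : M → Fin n → M) [TD f] [h : TDv a] :
    TDv fun x => (Fin.snoc (α := fun _ => M) (a x) (f x) : Fin (n + 1) → M) :=
  ⟨fun i => by
    refine Fin.lastCases ?_ (fun i => ?_) i
    · simpa using ‹TD f›
    · simpa using h.out i⟩

instance QD.eq (f g : M → M) [hf : TD f] [hg : TD g] : QD fun x => f x = g x := by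
  classical
  obtain ⟨s, t, ht⟩ := hf.out
  obtain ⟨s', t', ht'⟩ := hg.out
  refine ⟨s ∪ s', t.equal t', (BoundedFormula.IsAtomic.equal _ _).isQF, fun x v hv => ?_⟩
  rw [Formula.realize_equal, ht x v fun m hm => hv m (Finset.mem_union_left _ hm),
    ht' x v fun m hm => hv m (Finset.mem_union_right _ hm)]

instance QD.eta_eq (a : M) : QD (Eq a) := QD.eq (fun _ => a) fun x => x

instance QD.imp (P Q : M → Prop) [hP : QD P] [hQ : QD Q] : QD fun x => P x → Q x := by
  classical
  obtain ⟨s, φ, hφ, h⟩ := hP.out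
  obtain ⟨s', φ', hφ', h'⟩ := hQ.out
  refine ⟨s ∪ s', φ.imp φ', hφ.imp hφ', fun x v hv => ?_⟩
  rw [Formula.realize_imp, h x v fun m hm => hv m (Finset.mem_union_left _ hm),
    h' x v fun m hm => hv m (Finset.mem_union_right _ hm)]

instance QD.const (p : Prop) : QD fun _ : M => p := by
  by_cases hp : p
  · exact ⟨∅, ⊤, BoundedFormula.IsQF.top, fun x v _ => iff_of_true (by simp) hp⟩
  · exact ⟨∅, ⊥, BoundedFormula.isQF_bot, fun x v _ => iff_of_false (by simp) hp⟩

theorem QD.congr {P Q : M → Prop} (hP : QD P) (h : ∀ x, P x ↔ Q x) : QD Q := by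
  rwa [show Q = P from funext fun x => propext (h x).symm]

instance QD.not (P : M → Prop) [QD P] : QD fun x => ¬ P x := QD.imp P fun _ => False

instance QD.ne (f g : M → M) [TD f] [TD g] : QD fun x => f x ≠ g x :=
  QD.not fun x => f x = g x

instance QD.or (P Q : M → Prop) [QD P] [QD Q] : QD fun x => P x ∨ Q x :=
  (inferInstance : QD fun x => ¬ P x → Q x).congr fun _ => or_iff_not_imp_left.symm

instance QD.and (P Q : M → Prop) [QD P] [QD Q] : QD fun x => P x ∧ Q x :=
  (inferInstance : QD fun x => ¬ (P x → ¬ Q x)).congr fun x => by tauto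

instance QD.iff (P Q : M → Prop) [QD P] [QD Q] : QD fun x => (P x ↔ Q x) :=
  (inferInstance : QD fun x => (P x → Q x) ∧ (Q x → P x)).congr fun _ => iff_def.symm

theorem realize_substLast {k : ℕ} {β : Type} (φ : LALV.Formula (Fin (k + 1)))
    (v : Fin k → LALV.Term β) (t : LALV.Term β) (w : β → M) :
    (FOL.substLast φ v t).Realize w ↔
      φ.Realize (Fin.snoc (α := fun _ => M) (fun i => (v i).realize w) (t.realize w)) := by
  rw [FOL.substLast, Formula.Realize, BoundedFormula.realize_subst, Formula.Realize]
  congr!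
  rename_i i
  refine Fin.lastCases ?_ (fun i => ?_) i <;> simp

theorem realize_bindLast {k : ℕ} (φ : LALV.Formula (Fin (k + 1))) (v : Fin k → M) (x : M) :
    (FOL.bindLast φ).Realize v (Fin.snoc (α := fun _ => M) default x) ↔
      φ.Realize (Fin.snoc (α := fun _ => M) v x) := by
  rw [FOL.bindLast, Formula.Realize]
  refine BoundedFormula.realize_relabel.trans ?_
  have : Sum.elim v ((Fin.snoc default x : Fin 1 → M) ∘ Fin.castAdd 0) ∘
      (Fin.snoc (fun i => Sum.inl i) (Sum.inr 0) : Fin (k + 1) → Fin k ⊕ Fin 1) =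
      Fin.snoc v x := by
    funext i
    refine Fin.lastCases ?_ (fun i => ?_) i
    · simp [Fin.snoc]
    · simp
  rw [← this]
  exact iff_of_eq (congrArg _ (Subsingleton.elim _ _))

/-! ### The initial functions -/

instance : Zero M := ⟨ev ALV.zero ![]⟩

theorem zero_def : (0 : M) = ev ALV.zero ![] := rfl

/-- The binary successor `x ↦ 2x`. -/
def s0 (x : M) : M := ev ALV.s0 ![x]
/-- The binary successor `x ↦ 2x + 1`. -/
def s1 (x : M) : M := ev ALV.s1 ![x]

instance TD.s0 (f : M → M) [TD f] : TD fun x => s0 (f x) := TD.ev ALV.s0 fun x => ![f x]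
instance TD.s1 (f : M → M) [TD f] : TD fun x => s1 (f x) := TD.ev ALV.s1 fun x => ![f x]
instance TD.eta_s0 : TD (Mdl.s0 : M → M) := TD.s0 fun x => x
instance TD.eta_s1 : TD (Mdl.s1 : M → M) := TD.s1 fun x => x

open Classical in
/-- Append the digit `1` if `b` holds, and the digit `0` otherwise. -/
noncomputable def sB (b : Prop) (x : M) : M := if b then s1 x else s0 x

@[simp] theorem sB_true (x : M) : sB True x = s1 x := if_pos trivial
@[simp] theorem sB_false (x : M) : sB False x = s0 x := if_neg id
theorem sB_pos {b : Prop} (h : b) (x : M) : sB b x = s1 x := if_pos h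
theorem sB_neg {b : Prop} (h : ¬ b) (x : M) : sB b x = s0 x := if_neg h

instance TD.sB (b : Prop) (f : M → M) [TD f] : TD fun x => sB b (f x) := by
  by_cases h : b
  · simpa only [sB_pos h] using TD.s1 f
  · simpa only [sB_neg h] using TD.s0 f

theorem realize_notationInduction {k : ℕ} (φ : LALV.Formula (Fin (k + 1))) (v : Fin k → M) :
    (QALV.notationInduction φ).Realize v ↔
      ((φ.Realize (Fin.snoc (α := fun _ => M) v 0) ∧
        ∀ x, φ.Realize (Fin.snoc (α := fun _ => M) v x) →
          φ.Realize (Fin.snoc (α := fun _ => M) v (s0 x)) ∧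
            φ.Realize (Fin.snoc (α := fun _ => M) v (s1 x))) →
        ∀ x, φ.Realize (Fin.snoc (α := fun _ => M) v x)) := by
  have e0 : ∀ w : Fin 0 → M, (ev ALV.zero w : M) = 0 := fun w =>
    congrArg (ev ALV.zero) (Subsingleton.elim _ _)
  have e1 : ∀ (F : ALV 1) (x : M) (t : LALV.Term (Fin (k + 1))) (w : Fin (k + 1) → M),
      ev F (fun i => ((![t] : Fin 1 → _) i).realize w) = ev F ![t.realize w] := fun F x t w =>
    congrArg _ (funext fun i => by fin_cases i; rfl)
  have eall : ∀ φ : LALV.BoundedFormula (Fin k) 1, Formula.Realize φ.all v ↔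
      ∀ x, φ.Realize v (Fin.snoc (α := fun _ => M) default x) := fun φ => Iff.rfl
  rw [QALV.notationInduction, Formula.realize_imp, Formula.realize_inf, realize_substLast,
    eall, eall]
  simp only [realize_bindLast, Formula.realize_imp, Formula.realize_inf, realize_substLast,
    QALV.s0, QALV.s1, QALV.zero, realize_app, Term.realize_var, Fin.snoc_castSucc, e0, s0, s1,
    Matrix.cons_fin_one, Fin.snoc_last]

instance TD.eta_sB (b : Prop) : TD (Mdl.sB b : M → M) := TD.sB b fun x => x

/-- Induction on notation for quantifier-free properties with parameters. -/
theorem notation_induction {P : M → Prop} [h : QD P] (h0 : P 0)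
    (hs : ∀ x, P x → ∀ b, P (sB b x)) (x : M) : P x := by
  classical
  obtain ⟨s, φ, hφ, h⟩ := h.out
  let e := s.equivFin
  let g : Option M → Fin (s.card + 1) := fun o =>
    o.elim (Fin.last _) fun m => if hm : m ∈ s then (e ⟨m, hm⟩).castSucc else Fin.last _
  let a : Fin s.card → M := fun i => (e.symm i : M)
  have key : ∀ x, (Formula.relabel g φ).Realize (Fin.snoc (α := fun _ => M) a x) ↔ P x := by
    intro x
    rw [Formula.realize_relabel, ← h x (fun m => if m ∈ s then m else x) fun m hm => if_pos hm]
    refine iff_of_eq (congrArg _ (funext fun o => ?_))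
    rcases o with _ | m
    · simp [g]
    · by_cases hm : m ∈ s
      · simp [g, hm, a]
      · simp [g, hm]
  have hax := (realize_notationInduction _ _).1
    (realize_axiom (M := M) (QALV.Axiom.induction (Formula.relabel g φ) (hφ.relabel _)) a)
  refine (key x).1 (hax ⟨(key 0).2 h0, fun x hx => ?_⟩ x)
  have hx := hs x ((key x).1 hx)
  exact ⟨(key _).2 (by simpa using hx False), (key _).2 (by simpa using hx True)⟩

end Mdl

namespace Mdl

variable {M : Mdl}

/-! ### The axioms as equations -/

theorem ev_comp {k n : ℕ} (f : ALV k) (g : Fin k → ALV n) (v : Fin n → M) :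
    ev (ALV.comp f g) v = ev f fun i => ev (g i) v := by
  simpa [realize_app] using realize_axiom (M := M) (QALV.Axiom.comp f g) v

@[simp] theorem ev_proj {n : ℕ} (i : Fin n) (v : Fin n → M) : ev (ALV.proj n i) v = v i := by
  simpa [realize_app] using realize_axiom (M := M) (QALV.Axiom.proj n i) v

@[simp] theorem ev_comp0 {n : ℕ} (f : ALV 0) (g : Fin 0 → ALV n) (v : Fin n → M) :
    ev (ALV.comp f g) v = ev f ![] := by
  rw [ev_comp]
  exact congrArg _ (Subsingleton.elim _ _)

@[simp] theorem ev_comp1 {n : ℕ} (f : ALV 1) (a : ALV n) (v : Fin n → M) :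
    ev (ALV.comp f ![a]) v = ev f ![ev a v] := by
  rw [ev_comp]
  exact congrArg _ (funext fun i => by fin_cases i; rfl)

@[simp] theorem ev_comp2 {n : ℕ} (f : ALV 2) (a b : ALV n) (v : Fin n → M) :
    ev (ALV.comp f ![a, b]) v = ev f ![ev a v, ev b v] := by
  rw [ev_comp]
  exact congrArg _ (funext fun i => by fin_cases i <;> rfl)

@[simp] theorem ev_comp3 {n : ℕ} (f : ALV 3) (a b c : ALV n) (v : Fin n → M) :
    ev (ALV.comp f ![a, b, c]) v = ev f ![ev a v, ev b v, ev c v] := by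
  rw [ev_comp]
  exact congrArg _ (funext fun i => by fin_cases i <;> rfl)

@[simp] theorem ev_comp4 {n : ℕ} (f : ALV 4) (a b c d : ALV n) (v : Fin n → M) :
    ev (ALV.comp f ![a, b, c, d]) v = ev f ![ev a v, ev b v, ev c v, ev d v] := by
  rw [ev_comp]
  exact congrArg _ (funext fun i => by fin_cases i <;> rfl)

theorem ev_crn_zero {n : ℕ} (g : ALV n) (h0 h1 : ALV (n + 1)) (v : Fin n → M) :
    ev (ALV.crn g h0 h1) (Matrix.vecCons 0 v) = ev g v := by
  have := realize_axiom (M := M) (QALV.Axiom.crn_zero g h0 h1) v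
  simp only [Formula.realize_equal, realize_app, Term.realize_var] at this
  refine Eq.trans (congrArg _ (funext fun i => ?_)) this
  refine Fin.cases ?_ (fun i => ?_) i
  · simp only [Matrix.cons_val_zero, Fin.cons_zero]
    exact (congrArg (ev ALV.zero) (Subsingleton.elim _ _) :
      (0 : M) = ev ALV.zero fun i => ((![] : Fin 0 → LALV.Term (Fin n)) i).realize v)
  · simp

theorem realize_crnStep {n : ℕ} (f h : ALV (n + 1)) (r : LALV.Term (Fin (n + 1))) (x : M)
    (v : Fin n → M)
    (H : (QALV.crnStep f h r).Realize (Matrix.vecCons x v : Fin (n + 1) → M)) :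
    ev f (Matrix.vecCons (r.realize (Matrix.vecCons x v : Fin (n + 1) → M)) v) =
      sB (ev h (Matrix.vecCons x v) ≠ 0) (ev f (Matrix.vecCons x v)) := by
  have e : ∀ (f : ALV (n + 1)) (t : LALV.Term (Fin (n + 1))),
      (QALV.appRec f t).realize (Matrix.vecCons x v : Fin (n + 1) → M) =
        ev f (Matrix.vecCons (t.realize (Matrix.vecCons x v : Fin (n + 1) → M)) v) := by
    intro f t
    rw [QALV.appRec, realize_app]
    refine congrArg _ (funext fun i => ?_)
    refine Fin.cases ?_ (fun i => ?_) i <;> simp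
  have e1 : ∀ (F : ALV 1) (t : LALV.Term (Fin (n + 1))) (w : Fin (n + 1) → M),
      ev F (fun i => ((![t] : Fin 1 → _) i).realize w) = ev F ![t.realize w] := fun F t w =>
    congrArg _ (funext fun i => by fin_cases i; rfl)
  have e0 : ∀ w : Fin 0 → M, (ev ALV.zero w : M) = 0 := fun w =>
    congrArg (ev ALV.zero) (Subsingleton.elim _ _)
  rw [QALV.crnStep, Formula.realize_inf, Formula.realize_imp, Formula.realize_imp, QALV.ne,
    Formula.realize_not] at H
  simp only [Formula.realize_equal, e, QALV.s0, QALV.s1, QALV.zero, realize_app, e0, e1,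
    Term.realize_var, Matrix.cons_val_zero] at H
  by_cases hh : ev h (Matrix.vecCons x v) = 0
  · rw [sB_neg (not_not.2 hh), H.1 hh, s0]
  · rw [sB_pos hh, H.2 hh, s1]

theorem realize_app1 {α : Type} (F : ALV 1) (t : LALV.Term α) (v : α → M) :
    (QALV.app F ![t]).realize v = ev F ![t.realize v] :=
  congrArg _ (funext fun i => by fin_cases i; rfl)

theorem realize_app2 {α : Type} (F : ALV 2) (s t : LALV.Term α) (v : α → M) :
    (QALV.app F ![s, t]).realize v = ev F ![s.realize v, t.realize v] :=
  congrArg _ (funext fun i => by fin_cases i <;> rfl)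

theorem realize_zero {α : Type} (v : α → M) : (QALV.zero : LALV.Term α).realize v = 0 :=
  congrArg (ev ALV.zero) (Subsingleton.elim _ _)

theorem realize_s0 {α : Type} (t : LALV.Term α) (v : α → M) :
    (QALV.s0 t).realize v = s0 (t.realize v) := realize_app1 _ _ _

theorem realize_s1 {α : Type} (t : LALV.Term α) (v : α → M) :
    (QALV.s1 t).realize v = s1 (t.realize v) := realize_app1 _ _ _

theorem realize_one {α : Type} (v : α → M) : (QALV.one : LALV.Term α).realize v = s1 0 := by
  rw [QALV.one, realize_s1, realize_zero]

theorem ev_crn_s1 {n : ℕ} (g : ALV n) (h0 h1 : ALV (n + 1)) (x : M) (v : Fin n → M) :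
    ev (ALV.crn g h0 h1) (Matrix.vecCons (s1 x) v) =
      sB (ev h1 (Matrix.vecCons x v) ≠ 0) (ev (ALV.crn g h0 h1) (Matrix.vecCons x v)) := by
  rw [← realize_crnStep _ _ _ x v (realize_axiom (QALV.Axiom.crn_s1 g h0 h1) _), realize_s1]
  rfl

theorem ev_crn_s0 {n : ℕ} (g : ALV n) (h0 h1 : ALV (n + 1)) {x : M} (hx : x ≠ 0)
    (v : Fin n → M) :
    ev (ALV.crn g h0 h1) (Matrix.vecCons (s0 x) v) =
      sB (ev h0 (Matrix.vecCons x v) ≠ 0) (ev (ALV.crn g h0 h1) (Matrix.vecCons x v)) := by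
  have := realize_axiom (QALV.Axiom.crn_s0 g h0 h1) (Matrix.vecCons x v : Fin (n + 1) → M)
  rw [Formula.realize_imp, QALV.ne, Formula.realize_not] at this
  simp only [Formula.realize_equal, Term.realize_var, Matrix.cons_val_zero, realize_zero] at this
  rw [← realize_crnStep _ _ _ x v (this hx), realize_s0]
  rfl

theorem s0_zero : s0 (0 : M) = 0 := by
  have := realize_axiom (M := M) QALV.Axiom.s0_zero ![]
  rwa [Formula.realize_equal, realize_s0, realize_zero] at this

/-- The digit of `x` at the position `i`. -/
def bt (i x : M) : M := ev ALV.bit ![i, x]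
/-- The binary length, as a binary number. -/
def ln (x : M) : M := ev ALV.len ![x]
/-- The successor `x + 1`. -/
def sc (x : M) : M := ev ALV.add ![x, s1 0]
/-- `⌊x/2⌋` -/
def half (x : M) : M := ev ALV.half ![x]
/-- `2^(|x| |y|)` -/
def smash (x y : M) : M := ev ALV.smash ![x, y]
/-- `x · 2^|y|` -/
def pd (y x : M) : M := ev ALV.padRec ![y, x]
/-- The function `and` of Clote. -/
def andF (x : M) : M := ev ALV.andF ![x]
/-- The function `or` of Clote. -/
def orF (x : M) : M := ev ALV.orF ![x]
/-- The function `tree` of Clote. -/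
def tree (x : M) : M := ev ALV.tree ![x]

instance TD.bt (f g : M → M) [TD f] [TD g] : TD fun x => bt (f x) (g x) :=
  TD.ev ALV.bit fun x => ![f x, g x]
instance TD.eta_bt (a : M) : TD (Mdl.bt a) := TD.bt (fun _ => a) fun x => x
instance TD.ln (f : M → M) [TD f] : TD fun x => ln (f x) := TD.ev ALV.len fun x => ![f x]
instance TD.eta_ln : TD (Mdl.ln : M → M) := TD.ln fun x => x
instance TD.sc (f : M → M) [TD f] : TD fun x => sc (f x) := TD.ev ALV.add fun x => ![f x, Mdl.s1 0]
instance TD.eta_sc : TD (Mdl.sc : M → M) := TD.sc fun x => x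
instance TD.half (f : M → M) [TD f] : TD fun x => half (f x) := TD.ev ALV.half fun x => ![f x]
instance TD.eta_half : TD (Mdl.half : M → M) := TD.half fun x => x
instance TD.smash (f g : M → M) [TD f] [TD g] : TD fun x => smash (f x) (g x) :=
  TD.ev ALV.smash fun x => ![f x, g x]
instance TD.eta_smash (a : M) : TD (Mdl.smash a) := TD.smash (fun _ => a) fun x => x
instance TD.pd (f g : M → M) [TD f] [TD g] : TD fun x => pd (f x) (g x) :=
  TD.ev ALV.padRec fun x => ![f x, g x]
instance TD.eta_pd (a : M) : TD (Mdl.pd a) := TD.pd (fun _ => a) fun x => x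
instance TD.andF (f : M → M) [TD f] : TD fun x => andF (f x) := TD.ev ALV.andF fun x => ![f x]
instance TD.eta_andF : TD (Mdl.andF : M → M) := TD.andF fun x => x
instance TD.orF (f : M → M) [TD f] : TD fun x => orF (f x) := TD.ev ALV.orF fun x => ![f x]
instance TD.eta_orF : TD (Mdl.orF : M → M) := TD.orF fun x => x
instance TD.tree (f : M → M) [TD f] : TD fun x => tree (f x) := TD.ev ALV.tree fun x => ![f x]
instance TD.eta_tree : TD (Mdl.tree : M → M) := TD.tree fun x => x

theorem realize_succ {α : Type} (t : LALV.Term α) (v : α → M) :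
    (QALV.succ t).realize v = sc (t.realize v) := by
  rw [QALV.succ, realize_app2, realize_one, sc]

theorem ln_zero : ln (0 : M) = 0 := by
  have := realize_axiom (M := M) QALV.Axiom.len_zero ![]
  rwa [Formula.realize_equal, QALV.len, realize_app1, realize_zero] at this

theorem ln_s0 {x : M} (hx : x ≠ 0) : ln (s0 x) = sc (ln x) := by
  have := realize_axiom (M := M) QALV.Axiom.len_s0 ![x]
  rw [Formula.realize_imp, QALV.ne, Formula.realize_not, Formula.realize_equal,
    Formula.realize_equal, realize_zero, QALV.len, QALV.len, realize_app1, realize_s0,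
    realize_succ, realize_app1] at this
  exact this hx

theorem ln_s1 (x : M) : ln (s1 x) = sc (ln x) := by
  have := realize_axiom (M := M) QALV.Axiom.len_s1 ![x]
  rwa [Formula.realize_equal, QALV.len, QALV.len, realize_app1, realize_s1,
    realize_succ, realize_app1] at this

theorem bt_zero_right (i : M) : bt i 0 = 0 := by
  have := realize_axiom (M := M) QALV.Axiom.bit_zero ![i]
  rwa [Formula.realize_equal, QALV.bit, realize_app2, realize_zero] at this

theorem bt_zero_s0 (x : M) : bt 0 (s0 x) = 0 := by
  have := realize_axiom (M := M) QALV.Axiom.bit_zero_s0 ![x]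
  rwa [Formula.realize_equal, QALV.bit, realize_app2, realize_zero, realize_s0] at this

theorem bt_zero_s1 (x : M) : bt 0 (s1 x) = s1 0 := by
  have := realize_axiom (M := M) QALV.Axiom.bit_zero_s1 ![x]
  rwa [Formula.realize_equal, QALV.bit, realize_app2, realize_zero, realize_s1, realize_one]
    at this

theorem bt_sc_s0 (i x : M) : bt (sc i) (s0 x) = bt i x := by
  have := realize_axiom (M := M) QALV.Axiom.bit_succ_s0 ![i, x]
  rwa [Formula.realize_equal, QALV.bit, realize_app2, realize_succ, realize_s0, QALV.bit,
    realize_app2] at this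

theorem bt_sc_s1 (i x : M) : bt (sc i) (s1 x) = bt i x := by
  have := realize_axiom (M := M) QALV.Axiom.bit_succ_s1 ![i, x]
  rwa [Formula.realize_equal, QALV.bit, realize_app2, realize_succ, realize_s1, QALV.bit,
    realize_app2] at this

theorem smash_zero (x : M) : smash 0 x = s1 0 := by
  have := realize_axiom (M := M) QALV.Axiom.smash_zero ![x]
  rwa [Formula.realize_equal, QALV.smash, realize_app2, realize_zero, realize_one] at this

theorem ev_pad (x y : M) : ev ALV.pad ![x, y] = pd y x := by
  simp [ALV.pad, pd]

theorem smash_s0 {x : M} (hx : x ≠ 0) (y : M) : smash (s0 x) y = pd y (smash x y) := by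
  have := realize_axiom (M := M) QALV.Axiom.smash_s0 ![x, y]
  rw [Formula.realize_imp, QALV.ne, Formula.realize_not, Formula.realize_equal,
    Formula.realize_equal, realize_zero, QALV.smash, QALV.smash, QALV.pad, realize_app2,
    realize_s0, realize_app2, realize_app2, ev_pad] at this
  exact this hx

theorem smash_s1 (x y : M) : smash (s1 x) y = pd y (smash x y) := by
  have := realize_axiom (M := M) QALV.Axiom.smash_s1 ![x, y]
  rwa [Formula.realize_equal, QALV.smash, QALV.smash, QALV.pad, realize_app2,
    realize_s1, realize_app2, realize_app2, ev_pad] at this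

theorem zero_ne_one : (0 : M) ≠ s1 0 := by
  have := realize_axiom (M := M) QALV.Axiom.zero_ne_one ![]
  rwa [QALV.ne, Formula.realize_not, Formula.realize_equal, realize_zero, realize_one] at this

theorem andF_one : andF (s1 0 : M) = s1 0 := by
  have := realize_axiom (M := M) QALV.Axiom.and_1 ![]
  rwa [Formula.realize_equal, QALV.andF, realize_app1, realize_one] at this

theorem orF_one : orF (s1 0 : M) = s1 0 := by
  have := realize_axiom (M := M) QALV.Axiom.or_1 ![]
  rwa [Formula.realize_equal, QALV.orF, realize_app1, realize_one] at this

theorem andF_sB {x : M} (hx : x ≠ 0) (a b : Prop) :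
    andF (sB b (sB a x)) = sB (a ∧ b) (andF x) := by
  have h00 := realize_axiom (M := M) QALV.Axiom.and_00 ![x]
  have h01 := realize_axiom (M := M) QALV.Axiom.and_01 ![x]
  have h10 := realize_axiom (M := M) QALV.Axiom.and_10 ![x]
  have h11 := realize_axiom (M := M) QALV.Axiom.and_11 ![x]
  rw [Formula.realize_imp, QALV.ne, Formula.realize_not, Formula.realize_equal,
    realize_zero, Formula.realize_equal, QALV.andF, QALV.andF] at h00 h01 h10 h11
  simp only [realize_s0, realize_s1, realize_app1] at h00 h01 h10 h11
  by_cases ha : a <;> by_cases hb : b <;> simp only [ha, hb, sB_true, sB_false, and_true,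
    and_false]
  · exact h11 hx
  · exact h10 hx
  · exact h01 hx
  · exact h00 hx

theorem orF_sB {x : M} (hx : x ≠ 0) (a b : Prop) :
    orF (sB b (sB a x)) = sB (a ∨ b) (orF x) := by
  have h00 := realize_axiom (M := M) QALV.Axiom.or_00 ![x]
  have h01 := realize_axiom (M := M) QALV.Axiom.or_01 ![x]
  have h10 := realize_axiom (M := M) QALV.Axiom.or_10 ![x]
  have h11 := realize_axiom (M := M) QALV.Axiom.or_11 ![x]
  rw [Formula.realize_imp, QALV.ne, Formula.realize_not, Formula.realize_equal,
    realize_zero, Formula.realize_equal, QALV.orF, QALV.orF] at h00 h01 h10 h11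
  simp only [realize_s0, realize_s1, realize_app1] at h00 h01 h10 h11
  by_cases ha : a <;> by_cases hb : b <;> simp only [ha, hb, sB_true, sB_false, or_true,
    or_false]
  · exact h11 hx
  · exact h10 hx
  · exact h01 hx
  · exact h00 hx

theorem tree_small {x : M} (hx : half (half (half (half x))) = 0) : tree x = bt 0 x := by
  have := realize_axiom (M := M) QALV.Axiom.tree_small ![x]
  rw [Formula.realize_imp, Formula.realize_equal, Formula.realize_equal, realize_zero,
    QALV.tree, QALV.bit, realize_app1, realize_app2, realize_zero, QALV.half4] at this
  simp only [QALV.half, realize_app1] at this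
  exact this hx

theorem tree_large {x : M} (hx : half (half (half (half x))) ≠ 0) :
    tree x = tree (orF (andF x)) := by
  have := realize_axiom (M := M) QALV.Axiom.tree_large ![x]
  rw [Formula.realize_imp, QALV.ne, Formula.realize_not, Formula.realize_equal,
    Formula.realize_equal, realize_zero, QALV.half4] at this
  simp only [QALV.half, QALV.tree, QALV.andF, QALV.orF, realize_app1] at this
  exact this hx

end Mdl

namespace Mdl

variable {M : Mdl}

/-! ### Binary strings -/

@[simp] theorem ev_zeroC {n : ℕ} (v : Fin n → M) : ev (ALV.zeroC n) v = 0 := by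
  rw [ALV.zeroC, ev_comp0, zero_def]

@[simp] theorem ev_oneC {n : ℕ} (v : Fin n → M) : ev (ALV.oneC n) v = s1 0 := by
  rw [ALV.oneC, ev_comp1, ev_zeroC, s1]

@[simp] theorem ev_bit (i x : M) : ev ALV.bit ![i, x] = bt i x := rfl
@[simp] theorem ev_len (x : M) : ev ALV.len ![x] = ln x := rfl
@[simp] theorem ev_padRec (y x : M) : ev ALV.padRec ![y, x] = pd y x := rfl
@[simp] theorem ev_s1 (x : M) : ev ALV.s1 ![x] = s1 x := rfl
@[simp] theorem ev_s0 (x : M) : ev ALV.s0 ![x] = s0 x := rfl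
@[simp] theorem ev_smash (x y : M) : ev ALV.smash ![x, y] = smash x y := rfl
@[simp] theorem ev_tree (x : M) : ev ALV.tree ![x] = tree x := rfl
@[simp] theorem ev_andF (x : M) : ev ALV.andF ![x] = andF x := rfl
@[simp] theorem ev_orF (x : M) : ev ALV.orF ![x] = orF x := rfl
@[simp] theorem ev_half (x : M) : ev ALV.half ![x] = half x := rfl
@[simp] theorem ev_zero (v : Fin 0 → M) : ev ALV.zero v = 0 :=
  congrArg (ev ALV.zero) (Subsingleton.elim _ _)

theorem bt_zero_sB (b : Prop) (x : M) : bt 0 (sB b x) ≠ 0 ↔ b := by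
  by_cases h : b
  · simpa [h, bt_zero_s1] using zero_ne_one.symm
  · simp [h, bt_zero_s0]

theorem bt_sc_sB (i : M) (b : Prop) (x : M) : bt (sc i) (sB b x) = bt i x := by
  by_cases h : b
  · simp [h, bt_sc_s1]
  · simp [h, bt_sc_s0]

theorem s1_ne_zero (x : M) : s1 x ≠ 0 := by
  intro h
  have := bt_zero_s1 x
  rw [h, bt_zero_right] at this
  exact zero_ne_one this

theorem half_zero : half (0 : M) = 0 :=
  (ev_crn_zero _ _ _ ![]).trans (ev_zero _)

theorem half_s1' (x : M) : half (s1 x) = sB (bt 0 x ≠ 0) (half x) := by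
  refine (ev_crn_s1 _ _ _ x ![]).trans ?_
  simp only [ev_comp2, ev_zeroC, ev_proj]
  rfl

theorem half_s0' {x : M} (hx : x ≠ 0) : half (s0 x) = sB (bt 0 x ≠ 0) (half x) := by
  refine (ev_crn_s0 _ _ _ hx ![]).trans ?_
  simp only [ev_comp2, ev_zeroC, ev_proj]
  rfl

theorem half_s0_and_s1 (x : M) : half (s0 x) = x ∧ half (s1 x) = x := by
  refine notation_induction (P := fun x => half (s0 x) = x ∧ half (s1 x) = x) ?_ ?_ x
  · refine ⟨by rw [s0_zero, half_zero], ?_⟩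
    rw [half_s1', half_zero, bt_zero_right, sB_neg (not_not.2 rfl), s0_zero]
  · intro x hx b
    have key : half (sB b x) = x := by
      by_cases hb : b
      · rw [sB_pos hb, hx.2]
      · rw [sB_neg hb, hx.1]
    have : sB (bt 0 (sB b x) ≠ 0) (half (sB b x)) = sB b x := by
      rw [key, propext (bt_zero_sB b x)]
    refine ⟨?_, by rw [half_s1', this]⟩
    by_cases h0 : sB b x = 0
    · rw [h0, s0_zero, half_zero]
    · rw [half_s0' h0, this]

@[simp] theorem half_sB (b : Prop) (x : M) : half (sB b x) = x := by
  by_cases hb : b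
  · rw [sB_pos hb, (half_s0_and_s1 x).2]
  · rw [sB_neg hb, (half_s0_and_s1 x).1]

@[simp] theorem half_s0 (x : M) : half (s0 x) = x := (half_s0_and_s1 x).1
@[simp] theorem half_s1 (x : M) : half (s1 x) = x := (half_s0_and_s1 x).2

theorem sB_inj {a b : Prop} {x y : M} : sB a x = sB b y ↔ (a ↔ b) ∧ x = y := by
  constructor
  · intro h
    refine ⟨?_, by simpa using congrArg half h⟩
    rw [← bt_zero_sB a x, h, bt_zero_sB]
  · rintro ⟨hab, rfl⟩
    rw [propext hab]

theorem sB_eq_zero {b : Prop} {x : M} : sB b x = 0 ↔ ¬ b ∧ x = 0 := by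
  have : sB b x = 0 ↔ sB b x = sB False 0 := by rw [sB_false, s0_zero]
  rw [this, sB_inj, iff_false]

theorem s0_eq_zero {x : M} : s0 x = 0 ↔ x = 0 := by
  rw [← sB_false, sB_eq_zero]
  simp

theorem sB_ne_zero_of_ne {x : M} (hx : x ≠ 0) (b : Prop) : sB b x ≠ 0 :=
  fun h => hx (sB_eq_zero.1 h).2

/-- The last digit. -/
def od (x : M) : Prop := bt 0 x ≠ 0

@[simp] theorem od_sB (b : Prop) (x : M) : od (sB b x) ↔ b := bt_zero_sB b x

instance QD.od (f : M → M) [TD f] : QD fun x => od (f x) := QD.ne (fun x => bt 0 (f x)) fun _ => 0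
instance QD.eta_od : QD (Mdl.od : M → Prop) := QD.od fun x => x

theorem sB_od_half (x : M) : sB (od x) (half x) = x := by
  have h : (od x → s1 (half x) = x) ∧ (¬ od x → s0 (half x) = x) := by
    refine notation_induction
      (P := fun x => (od x → s1 (half x) = x) ∧ (¬ od x → s0 (half x) = x)) ?_ (fun x _ b => ?_) x
    · simp [half_zero, s0_zero, od, bt_zero_right]
    · simp only [od_sB, half_sB]
      exact ⟨fun h => (sB_pos h x).symm, fun h => (sB_neg h x).symm⟩
  by_cases hx : od x
  · rw [sB_pos hx, h.1 hx]
  · rw [sB_neg hx, h.2 hx]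

/-- Case distinction on the last digit. -/
theorem exists_sB (x : M) : ∃ b y, x = sB b y := ⟨_, _, (sB_od_half x).symm⟩

/-- Induction on notation, where the trivial step from `0` to `s₀ 0 = 0` is left out. -/
theorem ind {P : M → Prop} [QD P] (h0 : P 0)
    (hs : ∀ x b, sB b x ≠ 0 → P x → P (sB b x)) (x : M) : P x := by
  refine notation_induction h0 (fun x hx b => ?_) x
  by_cases h : sB b x = 0
  · rwa [h]
  · exact hs x b h hx

theorem ev_crn_sB' {n : ℕ} (g : ALV n) (h0 h1 : ALV (n + 1)) {b : Prop} {x : M}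
    (hx : sB b x ≠ 0) (v : Fin n → M) :
    ev (ALV.crn g h0 h1) (Matrix.vecCons (sB b x) v) =
      sB ((b ∧ ev h1 (Matrix.vecCons x v) ≠ 0) ∨ (¬ b ∧ ev h0 (Matrix.vecCons x v) ≠ 0))
        (ev (ALV.crn g h0 h1) (Matrix.vecCons x v)) := by
  by_cases hb : b
  · simp only [hb, sB_true, true_and, not_true, false_and, or_false, ev_crn_s1]
  · have hx' : x ≠ 0 := fun h => hx (sB_eq_zero.2 ⟨hb, h⟩)
    simp only [hb, sB_false, false_and, not_false_eq_true, true_and, false_or, ev_crn_s0 _ _ _ hx']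

theorem ev_crn_sB {n : ℕ} (g : ALV n) (h : ALV (n + 1)) {b : Prop} {x : M}
    (hx : sB b x ≠ 0) (v : Fin n → M) :
    ev (ALV.crn g h h) (Matrix.vecCons (sB b x) v) =
      sB (ev h (Matrix.vecCons x v) ≠ 0) (ev (ALV.crn g h h) (Matrix.vecCons x v)) := by
  rw [ev_crn_sB' _ _ _ hx]
  congr 1
  by_cases hb : b <;> simp [hb]

theorem ln_sB {b : Prop} {x : M} (hx : sB b x ≠ 0) : ln (sB b x) = sc (ln x) := by
  by_cases hb : b
  · rw [sB_pos hb, ln_s1]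
  · rw [sB_neg hb, ln_s0 fun h => hx (sB_eq_zero.2 ⟨hb, h⟩)]

theorem smash_sB {b : Prop} {x : M} (hx : sB b x ≠ 0) (y : M) :
    smash (sB b x) y = pd y (smash x y) := by
  by_cases hb : b
  · rw [sB_pos hb, smash_s1]
  · rw [sB_neg hb, smash_s0 fun h => hx (sB_eq_zero.2 ⟨hb, h⟩)]

@[simp] theorem pd_zero (x : M) : pd 0 x = x :=
  (ev_crn_zero _ _ _ ![x]).trans (ev_proj _ _)

theorem pd_sB {b : Prop} {y : M} (hy : sB b y ≠ 0) (x : M) : pd (sB b y) x = s0 (pd y x) := by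
  refine (ev_crn_sB _ _ hy ![x]).trans ?_
  rw [ev_zeroC, sB_neg (not_not.2 rfl)]
  rfl

/-! ### Digits and shifts -/

/-- The digit of `x` at the position `|y|`. -/
def at' (y x : M) : Prop := bt (ln y) x ≠ 0

instance QD.at' (f g : M → M) [TD f] [TD g] : QD fun x => at' (f x) (g x) :=
  QD.ne (fun x => bt (ln (f x)) (g x)) fun _ => 0
instance QD.eta_at (a : M) : QD (Mdl.at' a) := QD.at' (fun _ => a) fun x => x

theorem ev_bitAt {n : ℕ} (a b : ALV n) (v : Fin n → M) :
    ev (ALV.bitAt a b) v ≠ 0 ↔ at' (ev a v) (ev b v) := by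
  rw [ALV.bitAt, ev_comp2, ev_comp1]
  rfl

@[simp] theorem at_zero (y : M) : ¬ at' y 0 := fun h => h (bt_zero_right _)

@[simp] theorem zero_at (x : M) : at' 0 x ↔ od x := by rw [at', ln_zero, od]

theorem sB_at {b : Prop} {y : M} (hy : sB b y ≠ 0) (a : Prop) (x : M) :
    at' (sB b y) (sB a x) ↔ at' y x := by
  rw [at', ln_sB hy, bt_sc_sB, at']

end Mdl

namespace ALV

/-- `⌊x / 2^|y|⌋`, by recursion on `x`: the digits of `⌊x / 2^|y|⌋` are followed by the digit of
`s_j x` at the position `|y|`. -/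
def shr : ALV 2 :=
  crn (zeroC 1) (bitAt (proj 2 1) (comp s0 ![proj 2 0])) (bitAt (proj 2 1) (comp s1 ![proj 2 0]))

end ALV

namespace Mdl

variable {M : Mdl}

/-- `⌊x / 2^|y|⌋` -/
def shr (x y : M) : M := ev ALV.shr ![x, y]

@[simp] theorem ev_shr (x y : M) : ev ALV.shr ![x, y] = shr x y := rfl

instance TD.shr (f g : M → M) [TD f] [TD g] : TD fun x => shr (f x) (g x) :=
  TD.ev ALV.shr fun x => ![f x, g x]
instance TD.eta_shr (a : M) : TD (Mdl.shr a) := TD.shr (fun _ => a) fun x => x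

@[simp] theorem zero_shr (y : M) : shr 0 y = 0 :=
  (ev_crn_zero _ _ _ ![y]).trans (ev_zeroC _)

theorem sB_shr' (b : Prop) (x y : M) : shr (sB b x) y = sB (at' y (sB b x)) (shr x y) := by
  by_cases hx : sB b x = 0
  · obtain ⟨hb, rfl⟩ := sB_eq_zero.1 hx
    rw [hx, zero_shr, sB_neg (at_zero _), s0_zero]
  · refine (ev_crn_sB' _ _ _ hx ![y]).trans ?_
    simp only [ev_bitAt, ev_proj, ev_comp1, Matrix.cons_val_zero, Matrix.cons_val_one, ev_s0, ev_s1]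
    refine congrArg₂ sB ?_ rfl
    by_cases hb : b <;> simp [hb]

@[simp] theorem shr_zero (x : M) : shr x 0 = x := by
  refine ind (P := fun x => shr x 0 = x) (zero_shr _) (fun x b _ hx => ?_) x
  rw [sB_shr', hx, zero_at, propext (od_sB b x)]

@[simp] theorem half_shr (x y : M) : half (shr x y) = shr (half x) y := by
  obtain ⟨b, x, rfl⟩ := exists_sB x
  rw [sB_shr', half_sB, half_sB]

theorem sB_shr_sB {b : Prop} {y : M} (hy : sB b y ≠ 0) (a : Prop) (x : M) :
    shr (sB a x) (sB b y) = shr x y := by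
  have : ∀ x, shr (s0 x) (sB b y) = shr x y ∧ shr (s1 x) (sB b y) = shr x y := by
    refine ind (by simp [s0_zero, ← sB_true, sB_shr', sB_at hy]) fun x c _ hx => ?_
    have e : shr (sB c x) (sB b y) = shr x y := by
      by_cases hc : c
      · rw [sB_pos hc, hx.2]
      · rw [sB_neg hc, hx.1]
    have key : ∀ a, shr (sB a (sB c x)) (sB b y) = shr (sB c x) y := fun a => by
      rw [sB_shr' a, sB_at hy, e, ← sB_shr']
    exact ⟨by simpa using key False, by simpa using key True⟩
  by_cases ha : a
  · rw [sB_pos ha, (this x).2]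
  · rw [sB_neg ha, (this x).1]

theorem shr_sB {b : Prop} {y : M} (hy : sB b y ≠ 0) (x : M) : shr x (sB b y) = shr (half x) y := by
  obtain ⟨a, x, rfl⟩ := exists_sB x
  rw [sB_shr_sB hy, half_sB]

theorem od_shr (x y : M) : od (shr x y) ↔ at' y x := by
  obtain ⟨a, x, rfl⟩ := exists_sB x
  rw [sB_shr', od_sB]

theorem shr_eq_sB {b : Prop} {y : M} (hy : sB b y ≠ 0) (x : M) :
    shr x y = sB (at' y x) (shr x (sB b y)) := by
  conv_lhs => rw [← sB_od_half (shr x y)]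
  rw [propext (od_shr x y), half_shr, shr_sB hy]

/-- `|x| ≤ |y|` -/
def lel (x y : M) : Prop := shr x y = 0

instance QD.lel (f g : M → M) [TD f] [TD g] : QD fun x => lel (f x) (g x) :=
  QD.eq (fun x => shr (f x) (g x)) fun _ => 0
instance QD.eta_lel (a : M) : QD (Mdl.lel a) := QD.lel (fun _ => a) fun x => x

theorem lel_pd (z x : M) : lel z (pd z (s1 x)) ∧ pd z (s1 x) ≠ 0 := by
  refine ind (P := fun z => lel z (pd z (s1 x)) ∧ pd z (s1 x) ≠ 0) ?_ (fun z b hz ih => ?_) z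
  · exact ⟨zero_shr _, by rw [pd_zero]; exact s1_ne_zero x⟩
  · have := sB_ne_zero_of_ne ih.2 False
    rw [pd_sB hz, ← sB_false]
    exact ⟨by rw [lel, sB_shr_sB this]; exact ih.1, this⟩

theorem lel_refl (x : M) : lel x x := by
  refine ind (P := fun z => lel z z) (zero_shr _) (fun z b hz ih => ?_) x
  rwa [lel, sB_shr_sB hz]

theorem lel_sB {x y : M} (h : lel x y) (b : Prop) : lel x (sB b y) := by
  by_cases hy : sB b y = 0
  · obtain ⟨hb, rfl⟩ := sB_eq_zero.1 hy
    rwa [sB_neg hb, s0_zero]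
  · rw [lel, shr_sB hy, ← half_shr, h, half_zero]

theorem lel_pd_right (z x : M) : lel x (pd z (s1 x)) := by
  refine ind (P := fun z => lel x (pd z (s1 x))) ?_ (fun z b hz ih => ?_) z
  · rw [pd_zero, ← sB_true]
    exact lel_sB (lel_refl x) _
  · rw [pd_sB hz, ← sB_false]
    exact lel_sB ih _

/-- Simultaneous induction on notation on two strings. -/
theorem ind2 {P : M → M → Prop} [hP : ∀ a b : M, QD fun y => P (shr a y) (shr b y)]
    (h0 : P 0 0) (hs : ∀ x y a b, (sB a x ≠ 0 ∨ sB b y ≠ 0) → P x y → P (sB a x) (sB b y))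
    (x y : M) : P x y := by
  by_contra h
  -- A failure at `(x, y)` propagates to all the pairs of prefixes, and finally to `(0, 0)`.
  have key : ∀ u, ¬ P (shr x u) (shr y u) := by
    refine ind (by simpa using h) fun u c hu ih hP => ih ?_
    rw [shr_eq_sB hu x, shr_eq_sB hu y]
    by_cases hne : sB (at' u x) (shr x (sB c u)) ≠ 0 ∨ sB (at' u y) (shr y (sB c u)) ≠ 0
    · exact hs _ _ _ _ hne hP
    · push Not at hne
      rwa [hne.1, hne.2]
  refine key (pd x (s1 y)) ?_
  rwa [(lel_pd x y).1, lel_pd_right]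

/-- Simultaneous induction on notation on three strings. -/
theorem ind3 {P : M → M → M → Prop}
    [hP : ∀ a b c : M, QD fun y => P (shr a y) (shr b y) (shr c y)]
    (h0 : P 0 0 0) (hs : ∀ x y z a b c, (sB a x ≠ 0 ∨ sB b y ≠ 0 ∨ sB c z ≠ 0) → P x y z →
      P (sB a x) (sB b y) (sB c z))
    (x y z : M) : P x y z := by
  by_contra h
  have key : ∀ u, ¬ P (shr x u) (shr y u) (shr z u) := by
    refine ind (by simpa using h) fun u c hu ih hP => ih ?_
    rw [shr_eq_sB hu x, shr_eq_sB hu y, shr_eq_sB hu z]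
    by_cases hne : sB (at' u x) (shr x (sB c u)) ≠ 0 ∨ sB (at' u y) (shr y (sB c u)) ≠ 0 ∨
        sB (at' u z) (shr z (sB c u)) ≠ 0
    · exact hs _ _ _ _ _ _ hne hP
    · push Not at hne
      rwa [hne.1, hne.2.1, hne.2.2]
  -- a string that is longer than each of the three
  have hlong : ∀ w, lel y w → lel y (pd x w) := fun w hw => by
    refine ind (P := fun x => lel y (pd x w)) (by rwa [pd_zero]) (fun x b hx ih => ?_) x
    rw [pd_sB hx, ← sB_false]
    exact lel_sB ih _
  have hlong' : ∀ w, lel z w → lel z (pd x w) := fun w hw => by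
    refine ind (P := fun x => lel z (pd x w)) (by rwa [pd_zero]) (fun x b hx ih => ?_) x
    rw [pd_sB hx, ← sB_false]
    exact lel_sB ih _
  refine key (pd x (s1 (pd y (s1 z)))) ?_
  rwa [(lel_pd x _).1, hlong _ (by rw [← sB_true]; exact lel_sB (lel_pd y z).1 _),
    hlong' _ (by rw [← sB_true]; exact lel_sB (lel_pd_right y z) _)]

/-- Strings with the same digits are equal. -/
theorem ext_at {x y : M} (h : ∀ i, at' i x ↔ at' i y) : x = y := by
  by_contra hne
  have key : ∀ u, shr x u ≠ shr y u := by
    refine ind (by simpa using hne) fun u c hu ih he => ih ?_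
    rw [shr_eq_sB hu x, shr_eq_sB hu y, he, propext (h u)]
  refine key (pd x (s1 y)) ?_
  rw [(lel_pd x y).1, lel_pd_right]

end Mdl

namespace Mdl

variable {M : Mdl}

/-! ### Comparison of lengths -/

theorem exists_sB_ne_zero {x : M} (hx : x ≠ 0) : ∃ b y, x = sB b y ∧ sB b y ≠ 0 := by
  obtain ⟨b, y, rfl⟩ := exists_sB x
  exact ⟨b, y, rfl, hx⟩

theorem zero_lel (y : M) : lel 0 y := zero_shr y

theorem lel_zero {x : M} : lel x 0 ↔ x = 0 := by rw [lel, shr_zero]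

theorem sB_lel_sB {b : Prop} {y : M} (hy : sB b y ≠ 0) (a : Prop) (x : M) :
    lel (sB a x) (sB b y) ↔ lel x y := by rw [lel, sB_shr_sB hy, lel]

theorem lel_total (x y : M) : lel x y ∨ lel y x := by
  refine ind2 (P := fun x y => lel x y ∨ lel y x) (.inl (zero_lel 0)) (fun x y a b _ ih => ?_) x y
  by_cases hx : sB a x = 0
  · exact .inl (hx ▸ zero_lel _)
  by_cases hy : sB b y = 0
  · exact .inr (hy ▸ zero_lel _)
  rwa [sB_lel_sB hx, sB_lel_sB hy]

theorem lel_trans {x y z : M} : lel x y → lel y z → lel x z := by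
  refine ind3 (P := fun x y z => lel x y → lel y z → lel x z) (fun _ _ => zero_lel 0)
    (fun x y z a b c _ ih => ?_) x y z
  by_cases hz : sB c z = 0
  · rw [hz]
    intro h1 h2
    rwa [lel_zero.1 h2] at h1
  by_cases hy : sB b y = 0
  · rw [hy]
    intro h1 h2
    rw [lel_zero.1 h1]
    exact zero_lel _
  rwa [sB_lel_sB hz, sB_lel_sB hy, sB_lel_sB hz]

/-- `|x| < |y|` -/
def ltl (x y : M) : Prop := ¬ lel y x

instance QD.ltl (f g : M → M) [TD f] [TD g] : QD fun x => ltl (f x) (g x) :=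
  QD.not fun x => Mdl.lel (g x) (f x)
instance QD.eta_ltl (a : M) : QD (Mdl.ltl a) := QD.ltl (fun _ => a) fun x => x

theorem not_ltl_zero (x : M) : ¬ ltl x 0 := fun h => h (zero_lel x)

theorem ltl_sB {b : Prop} {y : M} (hy : sB b y ≠ 0) (u : M) : ltl u (sB b y) ↔ lel u y := by
  have key : (y ≠ 0 → (ltl u (s0 y) ↔ lel u y)) ∧ (ltl u (s1 y) ↔ lel u y) := by
    refine ind2 (P := fun u y => (y ≠ 0 → (ltl u (s0 y) ↔ lel u y)) ∧ (ltl u (s1 y) ↔ lel u y))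
      ⟨fun h => absurd rfl h, ?_⟩ (fun u y a b _ ih => ?_) u y
    · rw [ltl, lel_zero]
      exact iff_of_true (s1_ne_zero 0) (zero_lel 0)
    · have hg : ∀ c, sB c (sB b y) ≠ 0 → (ltl (sB a u) (sB c (sB b y)) ↔ lel (sB a u) (sB b y)) := by
        intro c hc
        by_cases hu : sB a u = 0
        · rw [hu, ltl, lel_zero]
          exact iff_of_true hc (zero_lel _)
        rw [ltl, sB_lel_sB hu]
        by_cases hy : sB b y = 0
        · rw [hy, lel_zero]
          exact iff_of_false (fun h => h (zero_lel u)) hu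
        rw [sB_lel_sB hy]
        by_cases hb : b
        · simpa [hb, ltl] using ih.2
        · have := ih.1 fun h => hy (sB_eq_zero.2 ⟨hb, h⟩)
          simpa [hb, ltl] using this
      exact ⟨fun h => by simpa using hg False (sB_ne_zero_of_ne h _),
        by simpa using hg True (by rw [sB_true]; exact s1_ne_zero _)⟩
  by_cases hb : b
  · simpa [hb] using key.2
  · simpa [hb] using key.1 fun h => hy (sB_eq_zero.2 ⟨hb, h⟩)

theorem zero_ltl {x : M} : ltl 0 x ↔ x ≠ 0 := by rw [ltl, lel_zero]

theorem sB_ltl_sB {a b : Prop} {x : M} (hx : sB a x ≠ 0) (y : M) :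
    ltl (sB a x) (sB b y) ↔ ltl x y := by rw [ltl, sB_lel_sB hx, ltl]

theorem sB_lel_iff_ltl {b : Prop} {y : M} (hy : sB b y ≠ 0) (u : M) : lel (sB b y) u ↔ ltl y u := by
  rw [← not_iff_not, ← ltl, ltl_sB hy, ltl, not_not]

theorem ltl_of_ltl_of_lel {x y z : M} (h : ltl x y) (h' : lel y z) : ltl x z :=
  fun hz => h (lel_trans h' hz)

theorem ltl_of_lel_of_ltl {x y z : M} (h : lel x y) (h' : ltl y z) : ltl x z :=
  fun hz => h' (lel_trans hz h)

theorem lel_of_ltl {x y : M} (h : ltl x y) : lel x y := (lel_total x y).resolve_right h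

theorem not_ltl {x y : M} : ¬ ltl x y ↔ lel y x := not_not

theorem ltl_of_at {y x : M} (h : at' y x) : ltl y x := fun hl => by
  rw [← od_shr, hl, od, bt_zero_right] at h
  exact h rfl

theorem half_lel (x : M) : lel (half x) x := by
  obtain ⟨b, x, rfl⟩ := exists_sB x
  rw [half_sB]
  exact lel_sB (lel_refl x) b

theorem half_ltl {x : M} (hx : x ≠ 0) : ltl (half x) x := by
  obtain ⟨b, x, rfl⟩ := exists_sB x
  rw [half_sB, ltl_sB hx]
  exact lel_refl x

theorem shr_lel (x y : M) : lel (shr x y) x := by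
  refine ind (P := fun y => lel (shr x y) x) (by rw [shr_zero]; exact lel_refl x)
    (fun y b hy ih => ?_) y
  rw [shr_sB hy, ← half_shr]
  exact lel_trans (half_lel _) ih

theorem shr_s1 (x y : M) : shr x (s1 y) = shr (half x) y := by
  rw [← sB_true, shr_sB (by rw [sB_true]; exact s1_ne_zero y)]

theorem shr_s1_ltl {x : M} (hx : x ≠ 0) (y : M) : ltl (shr x (s1 y)) x := by
  rw [shr_s1]
  exact ltl_of_lel_of_ltl (shr_lel _ _) (half_ltl hx)

/-- `|x| = |y|` -/
def eql (x y : M) : Prop := lel x y ∧ lel y x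

theorem eql_refl (x : M) : eql x x := ⟨lel_refl x, lel_refl x⟩

theorem eql.symm {x y : M} (h : eql x y) : eql y x := ⟨h.2, h.1⟩

theorem eql.trans {x y z : M} (h : eql x y) (h' : eql y z) : eql x z :=
  ⟨lel_trans h.1 h'.1, lel_trans h'.2 h.2⟩

theorem eql_sB {a b : Prop} {x y : M} (hx : sB a x ≠ 0) (hy : sB b y ≠ 0) (h : eql x y) :
    eql (sB a x) (sB b y) :=
  ⟨(sB_lel_sB hy a x).2 h.1, (sB_lel_sB hx b y).2 h.2⟩

theorem ln_eq_of_eql {x y : M} (h : eql x y) : ln x = ln y := by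
  refine ind2 (P := fun x y => lel x y → lel y x → ln x = ln y) (fun _ _ => rfl)
    (fun x y a b _ ih => ?_) x y h.1 h.2
  by_cases hx : sB a x = 0
  · rw [hx]
    intro _ h
    rw [lel_zero.1 h]
  by_cases hy : sB b y = 0
  · rw [hy]
    intro h _
    rw [lel_zero.1 h]
  rw [sB_lel_sB hx, sB_lel_sB hy, ln_sB hx, ln_sB hy]
  exact fun h1 h2 => by rw [ih h1 h2]

theorem at_congr {y y' : M} (h : eql y y') (x : M) : at' y x ↔ at' y' x := by
  rw [at', ln_eq_of_eql h, at']

theorem lel_iff_ltl_or_eql {x y : M} : lel x y ↔ ltl x y ∨ eql x y := by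
  constructor
  · intro h
    by_cases h' : lel y x
    · exact .inr ⟨h, h'⟩
    · exact .inl h'
  · rintro (h | h)
    · exact lel_of_ltl h
    · exact h.1

/-! ### Truth values and bounded quantifiers -/

/-- The truth value of `F` at `v`. -/
def tv {n : ℕ} (F : ALV n) (v : Fin n → M) : Prop := ev F v ≠ 0

instance QD.tv {n : ℕ} (F : ALV n) (a : M → Fin n → M) [TDv a] : QD fun x => Mdl.tv F (a x) :=
  QD.ne (fun x => Mdl.ev F (a x)) fun _ => 0

@[simp] theorem tv_zeroC {n : ℕ} (v : Fin n → M) : ¬ tv (ALV.zeroC n) v := fun h => h (ev_zeroC v)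
@[simp] theorem tv_oneC {n : ℕ} (v : Fin n → M) : tv (ALV.oneC n) v := by
  rw [tv, ev_oneC]
  exact s1_ne_zero 0

@[simp] theorem tv_neg {n : ℕ} (a : ALV n) (v : Fin n → M) : tv (ALV.neg a) v ↔ ¬ tv a v := by
  rw [tv, ALV.neg, ev_comp2, ev_comp2, ev_zeroC, ev_oneC, tv, not_not, ev_bit, ev_padRec]
  by_cases h : ev a v = 0
  · rw [h, pd_zero, ← sB_true, bt_zero_sB]
    simp
  · obtain ⟨b, y, hb, hy⟩ := exists_sB_ne_zero h
    rw [hb, pd_sB hy, ← sB_false, bt_zero_sB]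
    simp [hy]

@[simp] theorem tv_disj {n : ℕ} (a b : ALV n) (v : Fin n → M) :
    tv (ALV.disj a b) v ↔ tv a v ∨ tv b v := by
  rw [tv, ALV.disj, ev_comp3, ev_oneC]
  refine Eq.to_iff (congrArg (· ≠ 0) (ev_crn_s1 _ _ _ (0 : M) ![ev a v, ev b v])) |>.trans ?_
  rw [ev_crn_zero, ev_proj, ev_proj, Ne, sB_eq_zero, tv, tv]
  simp only [Matrix.cons_val_zero, Matrix.cons_val]
  tauto

@[simp] theorem tv_conj {n : ℕ} (a b : ALV n) (v : Fin n → M) :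
    tv (ALV.conj a b) v ↔ tv a v ∧ tv b v := by
  rw [ALV.conj, tv_neg, tv_disj, tv_neg, tv_neg]
  tauto

@[simp] theorem tv_exor {n : ℕ} (a b : ALV n) (v : Fin n → M) :
    tv (ALV.exor a b) v ↔ ¬ (tv a v ↔ tv b v) := by
  rw [ALV.exor, tv_conj, tv_disj, tv_neg, tv_conj]
  tauto

@[simp] theorem tv_bitAt {n : ℕ} (a b : ALV n) (v : Fin n → M) :
    tv (ALV.bitAt a b) v ↔ at' (ev a v) (ev b v) := ev_bitAt a b v

theorem tv_comp3 {n : ℕ} (f : ALV 3) (a b c : ALV n) (v : Fin n → M) :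
    tv (ALV.comp f ![a, b, c]) v ↔ tv f ![ev a v, ev b v, ev c v] := by
  rw [tv, ev_comp3, tv]

theorem tv_comp4 {n : ℕ} (f : ALV 4) (a b c d : ALV n) (v : Fin n → M) :
    tv (ALV.comp f ![a, b, c, d]) v ↔ tv f ![ev a v, ev b v, ev c v, ev d v] := by
  rw [tv, ev_comp4, tv]

/-- The string `1 ⋯ 1` of the length of `x`. -/
def ones (x : M) : M := ev ALV.ones ![x]

instance TD.ones (f : M → M) [TD f] : TD fun x => Mdl.ones (f x) :=
  TD.ev ALV.ones fun x => ![f x]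
instance TD.eta_ones : TD (Mdl.ones : M → M) := TD.ones fun x => x

theorem ones_zero : ones (0 : M) = 0 := (ev_crn_zero _ _ _ ![]).trans (ev_zero _)

theorem ones_sB {b : Prop} {x : M} (hx : sB b x ≠ 0) : ones (sB b x) = s1 (ones x) := by
  refine (ev_crn_sB _ _ hx ![]).trans ?_
  rw [ev_oneC, sB_pos (s1_ne_zero 0)]
  rfl

theorem at_ones (u v : M) : at' u (ones v) ↔ ltl u v := by
  refine ind2 (P := fun u v => at' u (ones v) ↔ ltl u v)
    (iff_of_false (by rw [ones_zero]; exact at_zero _) (not_ltl_zero _)) (fun u v a b _ ih => ?_) u v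
  by_cases hv : sB b v = 0
  · rw [hv, ones_zero]
    exact iff_of_false (at_zero _) (not_ltl_zero _)
  rw [ones_sB hv, ← sB_true]
  by_cases hu : sB a u = 0
  · rw [hu, zero_at, od_sB, zero_ltl]
    exact iff_of_true trivial hv
  rw [sB_at hu, sB_ltl_sB hu, ih]

@[simp] theorem tv_lenLt {n : ℕ} (a b : ALV n) (v : Fin n → M) :
    tv (ALV.lenLt a b) v ↔ ltl (ev a v) (ev b v) := by
  rw [← at_ones, tv, ALV.lenLt, ev_comp2, ev_comp1, ev_comp1, ev_len, ev_bit]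
  rfl

/-- `F` depends, as far as truth is concerned, on the length of its first argument only. -/
def LenInv {n : ℕ} (F : ALV (n + 1)) (v : Fin n → M) : Prop :=
  ∀ y y' : M, eql y y' → (tv F (Matrix.vecCons y v) ↔ tv F (Matrix.vecCons y' v))

/-- The symbol `exPrefix a` is the quantifier `∃ u (|u| < |y| ∧ a(u, v))`. -/
theorem tv_exPrefix {n : ℕ} {a : ALV (n + 1)} {v : Fin n → M} (ha : LenInv a v) (y : M) :
    tv (ALV.exPrefix a) (Matrix.vecCons y v) ↔ ∃ u, ltl u y ∧ tv a (Matrix.vecCons u v) := by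
  have h0 : ¬ tv (ALV.exPrefix a) (Matrix.vecCons (0 : M) v) := fun h =>
    h ((ev_crn_zero _ _ _ v).trans (ev_zeroC v))
  have hs : ∀ (b : Prop) (x : M), sB b x ≠ 0 →
      (tv (ALV.exPrefix a) (Matrix.vecCons (sB b x) v) ↔
        tv a (Matrix.vecCons x v) ∨ tv (ALV.exPrefix a) (Matrix.vecCons x v)) := by
    intro b x hx
    rw [tv, ALV.exPrefix, ev_crn_sB _ _ hx, Ne, sB_eq_zero, ← ALV.exPrefix, tv, tv]
    tauto
  constructor
  · contrapose!
    intro hu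
    have key : ∀ x, lel x y → ¬ tv (ALV.exPrefix a) (Matrix.vecCons x v) := by
      refine ind (fun _ => h0) fun x b hx ih hl => ?_
      rw [sB_lel_iff_ltl hx] at hl
      rw [hs b x hx]
      rintro (h | h)
      · exact hu x hl h
      · exact ih (lel_of_ltl hl) h
    exact key y (lel_refl y)
  · rintro ⟨u, hu, h⟩
    have key : ∀ x, ltl u x → tv (ALV.exPrefix a) (Matrix.vecCons x v) := by
      refine ind (fun h => absurd h (not_ltl_zero u)) fun x b hx ih hl => ?_
      rw [ltl_sB hx] at hl
      rw [hs b x hx]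
      rcases lel_iff_ltl_or_eql.1 hl with hl | hl
      · exact .inr (ih hl)
      · exact .inl ((ha _ _ hl).1 h)
    exact key y hu

/-! ### Comprehension -/

theorem at_crn {n : ℕ} (g : ALV n) (H : ALV (n + 1)) (v : Fin n → M) (i d : M) (hi : ltl i d) :
    at' i (ev (ALV.crn g H H) (Matrix.vecCons d v)) ↔ tv H (Matrix.vecCons (shr d (s1 i)) v) := by
  refine ind2 (P := fun i d => ltl i d → (at' i (ev (ALV.crn g H H) (Matrix.vecCons d v)) ↔
    tv H (Matrix.vecCons (shr d (s1 i)) v))) (fun h => absurd h (not_ltl_zero _))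
    (fun i d a b _ ih hl => ?_) i d hi
  by_cases hd : sB b d = 0
  · rw [hd] at hl
    exact absurd hl (not_ltl_zero _)
  rw [ev_crn_sB _ _ hd, ← tv]
  by_cases hi : sB a i = 0
  · rw [hi, zero_at, od_sB, shr_s1, half_sB, shr_zero]
  rw [sB_at hi, ih ((sB_ltl_sB hi d).1 hl), shr_s1, shr_s1, half_sB, shr_sB hi]

theorem ne_zero_of_ltl {i d : M} (h : ltl i d) : d ≠ 0 := fun h0 => not_ltl_zero i (h0 ▸ h)

/-- The map `i ↦ d - 1 - i` on the numbers below `d` is an involution. -/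
theorem shr_shr_eql {i d : M} (hi : ltl i d) : eql (shr d (s1 (shr d (s1 i)))) i := by
  have := ind2 (P := fun i d => ltl i d →
    lel (shr d (s1 (shr d (s1 i)))) i ∧ lel i (shr d (s1 (shr d (s1 i)))))
    (fun h => absurd h (not_ltl_zero _)) (fun i d a b _ ih hl => ?_) i d hi
  · exact this
  have hd : sB b d ≠ 0 := ne_zero_of_ltl hl
  have e1 : shr (sB b d) (s1 (sB a i)) = shr d (sB a i) := by rw [shr_s1, half_sB]
  have e2 : ∀ w, shr (sB b d) (s1 w) = shr d w := fun w => by rw [shr_s1, half_sB]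
  rw [e1, e2]
  by_cases hi : sB a i = 0
  · rw [hi, shr_zero, lel_refl d]
    exact eql_refl 0
  have hid := (sB_ltl_sB hi d).1 hl
  have hd0 : d ≠ 0 := ne_zero_of_ltl hid
  have e3 : shr d (sB a i) = shr d (s1 i) := by rw [shr_sB hi, shr_s1]
  rw [e3]
  have hw : ltl (shr d (s1 i)) d := shr_s1_ltl hd0 i
  have hne : shr d (shr d (s1 i)) ≠ 0 := hw
  have e4 := shr_eq_sB (b := True) (y := shr d (s1 i)) (by rw [sB_true]; exact s1_ne_zero _) d
  rw [e4] at hne ⊢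
  rw [sB_true] at hne ⊢
  exact eql_sB hne hi (ih hid)

/-- The digits of the string given by comprehension. -/
theorem at_compr {n : ℕ} {e : ALV (n + 1)} {v : Fin n → M} (he : LenInv e v) (i d : M) :
    at' i (ev (ALV.compr e) (Matrix.vecCons d v)) ↔ ltl i d ∧ tv e (Matrix.vecCons i v) := by
  set Hb : ALV (n + 2) := ALV.bitAt (ALV.proj (n + 2) 0)
    (ALV.comp (ALV.crn (ALV.oneC n) e e) fun i => ALV.proj (n + 2) i.succ) with hHb
  have e1 : ev (ALV.compr e) (Matrix.vecCons d v) =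
      ev (ALV.crn (ALV.zeroC (n + 1)) Hb Hb) (Matrix.vecCons d (Matrix.vecCons d v)) := by
    rw [ALV.compr, ev_comp]
    refine congrArg _ (funext fun i => ?_)
    refine Fin.cases ?_ (fun i => ?_) i <;> simp
  have e2 : ∀ y : M, tv Hb (Matrix.vecCons y (Matrix.vecCons d v)) ↔
      at' y (ev (ALV.crn (ALV.oneC n) e e) (Matrix.vecCons d v)) := by
    intro y
    rw [hHb, tv_bitAt, ev_proj, ev_comp]
    simp
  rw [e1]
  by_cases hi : ltl i d
  · rw [at_crn _ _ _ _ _ hi, e2, at_crn _ _ _ _ _ (shr_s1_ltl (ne_zero_of_ltl hi) i),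
      he _ _ (shr_shr_eql hi)]
    simp [hi]
  · simp only [hi, false_and, iff_false]
    intro h
    have hlen : ∀ y, lel (ev (ALV.crn (ALV.zeroC (n + 1)) Hb Hb)
        (Matrix.vecCons y (Matrix.vecCons d v))) y := by
      refine ind ?_ fun y b hy ih => ?_
      · rw [ev_crn_zero, ev_zeroC]
        exact zero_lel 0
      · rw [ev_crn_sB _ _ hy, sB_lel_sB hy]
        exact ih
    exact hi (ltl_of_ltl_of_lel (ltl_of_at h) (hlen d))

end Mdl

namespace Mdl

variable {M : Mdl}

/-! ### Carry and borrow lookahead -/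

theorem lenInv_bx (x z : M) : LenInv ALV.bx ![x, z] := fun y y' h => by
  simpa [ALV.bx] using at_congr h x

theorem lenInv_bz (x z : M) : LenInv ALV.bz ![x, z] := fun y y' h => by
  simpa [ALV.bz] using at_congr h z

theorem ltl_congr {y y' : M} (h : eql y y') (z : M) : ltl z y ↔ ltl z y' :=
  ⟨fun h' => ltl_of_ltl_of_lel h' h.1, fun h' => ltl_of_ltl_of_lel h' h.2⟩

theorem lel_congr {y y' : M} (h : eql y y') (z : M) : lel z y ↔ lel z y' :=
  ⟨fun h' => lel_trans h' h.1, fun h' => lel_trans h' h.2⟩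

section carry

variable {gen prop : ALV 3} {x z : M}

theorem tv_carry (hg : LenInv gen ![x, z]) (hp : LenInv prop ![x, z]) (y : M) :
    tv (ALV.carry gen prop) ![y, x, z] ↔
      ∃ u, ltl u y ∧ tv gen ![u, x, z] ∧ ∀ w, ltl w y → ltl u w → tv prop ![w, x, z] := by
  have inner : ∀ u : M, LenInv (ALV.conj (ALV.lenLt (ALV.proj 4 1) (ALV.proj 4 0))
      (ALV.neg (ALV.comp prop ![ALV.proj 4 0, ALV.proj 4 2, ALV.proj 4 3]))) ![u, x, z] := by
    intro u w w' h
    simp only [tv_conj, tv_neg, tv_lenLt, tv_comp3, ev_proj]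
    exact and_congr (ltl_congr h u) (not_congr (hp _ _ h))
  have e : ∀ u : M, tv (ALV.conj (ALV.comp gen ![ALV.proj 4 0, ALV.proj 4 2, ALV.proj 4 3])
      (ALV.neg (ALV.comp (ALV.exPrefix (n := 3)
        (ALV.conj (ALV.lenLt (ALV.proj 4 1) (ALV.proj 4 0))
          (ALV.neg (ALV.comp prop ![ALV.proj 4 0, ALV.proj 4 2, ALV.proj 4 3]))))
        ![ALV.proj 4 1, ALV.proj 4 0, ALV.proj 4 2, ALV.proj 4 3]))) ![u, y, x, z] ↔
      tv gen ![u, x, z] ∧ ∀ w, ltl w y → ltl u w → tv prop ![w, x, z] := by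
    intro u
    simp only [tv_conj, tv_neg, tv_comp4, tv_comp3, ev_proj]
    refine and_congr Iff.rfl ((not_congr (tv_exPrefix (inner u) y)).trans ?_)
    simp only [tv_conj, tv_neg, tv_lenLt, tv_comp3, ev_proj]
    push Not
    rfl
  rw [ALV.carry, tv_comp4]
  simp only [ev_proj, Matrix.cons_val]
  refine (tv_exPrefix ?_ y).trans (exists_congr fun u => and_congr Iff.rfl (e u))
  intro u u' h
  rw [e u, e u']
  exact and_congr (hg _ _ h) (forall_congr' fun w => imp_congr Iff.rfl (imp_congr
    ⟨fun h' => ltl_of_lel_of_ltl h.2 h', fun h' => ltl_of_lel_of_ltl h.1 h'⟩ Iff.rfl))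

theorem carry_zero (hg : LenInv gen ![x, z]) (hp : LenInv prop ![x, z]) :
    ¬ tv (ALV.carry gen prop) ![0, x, z] := by
  rw [tv_carry hg hp]
  rintro ⟨u, hu, -⟩
  exact not_ltl_zero u hu

theorem carry_congr (hg : LenInv gen ![x, z]) (hp : LenInv prop ![x, z]) {y y' : M}
    (h : eql y y') :
    tv (ALV.carry gen prop) ![y, x, z] ↔ tv (ALV.carry gen prop) ![y', x, z] := by
  rw [tv_carry hg hp, tv_carry hg hp]
  simp only [ltl_congr h]

/-- The carry ripples. -/
theorem carry_sB (hg : LenInv gen ![x, z]) (hp : LenInv prop ![x, z]) {b : Prop} {j : M}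
    (hj : sB b j ≠ 0) :
    tv (ALV.carry gen prop) ![sB b j, x, z] ↔
      tv gen ![j, x, z] ∨ tv prop ![j, x, z] ∧ tv (ALV.carry gen prop) ![j, x, z] := by
  rw [tv_carry hg hp, tv_carry hg hp]
  simp only [ltl_sB hj]
  constructor
  · rintro ⟨u, hu, h1, h2⟩
    rcases lel_iff_ltl_or_eql.1 hu with hl | hl
    · exact .inr ⟨h2 j (lel_refl j) hl, u, hl, h1, fun w hw => h2 w (lel_of_ltl hw)⟩
    · exact .inl ((hg _ _ hl).1 h1)
  · rintro (h | ⟨h, u, hu, h1, h2⟩)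
    · exact ⟨j, lel_refl j, h, fun w hw hw' => absurd hw hw'⟩
    · refine ⟨u, lel_of_ltl hu, h1, fun w hw hw' => ?_⟩
      rcases lel_iff_ltl_or_eql.1 hw with hl | hl
      · exact h2 w hl hw'
      · exact (hp _ _ hl).2 h

end carry

/-! ### Addition -/

/-- The carry into the position `|y|` in `x + z`. -/
def cy (y x z : M) : Prop :=
  tv (ALV.carry (ALV.conj ALV.bx ALV.bz) (ALV.disj ALV.bx ALV.bz)) ![y, x, z]

instance QD.cy (f g h : M → M) [TD f] [TD g] [TD h] : QD fun x => cy (f x) (g x) (h x) :=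
  QD.tv _ fun x => ![f x, g x, h x]
instance QD.eta_cy (a b : M) : QD (Mdl.cy a b) := QD.cy (fun _ => a) (fun _ => b) fun x => x

theorem lenInv_conj {n : ℕ} {a b : ALV (n + 1)} {v : Fin n → M} (ha : LenInv a v)
    (hb : LenInv b v) : LenInv (ALV.conj a b) v := fun y y' h => by
  rw [tv_conj, tv_conj, ha y y' h, hb y y' h]

theorem lenInv_disj {n : ℕ} {a b : ALV (n + 1)} {v : Fin n → M} (ha : LenInv a v)
    (hb : LenInv b v) : LenInv (ALV.disj a b) v := fun y y' h => by
  rw [tv_disj, tv_disj, ha y y' h, hb y y' h]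

theorem lenInv_exor {n : ℕ} {a b : ALV (n + 1)} {v : Fin n → M} (ha : LenInv a v)
    (hb : LenInv b v) : LenInv (ALV.exor a b) v := fun y y' h => by
  rw [tv_exor, tv_exor, ha y y' h, hb y y' h]

theorem lenInv_neg {n : ℕ} {a : ALV (n + 1)} {v : Fin n → M} (ha : LenInv a v) :
    LenInv (ALV.neg a) v := fun y y' h => by
  rw [tv_neg, tv_neg, ha y y' h]

theorem tv_bx (y x z : M) : tv ALV.bx ![y, x, z] ↔ at' y x := by simp [ALV.bx]
theorem tv_bz (y x z : M) : tv ALV.bz ![y, x, z] ↔ at' y z := by simp [ALV.bz]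

theorem cy_zero (x z : M) : ¬ cy 0 x z :=
  carry_zero (lenInv_conj (lenInv_bx x z) (lenInv_bz x z))
    (lenInv_disj (lenInv_bx x z) (lenInv_bz x z))

theorem cy_congr {y y' : M} (h : eql y y') (x z : M) : cy y x z ↔ cy y' x z :=
  carry_congr (lenInv_conj (lenInv_bx x z) (lenInv_bz x z))
    (lenInv_disj (lenInv_bx x z) (lenInv_bz x z)) h

theorem cy_sB {b : Prop} {j : M} (hj : sB b j ≠ 0) (x z : M) :
    cy (sB b j) x z ↔ at' j x ∧ at' j z ∨ (at' j x ∨ at' j z) ∧ cy j x z := by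
  refine (carry_sB (lenInv_conj (lenInv_bx x z) (lenInv_bz x z))
    (lenInv_disj (lenInv_bx x z) (lenInv_bz x z)) hj).trans ?_
  rw [tv_conj, tv_disj, tv_bx, tv_bz, cy]

instance : Add M := ⟨fun x z => ev ALV.add ![x, z]⟩

theorem add_def (x z : M) : x + z = ev ALV.add ![x, z] := rfl

instance TD.add (f g : M → M) [TD f] [TD g] : TD fun x => f x + g x :=
  TD.ev ALV.add fun x => ![f x, g x]
instance TD.eta_add (a : M) : TD (HAdd.hAdd a : M → M) := TD.add (fun _ => a) fun x => x

theorem eql_s1_sB {b : Prop} {j : M} (hj : sB b j ≠ 0) : eql (sB b j) (s1 j) := by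
  rw [← sB_true]
  exact eql_sB hj (by rw [sB_true]; exact s1_ne_zero j) (eql_refl j)

theorem at_s1 (i : M) (a : Prop) (x : M) : at' (s1 i) (sB a x) ↔ at' i x := by
  rw [← sB_true]
  exact sB_at (by rw [sB_true]; exact s1_ne_zero i) a x

/-- Equality of strings can be checked at the positions `0` and `|i| + 1`. -/
theorem ext_at_s1 {x y : M} (h0 : od x ↔ od y) (h : ∀ i, at' (s1 i) x ↔ at' (s1 i) y) : x = y := by
  refine ext_at fun i => ?_
  obtain ⟨b, i, rfl⟩ := exists_sB i
  by_cases hi : sB b i = 0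
  · rwa [hi, zero_at, zero_at]
  · rw [at_congr (eql_s1_sB hi), at_congr (eql_s1_sB hi), h]

theorem ltl_long_left (x z : M) : ltl x (pd x (s1 z)) := by
  refine ind (P := fun x => ltl x (pd x (s1 z))) ?_ (fun x b hx ih => ?_) x
  · rw [pd_zero, zero_ltl]
    exact s1_ne_zero z
  · rw [pd_sB hx, ← sB_false, sB_ltl_sB hx]
    exact ih

theorem ltl_long_right (x z : M) : ltl z (pd x (s1 z)) := by
  refine ind (P := fun x => ltl z (pd x (s1 z))) ?_ (fun x b hx ih => ?_) x
  · rw [pd_zero, ← sB_true, ltl_sB (by rw [sB_true]; exact s1_ne_zero z)]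
    exact lel_refl z
  · rw [pd_sB hx, ← sB_false, ltl_sB (sB_ne_zero_of_ne (ne_zero_of_ltl ih) _)]
    exact lel_of_ltl ih

theorem not_at_of_lel {i x : M} (h : lel x i) : ¬ at' i x := fun h' => ltl_of_at h' h

theorem at_add (i x z : M) : at' i (x + z) ↔ ¬ (¬ (at' i x ↔ at' i z) ↔ cy i x z) := by
  rw [add_def, ALV.add, ev_comp3, ALV.long, ev_comp2]
  simp only [ev_proj, ev_comp1, Matrix.cons_val_zero, Matrix.cons_val_one, ev_s1, ev_padRec]
  refine (at_compr (lenInv_exor (lenInv_exor (lenInv_bx x z) (lenInv_bz x z))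
    fun y y' h => cy_congr h x z) i (pd x (s1 z))).trans ?_
  rw [tv_exor, tv_exor, tv_bx, tv_bz, ← cy]
  refine and_iff_right_of_imp fun h => ?_
  -- beyond the lengths of `x` and `z` there are no digits and no carry
  by_contra hl
  rw [not_ltl] at hl
  have hx : ltl x i := ltl_of_ltl_of_lel (ltl_long_left x z) hl
  have hz : ltl z i := ltl_of_ltl_of_lel (ltl_long_right x z) hl
  obtain ⟨b, j, rfl, hj⟩ := exists_sB_ne_zero (ne_zero_of_ltl hx)
  rw [cy_sB hj] at h
  have hx' := not_at_of_lel (lel_of_ltl hx)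
  have hz' := not_at_of_lel (lel_of_ltl hz)
  rw [ltl_sB hj] at hx hz
  have hx'' := not_at_of_lel hx
  have hz'' := not_at_of_lel hz
  tauto

theorem add_comm' (x z : M) : x + z = z + x := by
  refine ext_at fun i => ?_
  have : cy i x z ↔ cy i z x := by
    refine ind (P := fun i => cy i x z ↔ cy i z x) (iff_of_false (cy_zero x z) (cy_zero z x))
      (fun i b hi ih => ?_) i
    rw [cy_sB hi, cy_sB hi]
    tauto
  rw [at_add, at_add]
  tauto

theorem add_zero' (x : M) : x + 0 = x := by
  refine ext_at fun i => ?_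
  have : ¬ cy i x 0 := by
    refine ind (P := fun i => ¬ cy i x 0) (cy_zero x 0) (fun i b hi ih => ?_) i
    rw [cy_sB hi]
    have := at_zero i
    tauto
  rw [at_add]
  have := at_zero i
  tauto

theorem s1_ne_zero' (x : M) : sB True x ≠ 0 := by rw [sB_true]; exact s1_ne_zero x

theorem cy_s1 (j x z : M) :
    cy (s1 j) x z ↔ at' j x ∧ at' j z ∨ (at' j x ∨ at' j z) ∧ cy j x z := by
  rw [← sB_true, cy_sB (s1_ne_zero' j)]

theorem od_add (x z : M) : od (x + z) ↔ ¬ (od x ↔ od z) := by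
  have := cy_zero x z
  rw [← zero_at, at_add, zero_at, zero_at]
  tauto

theorem add_sB_sB_of_not {a b : Prop} (h : ¬ (a ∧ b)) (x z : M) :
    sB a x + sB b z = sB (a ∨ b) (x + z) := by
  have key : ∀ j, cy (s1 j) (sB a x) (sB b z) ↔ cy j x z := by
    refine ind ?_ fun j c hj ih => ?_
    · rw [cy_s1, zero_at, zero_at, od_sB, od_sB]
      have h1 := cy_zero (sB a x) (sB b z)
      have h2 := cy_zero x z
      tauto
    · rw [cy_s1, cy_congr (eql_s1_sB hj) (sB a x), ih, sB_at hj, sB_at hj, cy_sB hj]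
  refine ext_at_s1 ?_ fun i => ?_
  · rw [od_add, od_sB, od_sB, od_sB]
    tauto
  · rw [at_add, at_s1, at_s1, at_s1, at_add, key]

theorem sc_def (x : M) : sc x = x + s1 0 := rfl

theorem add_sB_sB_of_and {a b : Prop} (ha : a) (hb : b) (x z : M) :
    sB a x + sB b z = sB False (sc (x + z)) := by
  -- Compared with the sum `x + z`, either the carry out of the last digits travels with the
  -- carry of `x + z` or it is the carry that `1` causes in `(x + z) + 1`.
  have key : ∀ j, (cy (s1 j) (sB a x) (sB b z) ↔ (cy j x z ∨ j = 0 ∨ cy j (x + z) (s1 0))) ∧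
      ¬ (cy j x z ∧ (j = 0 ∨ cy j (x + z) (s1 0))) := by
    refine ind ?_ fun j c hj ih => ?_
    · rw [cy_s1, zero_at, zero_at, od_sB, od_sB]
      have h1 := cy_zero (sB a x) (sB b z)
      have h2 := cy_zero x z
      tauto
    · rw [cy_s1, cy_congr (eql_s1_sB hj) (sB a x), sB_at hj, sB_at hj, cy_sB hj, cy_sB hj, at_add]
      have h1 : at' j (s1 0) ↔ j = 0 := by
        obtain ⟨d, j, rfl⟩ := exists_sB j
        by_cases h : sB d j = 0
        · rw [h, zero_at, ← sB_true, od_sB]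
          simp
        · rw [← sB_true, sB_at h]
          exact iff_of_false (at_zero _) h
      have h2 : j = 0 → ¬ cy j (x + z) (s1 0) := fun h => h ▸ cy_zero _ _
      rw [h1]
      grind
  refine ext_at_s1 ?_ fun i => ?_
  · rw [od_add, od_sB, od_sB, od_sB]
    tauto
  · have h1 : at' i (s1 0) ↔ i = 0 := by
      obtain ⟨d, j, rfl⟩ := exists_sB i
      by_cases h : sB d j = 0
      · rw [h, zero_at, ← sB_true, od_sB]
        simp
      · rw [← sB_true, sB_at h]
        exact iff_of_false (at_zero _) h
    have h2 : i = 0 → ¬ cy i (x + z) (s1 0) := fun h => h ▸ cy_zero _ _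
    have := key i
    rw [at_add, at_s1, at_s1, at_s1, sc_def, at_add, at_add, h1]
    grind

theorem sc_s0 (x : M) : sc (s0 x) = s1 x := by
  rw [sc_def, ← sB_false, ← sB_true, add_sB_sB_of_not (by simp), add_zero']
  simp

theorem sc_s1 (x : M) : sc (s1 x) = s0 (sc x) := by
  rw [sc_def, ← sB_true, ← sB_true, add_sB_sB_of_and trivial trivial, add_zero', sB_false]

theorem sc_zero : sc (0 : M) = s1 0 := by rw [← s0_zero, sc_s0, s0_zero]

theorem add_sc (u v : M) : u + sc v = sc (u + v) := by
  refine ind2 (P := fun u v => u + sc v = sc (u + v)) ?_ (fun u v a b _ ih => ?_) u v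
  · rw [add_zero', add_comm', add_zero']
  by_cases ha : a <;> by_cases hb : b <;> simp only [ha, hb]
  · rw [add_sB_sB_of_and trivial trivial, sB_true v, sc_s1, ← sB_false, add_sB_sB_of_not (by simp),
      ih, sB_false _, sc_s0]
    simp
  · rw [add_sB_sB_of_not (by simp), sB_false, sc_s0, ← sB_true v,
      add_sB_sB_of_and trivial trivial]
    simp [sc_s1]
  · rw [add_sB_sB_of_not (by simp), sB_true v, sc_s1, ← sB_false (sc v),
      add_sB_sB_of_not (by simp), ih]
    simp [sc_s1]
  · rw [add_sB_sB_of_not (by simp), sB_false v, sc_s0, ← sB_true, add_sB_sB_of_not (by simp)]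
    simp [sc_s0]

theorem add_self (u : M) : u + u = s0 u := by
  refine notation_induction (P := fun u => u + u = s0 u) ?_ (fun u ih b => ?_) u
  · rw [add_zero', s0_zero]
  by_cases hb : b <;> simp only [hb]
  · rw [add_sB_sB_of_and trivial trivial, ih, sc_s0]
    simp
  · rw [add_sB_sB_of_not (by simp), ih]
    simp

theorem sc_ne_zero (x : M) : sc x ≠ 0 := by
  refine notation_induction (P := fun x => sc x ≠ 0) ?_ (fun x ih b => ?_) x
  · rw [sc_zero]
    exact s1_ne_zero 0
  · by_cases hb : b <;> simp only [hb, sB_true, sB_false]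
    · rwa [sc_s1, Ne, s0_eq_zero]
    · rw [sc_s0]
      exact s1_ne_zero x

end Mdl

namespace Mdl

variable {M : Mdl}

/-! ### Truncated subtraction and the order -/

/-- The borrow into the position `|y|` in `x - z`. -/
def bo (y x z : M) : Prop := tv ALV.borrow ![y, x, z]

instance QD.bo (f g h : M → M) [TD f] [TD g] [TD h] : QD fun x => bo (f x) (g x) (h x) :=
  QD.tv _ fun x => ![f x, g x, h x]
instance QD.eta_bo (a b : M) : QD (Mdl.bo a b) := QD.bo (fun _ => a) (fun _ => b) fun x => x

theorem bo_zero (x z : M) : ¬ bo 0 x z :=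
  carry_zero (lenInv_conj (lenInv_neg (lenInv_bx x z)) (lenInv_bz x z))
    (lenInv_disj (lenInv_neg (lenInv_bx x z)) (lenInv_bz x z))

theorem bo_congr {y y' : M} (h : eql y y') (x z : M) : bo y x z ↔ bo y' x z :=
  carry_congr (lenInv_conj (lenInv_neg (lenInv_bx x z)) (lenInv_bz x z))
    (lenInv_disj (lenInv_neg (lenInv_bx x z)) (lenInv_bz x z)) h

theorem bo_sB {b : Prop} {j : M} (hj : sB b j ≠ 0) (x z : M) :
    bo (sB b j) x z ↔ ¬ at' j x ∧ at' j z ∨ (¬ at' j x ∨ at' j z) ∧ bo j x z := by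
  refine (carry_sB (lenInv_conj (lenInv_neg (lenInv_bx x z)) (lenInv_bz x z))
    (lenInv_disj (lenInv_neg (lenInv_bx x z)) (lenInv_bz x z)) hj).trans ?_
  rw [tv_conj, tv_disj, tv_neg, tv_bx, tv_bz, bo, ALV.borrow]

theorem bo_s1 (j x z : M) :
    bo (s1 j) x z ↔ ¬ at' j x ∧ at' j z ∨ (¬ at' j x ∨ at' j z) ∧ bo j x z := by
  rw [← sB_true, bo_sB (s1_ne_zero' j)]

noncomputable instance : LT M := ⟨fun x z => bo (pd x (s1 z)) x z⟩

theorem lt_def (x z : M) : x < z ↔ bo (pd x (s1 z)) x z := Iff.rfl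

instance QD.lt (f g : M → M) [TD f] [TD g] : QD fun x => f x < g x :=
  (QD.bo (fun x => Mdl.pd (f x) (Mdl.s1 (g x))) f g).congr fun _ => Iff.rfl
instance QD.eta_lt (a : M) : QD (LT.lt a : M → Prop) := QD.lt (fun _ => a) fun x => x

/-- Beyond the lengths of `x` and `z` the borrow does not change. -/
theorem bo_of_lel {x z N N' : M} (hx : lel x N) (hz : lel z N) (h : lel N N') :
    bo N' x z ↔ bo N x z := by
  revert h
  refine ind (P := fun N' => lel N N' → (bo N' x z ↔ bo N x z)) (fun h => ?_)
    (fun j b hj ih h => ?_) N'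
  · rw [lel_zero.1 h]
  rcases lel_iff_ltl_or_eql.1 h with hl | hl
  · rw [ltl_sB hj] at hl
    rw [bo_sB hj, ← ih hl]
    have h1 := not_at_of_lel (lel_trans hx hl)
    have h2 := not_at_of_lel (lel_trans hz hl)
    tauto
  · exact bo_congr hl.symm x z

theorem bo_iff_lt {x z N : M} (hx : lel x N) (hz : lel z N) : bo N x z ↔ x < z := by
  rw [lt_def]
  rcases lel_total N (pd x (s1 z)) with h | h
  · exact (bo_of_lel hx hz h).symm
  · exact bo_of_lel (lel_of_ltl (ltl_long_left x z)) (lel_of_ltl (ltl_long_right x z)) h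

theorem bo_self (y x : M) : ¬ bo y x x := by
  refine ind (P := fun y => ¬ bo y x x) (bo_zero x x) (fun j b hj ih => ?_) y
  rw [bo_sB hj]
  tauto

theorem not_lt_self (x : M) : ¬ x < x := bo_self _ x

theorem sB_lt_sB {a b : Prop} {x z : M} : sB a x < sB b z ↔ x < z ∨ x = z ∧ ¬ a ∧ b := by
  set N := pd x (s1 z) with hN
  have hx : lel x N := lel_of_ltl (ltl_long_left x z)
  have hz : lel z N := lel_of_ltl (ltl_long_right x z)
  have hs : ∀ (c : Prop) (w : M), lel w N → lel (sB c w) (s1 N) := fun c w hw => by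
    rw [← sB_true, sB_lel_sB (s1_ne_zero' N)]
    exact hw
  rw [← bo_iff_lt (hs a x hx) (hs b z hz), lt_def, ← hN]
  by_cases hxz : x = z
  · have h1 := bo_self N x
    have key : ∀ j, bo (s1 j) (sB a x) (sB b x) ↔ ¬ a ∧ b := by
      refine ind ?_ fun j c hj ih => ?_
      · have := bo_zero (sB a x) (sB b x)
        rw [bo_s1, zero_at, zero_at, od_sB, od_sB]
        tauto
      · rw [bo_s1, bo_congr (eql_s1_sB hj), sB_at hj, sB_at hj, ih]
        tauto
    subst hxz
    rw [key]
    tauto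
  · -- the position of a digit where `x` and `z` differ determines the borrow beyond it
    obtain ⟨i, hi⟩ : ∃ i, ¬ (at' i x ↔ at' i z) := by
      by_contra h
      push Not at h
      exact hxz (ext_at fun i => h i)
    have key : ∀ j, ltl i j → (bo (s1 j) (sB a x) (sB b z) ↔ bo j x z) := by
      refine ind (fun h => absurd h (not_ltl_zero i)) fun j c hj ih hl => ?_
      rw [bo_s1, bo_congr (eql_s1_sB hj) (sB a x), sB_at hj, sB_at hj, bo_sB hj]
      rcases lel_iff_ltl_or_eql.1 ((ltl_sB hj i).1 hl) with h | h
      · rw [ih h]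
      · have h1 := at_congr h x
        have h2 := at_congr h z
        tauto
    have hiN : ltl i N := by
      by_contra h
      rw [not_ltl] at h
      have h1 := not_at_of_lel (lel_trans hx h)
      have h2 := not_at_of_lel (lel_trans hz h)
      tauto
    rw [key N hiN]
    tauto

/-- `x ∸ z` -/
def monus (x z : M) : M := ev ALV.monus ![x, z]

instance TD.monus (f g : M → M) [TD f] [TD g] : TD fun x => monus (f x) (g x) :=
  TD.ev ALV.monus fun x => ![f x, g x]

theorem ev_long {n : ℕ} (a b : ALV n) (v : Fin n → M) :
    ev (ALV.long a b) v = pd (ev a v) (s1 (ev b v)) := by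
  rw [ALV.long, ev_comp2, ev_comp1, ev_s1, ev_padRec]

theorem at_monus (i x z : M) : at' i (monus x z) ↔
    ltl i (pd x (s1 z)) ∧ ¬ (¬ (at' i x ↔ at' i z) ↔ bo i x z) ∧ ¬ x < z := by
  rw [monus, ALV.monus, ev_comp3, ev_long]
  simp only [ev_proj, Matrix.cons_val_zero, Matrix.cons_val_one]
  have e : ∀ y : M, tv (ALV.conj (ALV.exor (ALV.exor ALV.bx ALV.bz) ALV.borrow)
      (ALV.neg (ALV.comp ALV.borrow
        ![ALV.long (ALV.proj 3 1) (ALV.proj 3 2), ALV.proj 3 1, ALV.proj 3 2]))) ![y, x, z] ↔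
      ¬ (¬ (at' y x ↔ at' y z) ↔ bo y x z) ∧ ¬ x < z := fun y => by
    rw [tv_conj, tv_exor, tv_exor, tv_bx, tv_bz, tv_neg, tv_comp3, lt_def, bo, bo, ev_long]
    simp
  refine (at_compr (fun y y' h => ?_) i (pd x (s1 z))).trans ?_
  · rw [e, e, at_congr h, at_congr h, bo_congr h]
  · rw [e]

theorem monus_eq_zero {x z : M} : monus x z = 0 ↔ x < z ∨ x = z := by
  constructor
  · intro h
    by_contra! hne
    have key : ∀ i, ¬ bo i x z := by
      refine ind (bo_zero x z) fun i b hi ih => ?_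
      have h1 := at_monus i x z
      rw [h] at h1
      have h2 := at_zero i
      rw [bo_sB hi]
      by_cases hl : ltl i (pd x (s1 z))
      · tauto
      · have hx := not_at_of_lel (lel_trans (lel_of_ltl (ltl_long_left x z)) (not_ltl.1 hl))
        have hz := not_at_of_lel (lel_trans (lel_of_ltl (ltl_long_right x z)) (not_ltl.1 hl))
        tauto
    refine hne.2 (ext_at fun i => ?_)
    have h1 := at_monus i x z
    rw [h] at h1
    have h2 := at_zero i
    have h3 := key i
    have h4 := hne.1
    by_cases hl : ltl i (pd x (s1 z))
    · tauto
    · have hx := not_at_of_lel (lel_trans (lel_of_ltl (ltl_long_left x z)) (not_ltl.1 hl))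
      have hz := not_at_of_lel (lel_trans (lel_of_ltl (ltl_long_right x z)) (not_ltl.1 hl))
      tauto
  · intro h
    refine ext_at fun i => ?_
    rw [at_monus]
    have h2 := at_zero i
    rcases h with h | rfl
    · tauto
    · have := bo_self i x
      tauto

theorem lt_trichotomy' (x y : M) : x < y ∨ x = y ∨ y < x := by
  refine ind2 (P := fun x y => x < y ∨ x = y ∨ y < x) (.inr (.inl rfl)) (fun x y a b _ ih => ?_) x y
  rw [sB_lt_sB, sB_lt_sB, sB_inj]
  rcases ih with h | h | h
  · exact .inl (.inl h)
  · have := h.symm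
    tauto
  · exact .inr (.inr (.inl h))

theorem lt_trans' {x y z : M} : x < y → y < z → x < z := by
  refine ind3 (P := fun x y z => x < y → y < z → x < z) (fun h => absurd h (not_lt_self 0))
    (fun x y z a b c _ ih => ?_) x y z
  rw [sB_lt_sB, sB_lt_sB, sB_lt_sB]
  rintro (h | ⟨rfl, h⟩) (h' | ⟨rfl, h'⟩)
  · exact .inl (ih h h')
  · exact .inl h
  · exact .inl h'
  · tauto

open Classical in
noncomputable instance : LinearOrder M where
  le x y := x < y ∨ x = y
  lt x y := x < y
  le_refl x := .inr rfl
  le_trans x y z := by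
    rintro (h | rfl) (h' | rfl)
    · exact .inl (lt_trans' h h')
    · exact .inl h
    · exact .inl h'
    · exact .inr rfl
  lt_iff_le_not_ge x y := by
    constructor
    · intro h
      refine ⟨.inl h, ?_⟩
      rintro (h' | rfl)
      · exact not_lt_self x (lt_trans' h h')
      · exact not_lt_self y h
    · rintro ⟨h | rfl, h'⟩
      · exact h
      · exact absurd (.inr rfl) h'
  le_antisymm x y := by
    rintro (h | rfl) (h' | h')
    · exact absurd (lt_trans' h h') (not_lt_self x)
    · exact h'.symm
    · rfl
    · rfl
  le_total x y := by
    rcases lt_trichotomy' x y with h | h | h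
    · exact .inl (.inl h)
    · exact .inl (.inr h)
    · exact .inr (.inl h)
  toDecidableLE := Classical.decRel _

instance QD.le (f g : M → M) [TD f] [TD g] : QD fun x => f x ≤ g x :=
  (inferInstance : QD fun x => f x < g x ∨ f x = g x).congr fun _ => le_iff_lt_or_eq.symm
instance QD.eta_le (a : M) : QD (LE.le a : M → Prop) := QD.le (fun _ => a) fun x => x

theorem monus_eq_zero_iff_le {x z : M} : monus x z = 0 ↔ x ≤ z := monus_eq_zero

theorem sB_le_sB {a b : Prop} {x z : M} : sB a x ≤ sB b z ↔ x < z ∨ x = z ∧ (a → b) := by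
  rw [le_iff_lt_or_eq, sB_lt_sB, sB_inj]
  tauto

theorem zero_le' (x : M) : 0 ≤ x := by
  refine notation_induction (P := fun x => 0 ≤ x) le_rfl (fun x ih b => ?_) x
  rw [← s0_zero, ← sB_false, sB_le_sB]
  have := le_iff_lt_or_eq.1 ih
  tauto

theorem pos_iff {x : M} : 0 < x ↔ x ≠ 0 := by
  rw [lt_iff_le_and_ne, and_iff_right (zero_le' x), ne_comm]

theorem lt_sc {u v : M} : u < sc v ↔ u ≤ v := by
  refine ind2 (P := fun u v => u < sc v ↔ u ≤ v) ?_ (fun u v a b _ ih => ?_) u v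
  · exact iff_of_true (pos_iff.2 (sc_ne_zero 0)) le_rfl
  by_cases hb : b
  · simp only [hb, sB_true, sc_s1]
    rw [← sB_false, ← sB_true, sB_lt_sB, sB_le_sB, ih, le_iff_lt_or_eq]
    tauto
  · simp only [hb, sB_false, sc_s0]
    rw [← sB_false, ← sB_true, sB_lt_sB, sB_le_sB]
    tauto

theorem sc_le_iff {u v : M} : sc u ≤ v ↔ u < v := by
  rw [← not_lt, lt_sc, not_le]

theorem sc_le_sc {u v : M} : sc u ≤ sc v ↔ u ≤ v := by rw [sc_le_iff, lt_sc]

theorem lt_sc_self (u : M) : u < sc u := lt_sc.2 le_rfl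

theorem sB_mono {a b : Prop} {x y : M} (h : x < y) : sB a x < sB b y := sB_lt_sB.2 (.inl h)

theorem add_lt_add_left' {u v : M} (h : u < v) (w : M) : u + w < v + w := by
  refine ind3 (P := fun u v w => u < v → u + w < v + w) (fun h => absurd h (not_lt_self 0))
    (fun u v w a b c _ ih h => ?_) u v w h
  rw [sB_lt_sB] at h
  have hle : u + w ≤ v + w := by
    rcases h with h | ⟨rfl, -⟩
    · exact (ih h).le
    · exact le_rfl
  by_cases hc : c
  · by_cases ha : a
    · have hlt := ih (h.resolve_right fun h => h.2.1 ha)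
      rw [add_sB_sB_of_and ha hc]
      by_cases hb : b
      · rw [add_sB_sB_of_and hb hc]
        exact sB_mono (lt_sc.2 (sc_le_iff.2 hlt))
      · rw [add_sB_sB_of_not (fun h => hb h.1), sB_lt_sB]
        rcases (sc_le_iff.2 hlt).lt_or_eq with h | h
        · exact .inl h
        · exact .inr ⟨h, id, .inr hc⟩
    · rw [add_sB_sB_of_not (fun h => ha h.1)]
      by_cases hb : b
      · rw [add_sB_sB_of_and hb hc]
        exact sB_mono (lt_sc.2 hle)
      · rw [add_sB_sB_of_not (fun h => hb h.1)]
        exact sB_mono (ih (h.resolve_right fun h => hb h.2.2))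
  · rw [add_sB_sB_of_not (fun h => hc h.2), add_sB_sB_of_not (fun h => hc h.2), sB_lt_sB]
    rcases h with h | ⟨rfl, h1, h2⟩
    · exact .inl (ih h)
    · exact .inr ⟨rfl, fun h => h.elim h1 hc, .inl h2⟩

theorem le_add_left' (u w : M) : w ≤ u + w := by
  by_cases hu : u = 0
  · rw [hu, add_comm', add_zero']
  · have := add_lt_add_left' (pos_iff.2 hu) w
    rw [add_comm' 0, add_zero'] at this
    exact this.le

theorem lel_iff {x y : M} : lel x y ↔ ln x ≤ ln y := by
  refine ind2 (P := fun x y => lel x y ↔ ln x ≤ ln y) (iff_of_true (zero_lel 0) le_rfl)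
    (fun x y a b _ ih => ?_) x y
  by_cases hx : sB a x = 0
  · rw [hx, ln_zero]
    exact iff_of_true (zero_lel _) (zero_le' _)
  by_cases hy : sB b y = 0
  · rw [hy, ln_zero, lel_zero]
    refine iff_of_false hx fun h => ?_
    rw [ln_sB hx] at h
    exact sc_ne_zero _ (le_antisymm h (zero_le' _))
  rw [sB_lel_sB hy, ln_sB hx, ln_sB hy, sc_le_sc, ih]

theorem ltl_iff {x y : M} : ltl x y ↔ ln x < ln y := by rw [ltl, lel_iff, not_le]

theorem eql_iff {x y : M} : eql x y ↔ ln x = ln y := by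
  rw [eql, lel_iff, lel_iff, le_antisymm_iff]

theorem ln_eq_zero {x : M} : ln x = 0 ↔ x = 0 := by
  rw [← lel_zero (x := x), lel_iff, ln_zero, le_antisymm_iff, and_iff_left (zero_le' _)]

/-- `x ↦ x.2^{|y|}` adds lengths. -/
theorem ln_pd (y x : M) (hx : x ≠ 0) : ln (pd y x) = ln x + ln y := by
  have := ind (P := fun y => pd y x ≠ 0 ∧ ln (pd y x) = ln x + ln y)
    (by rw [pd_zero, ln_zero, add_zero']; exact ⟨hx, rfl⟩) (fun y b hy ih => ?_) y
  · exact this.2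
  · have h0 : pd (sB b y) x ≠ 0 := by rw [pd_sB hy, Ne, s0_eq_zero]; exact ih.1
    refine ⟨h0, ?_⟩
    rw [pd_sB hy, ln_s0 ih.1, ih.2, ln_sB hy, add_sc]

theorem pd_ne_zero (y : M) {x : M} (hx : x ≠ 0) : pd y x ≠ 0 := by
  refine ind (P := fun y => pd y x ≠ 0) (by rwa [pd_zero]) (fun y b hy ih => ?_) y
  rwa [pd_sB hy, Ne, s0_eq_zero]

/-- `c < 2^|y|` means that `c` is not longer than `y`. -/
theorem lt_pd_iff {c y : M} : c < pd y (s1 0) ↔ ln c ≤ ln y := by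
  rw [← lel_iff]
  refine ind2 (P := fun c y => c < pd y (s1 0) ↔ lel c y) ?_ (fun c y a b _ ih => ?_) c y
  · rw [pd_zero]
    exact iff_of_true (pos_iff.2 (s1_ne_zero 0)) (zero_lel 0)
  by_cases hy : sB b y = 0
  · rw [hy, pd_zero, lel_zero, ← sc_zero, lt_sc, le_antisymm_iff, and_iff_left (zero_le' _)]
  · rw [pd_sB hy, sB_lel_sB hy, ← sB_false, sB_lt_sB, ← ih]
    tauto

end Mdl

namespace ALV

/-! ### Further explicit symbols, and their freeness of `tree` -/

/-- `(x, m) ↦` the prefix of `x` of length `min(m, |x|)`: one digit is removed for each proper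
prefix of `x` whose length is at least `m`. -/
def trunc : ALV 2 :=
  comp shr ![proj 2 0,
    crn (zeroC 1) (neg (comp monus ![proj 2 1, comp len ![proj 2 0]]))
      (neg (comp monus ![proj 2 1, comp len ![proj 2 0]]))]

/-- `(y, x) ↦ x` with a digit `1` appended for each digit of `y`. -/
def cat : ALV 2 := crn (proj 1 0) (oneC 2) (oneC 2)

/-- `(c, x) ↦ x` if the truth value of `c` is true, and `0` otherwise. -/
def mask {n : ℕ} (c x : ALV n) : ALV n :=
  comp (crn (zeroC 1) (zeroC 2) (proj 2 1)) ![x, c]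

/-- Substitute `q` for the first argument of `f`, and let `f` keep the other ones; `k` further
arguments may be inserted between the two. -/
def substHead {n : ℕ} (f : ALV (n + 1)) {k : ℕ} (r : Fin n → Fin k) (q : ALV k) : ALV k :=
  comp f (Matrix.vecCons q fun i => proj k (r i))

theorem treeFree_comp {k n : ℕ} {f : ALV k} {g : Fin k → ALV n} (hf : f.TreeFree)
    (hg : ∀ i, (g i).TreeFree) : (comp f g).TreeFree := ⟨hf, hg⟩

theorem treeFree_comp1 {n : ℕ} {f : ALV 1} {a : ALV n} (hf : f.TreeFree) (ha : a.TreeFree) :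
    (comp f ![a]).TreeFree := ⟨hf, by simpa using ha⟩

theorem treeFree_comp2 {n : ℕ} {f : ALV 2} {a b : ALV n} (hf : f.TreeFree) (ha : a.TreeFree)
    (hb : b.TreeFree) : (comp f ![a, b]).TreeFree := ⟨hf, by simp [Fin.forall_fin_two, ha, hb]⟩

theorem treeFree_crn {n : ℕ} {g : ALV n} {h0 h1 : ALV (n + 1)} (hg : g.TreeFree)
    (hh0 : h0.TreeFree) (hh1 : h1.TreeFree) : (crn g h0 h1).TreeFree := ⟨hg, hh0, hh1⟩

theorem treeFree_proj {n : ℕ} (i : Fin n) : (proj n i).TreeFree := trivial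

theorem treeFree_cons {k n : ℕ} {q : ALV k} {g : Fin n → ALV k} (hq : q.TreeFree)
    (hg : ∀ i, (g i).TreeFree) : ∀ i, (Matrix.vecCons q g i).TreeFree :=
  fun i => Fin.cases hq hg i

theorem treeFree_zeroC (n : ℕ) : (zeroC n).TreeFree := ⟨trivial, fun i => i.elim0⟩
theorem treeFree_oneC (n : ℕ) : (oneC n).TreeFree := treeFree_comp1 trivial (treeFree_zeroC n)
theorem treeFree_padRec : padRec.TreeFree :=
  treeFree_crn trivial (treeFree_zeroC 2) (treeFree_zeroC 2)
theorem treeFree_pad : pad.TreeFree := treeFree_comp2 treeFree_padRec trivial trivial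
theorem treeFree_half : half.TreeFree :=
  treeFree_crn trivial (treeFree_comp2 trivial (treeFree_zeroC 1) trivial)
    (treeFree_comp2 trivial (treeFree_zeroC 1) trivial)

section

variable {n : ℕ} {a b : ALV n}

theorem treeFree_neg (ha : a.TreeFree) : (neg a).TreeFree :=
  treeFree_comp2 trivial (treeFree_zeroC n) (treeFree_comp2 treeFree_padRec ha (treeFree_oneC n))

theorem treeFree_disj (ha : a.TreeFree) (hb : b.TreeFree) : (disj a b).TreeFree :=
  treeFree_comp (treeFree_crn trivial trivial trivial)
    (treeFree_cons (treeFree_oneC n) (treeFree_cons ha (treeFree_cons hb fun i => i.elim0)))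

theorem treeFree_conj (ha : a.TreeFree) (hb : b.TreeFree) : (conj a b).TreeFree :=
  treeFree_neg (treeFree_disj (treeFree_neg ha) (treeFree_neg hb))

theorem treeFree_exor (ha : a.TreeFree) (hb : b.TreeFree) : (exor a b).TreeFree :=
  treeFree_conj (treeFree_disj ha hb) (treeFree_neg (treeFree_conj ha hb))

theorem treeFree_exPrefix {a : ALV (n + 1)} (ha : a.TreeFree) : (exPrefix a).TreeFree :=
  treeFree_crn (treeFree_zeroC n) ha ha

theorem treeFree_ones : ones.TreeFree :=
  treeFree_crn trivial (treeFree_oneC 1) (treeFree_oneC 1)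

theorem treeFree_lenLt (ha : a.TreeFree) (hb : b.TreeFree) : (lenLt a b).TreeFree :=
  treeFree_comp2 trivial (treeFree_comp1 trivial ha) (treeFree_comp1 treeFree_ones hb)

theorem treeFree_bitAt (ha : a.TreeFree) (hb : b.TreeFree) : (bitAt a b).TreeFree :=
  treeFree_comp2 trivial (treeFree_comp1 trivial ha) hb

theorem treeFree_compr {e : ALV (n + 1)} (he : e.TreeFree) : (compr e).TreeFree := by
  have h : (bitAt (proj (n + 2) 0) (comp (crn (oneC n) e e) fun i => proj (n + 2) i.succ)).TreeFree :=
    treeFree_bitAt trivial (treeFree_comp (treeFree_crn (treeFree_oneC n) he he) fun _ => trivial)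
  exact treeFree_comp (treeFree_crn (treeFree_zeroC _) h h)
    (treeFree_cons trivial fun _ => trivial)

theorem treeFree_carry {gen prop : ALV 3} (hg : gen.TreeFree) (hp : prop.TreeFree) :
    (carry gen prop).TreeFree := by
  refine treeFree_comp (treeFree_exPrefix (treeFree_conj (treeFree_comp hg ?_)
    (treeFree_neg (treeFree_comp (treeFree_exPrefix (treeFree_conj (treeFree_lenLt ?_ ?_)
      (treeFree_neg (treeFree_comp hp ?_)))) ?_)))) ?_
  all_goals first | exact treeFree_proj _ | simp [Fin.forall_fin_succ, treeFree_proj]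

theorem treeFree_bx : bx.TreeFree := treeFree_bitAt trivial trivial
theorem treeFree_bz : bz.TreeFree := treeFree_bitAt trivial trivial

theorem treeFree_long (ha : a.TreeFree) (hb : b.TreeFree) : (long a b).TreeFree :=
  treeFree_comp2 treeFree_padRec ha (treeFree_comp1 trivial hb)

theorem treeFree_borrow : borrow.TreeFree :=
  treeFree_carry (treeFree_conj (treeFree_neg treeFree_bx) treeFree_bz)
    (treeFree_disj (treeFree_neg treeFree_bx) treeFree_bz)

theorem treeFree_add : add.TreeFree :=
  treeFree_comp (treeFree_compr (treeFree_exor (treeFree_exor treeFree_bx treeFree_bz)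
      (treeFree_carry (treeFree_conj treeFree_bx treeFree_bz)
        (treeFree_disj treeFree_bx treeFree_bz))))
    (treeFree_cons (treeFree_long trivial trivial)
      (treeFree_cons trivial (treeFree_cons trivial fun i => i.elim0)))

theorem treeFree_monus : monus.TreeFree :=
  treeFree_comp (treeFree_compr (treeFree_conj
      (treeFree_exor (treeFree_exor treeFree_bx treeFree_bz) treeFree_borrow)
      (treeFree_neg (treeFree_comp treeFree_borrow
        (treeFree_cons (treeFree_long trivial trivial)
          (treeFree_cons trivial (treeFree_cons trivial fun i => i.elim0)))))))
    (treeFree_cons (treeFree_long trivial trivial)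
      (treeFree_cons trivial (treeFree_cons trivial fun i => i.elim0)))

theorem treeFree_part : part.TreeFree := by
  have h : (comp add ![proj 4 2, comp len ![proj 4 0]]).TreeFree :=
    treeFree_comp2 treeFree_add trivial (treeFree_comp1 trivial trivial)
  refine treeFree_comp (treeFree_compr (treeFree_conj (treeFree_comp2 trivial h trivial)
    (treeFree_comp2 treeFree_monus trivial h))) ?_
  simp [Fin.forall_fin_succ, treeFree_proj]

theorem treeFree_shr : shr.TreeFree := by
  simp [shr, TreeFree, bitAt, Fin.forall_fin_succ, treeFree_zeroC]

theorem treeFree_trunc : trunc.TreeFree := by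
  have h : (neg (comp monus ![proj 2 1, comp len ![proj 2 0]])).TreeFree :=
    treeFree_neg (treeFree_comp2 treeFree_monus trivial (treeFree_comp1 trivial trivial))
  exact treeFree_comp2 treeFree_shr trivial (treeFree_crn (treeFree_zeroC 1) h h)

theorem treeFree_cat : cat.TreeFree :=
  treeFree_crn trivial (treeFree_oneC 2) (treeFree_oneC 2)

theorem treeFree_mask (ha : a.TreeFree) (hb : b.TreeFree) : (mask a b).TreeFree :=
  treeFree_comp2 (treeFree_crn (treeFree_zeroC 1) (treeFree_zeroC 2) trivial) hb ha

theorem treeFree_substHead {f : ALV (n + 1)} {k : ℕ} (r : Fin n → Fin k) {q : ALV k}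
    (hf : f.TreeFree) (hq : q.TreeFree) : (substHead f r q).TreeFree :=
  treeFree_comp hf (treeFree_cons hq fun _ => trivial)

end

theorem treeFree_ofBA : {n : ℕ} → (f : BA.Func n) → (ofBA f).TreeFree
  | _, .zero => trivial
  | _, .one => treeFree_oneC 0
  | _, .add => treeFree_add
  | _, .half => treeFree_half
  | _, .len => trivial
  | _, .smash => trivial
  | _, .pad => treeFree_pad
  | _, .monus => treeFree_monus
  | _, .part => treeFree_part

end ALV

namespace Mdl

variable {M : Mdl}

/-! ### Strings of a given length -/

/-- The prefix of `x` of length `min(m, |x|)`. -/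
def trunc (x m : M) : M := ev ALV.trunc ![x, m]

instance TD.trunc (f g : M → M) [TD f] [TD g] : TD fun x => trunc (f x) (g x) :=
  TD.ev ALV.trunc fun x => ![f x, g x]
instance TD.eta_trunc (a : M) : TD (Mdl.trunc a) := TD.trunc (fun _ => a) fun x => x

@[simp] theorem ev_trunc (x m : M) : ev ALV.trunc ![x, m] = trunc x m := rfl
@[simp] theorem ev_monus (x m : M) : ev ALV.monus ![x, m] = monus x m := rfl
@[simp] theorem ev_add (x m : M) : ev ALV.add ![x, m] = x + m := rfl

theorem trunc_spec (m : M) : ∃ w : M → M, (∀ x, trunc x m = shr x (w x)) ∧ w 0 = 0 ∧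
    (∃ _ : TD w, True) ∧ ∀ b x, sB b x ≠ 0 → w (sB b x) = sB (m ≤ ln x) (w x) := by
  set H : ALV 2 := ALV.neg (ALV.comp ALV.monus ![ALV.proj 2 1, ALV.comp ALV.len ![ALV.proj 2 0]])
    with hH
  refine ⟨fun x => ev (ALV.crn (ALV.zeroC 1) H H) ![x, m], fun x => ?_, ?_, ⟨inferInstance, trivial⟩,
    fun b x hx => ?_⟩
  · rw [trunc, ALV.trunc, ev_comp2, ev_shr, ev_proj]
    rfl
  · exact (ev_crn_zero _ _ _ ![m]).trans (ev_zeroC _)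
  · refine (ev_crn_sB _ _ hx ![m]).trans ?_
    congr 1
    rw [← tv, hH, tv_neg, tv, not_not, ev_comp2, ev_comp1]
    simp [monus_eq_zero_iff_le]

theorem trunc_sB {b : Prop} {x m : M} (hx : sB b x ≠ 0) (h : m ≤ ln x) :
    trunc (sB b x) m = trunc x m := by
  obtain ⟨w, h1, -, -, h3⟩ := trunc_spec m
  rw [h1, h1, h3 b x hx, sB_pos h, shr_s1, half_sB]

theorem trunc_of_le {x m : M} (h : ln x ≤ m) : trunc x m = x := by
  obtain ⟨w, h1, h0, ⟨_, -⟩, h3⟩ := trunc_spec m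
  have key : ∀ x, ln x ≤ m → w x = 0 := by
    refine ind (fun _ => h0) fun x b hx ih h => ?_
    rw [ln_sB hx, sc_le_iff] at h
    rw [h3 b x hx, ih h.le, sB_neg (not_le.2 h), s0_zero]
  rw [h1, key x h, shr_zero]

theorem ln_trunc {x m : M} (h : m ≤ ln x) : ln (trunc x m) = m := by
  refine ind (P := fun x => m ≤ ln x → ln (trunc x m) = m) (fun h => ?_) (fun x b hx ih h => ?_) x h
  · rw [trunc_of_le (by rw [ln_zero]; exact zero_le' m), ln_zero]
    rw [ln_zero] at h
    exact le_antisymm (zero_le' m) h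
  · rcases le_or_gt m (ln x) with h' | h'
    · rw [trunc_sB hx h', ih h']
    · have : ln (sB b x) ≤ m := by rwa [ln_sB hx, sc_le_iff]
      rw [trunc_of_le this]
      exact le_antisymm this h

/-- The numbers up to `|x|` are the lengths of the strings that are not longer than `x`. -/
theorem exists_ln_eq {x m : M} (h : m ≤ ln x) : ∃ z, lel z x ∧ ln z = m :=
  ⟨trunc x m, by rw [lel_iff, ln_trunc h]; exact h, ln_trunc h⟩

/-- `x` with a digit `1` appended for each digit of `y`. -/
def cat (y x : M) : M := ev ALV.cat ![y, x]

instance TD.cat (f g : M → M) [TD f] [TD g] : TD fun x => cat (f x) (g x) :=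
  TD.ev ALV.cat fun x => ![f x, g x]
instance TD.eta_cat (a : M) : TD (Mdl.cat a) := TD.cat (fun _ => a) fun x => x

@[simp] theorem ev_cat (y x : M) : ev ALV.cat ![y, x] = cat y x := rfl

theorem cat_zero (x : M) : cat 0 x = x := (ev_crn_zero _ _ _ ![x]).trans (ev_proj _ _)

theorem cat_sB {b : Prop} {y : M} (hy : sB b y ≠ 0) (x : M) : cat (sB b y) x = s1 (cat y x) := by
  refine (ev_crn_sB _ _ hy ![x]).trans ?_
  rw [ev_oneC, sB_pos (s1_ne_zero 0)]
  rfl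

theorem ln_cat (y x : M) : ln (cat y x) = ln x + ln y := by
  refine ind (P := fun y => ln (cat y x) = ln x + ln y) ?_ (fun y b hy ih => ?_) y
  · rw [cat_zero, ln_zero, add_zero']
  · rw [cat_sB hy, ln_s1, ih, ln_sB hy, add_sc]

theorem pd_cat (y x z : M) : pd (cat y x) z = pd y (pd x z) := by
  refine ind (P := fun y => pd (cat y x) z = pd y (pd x z)) ?_ (fun y b hy ih => ?_) y
  · rw [cat_zero, pd_zero]
  · rw [cat_sB hy, ← sB_true, pd_sB (s1_ne_zero' _), ih, pd_sB hy]

theorem s0_add (x y : M) : s0 (x + y) = s0 x + s0 y := by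
  rw [← sB_false x, ← sB_false y, add_sB_sB_of_not (by simp)]
  simp

theorem pd_add (y a b : M) : pd y (a + b) = pd y a + pd y b := by
  refine ind (P := fun y => pd y (a + b) = pd y a + pd y b) (by simp) (fun y b hy ih => ?_) y
  rw [pd_sB hy, pd_sB hy, pd_sB hy, ih, s0_add]

theorem pd_zero_right (y : M) : pd y 0 = 0 := by
  refine ind (P := fun y => pd y 0 = 0) (pd_zero 0) (fun y b hy ih => ?_) y
  rw [pd_sB hy, ih, s0_zero]

theorem smash_ne_zero (u v : M) : smash u v ≠ 0 := by
  refine ind (P := fun u => smash u v ≠ 0) ?_ (fun u b hu ih => ?_) u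
  · rw [smash_zero]
    exact s1_ne_zero 0
  · rw [smash_sB hu]
    exact pd_ne_zero v ih

theorem ln_one : ln (s1 0 : M) = s1 0 := by rw [ln_s1, ln_zero, sc_zero]

/-- The length of `u # v` is `|u| |v| + 1`; here `|v|` is a power of two. -/
theorem ln_smash {v y : M} (hv : ln v = pd y (s1 0)) (u : M) :
    ln (smash u v) = sc (pd y (ln u)) := by
  refine ind (P := fun u => ln (smash u v) = sc (pd y (ln u))) ?_ (fun u b hu ih => ?_) u
  · rw [smash_zero, ln_zero, pd_zero_right, ln_one, sc_zero]
  · rw [smash_sB hu, ln_pd _ _ (smash_ne_zero u v), ih, hv, ln_sB hu, sc_def (ln u), pd_add,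
      add_comm', add_sc, add_comm']

theorem s0_le_s0 {x y : M} : s0 x ≤ s0 y ↔ x ≤ y := by
  rw [← sB_false, ← sB_false, sB_le_sB, le_iff_lt_or_eq]
  tauto

/-- `2^{|m|} ≤ 2m` -/
theorem pd_one_le {m : M} (hm : m ≠ 0) : pd m (s1 0) ≤ s0 m := by
  refine ind (P := fun m => m ≠ 0 → pd m (s1 0) ≤ s0 m) (fun h => absurd rfl h)
    (fun m b hm ih _ => ?_) m hm
  rw [pd_sB hm, s0_le_s0]
  by_cases h : m = 0
  · subst h
    have hb : b := by
      by_contra hb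
      exact hm (by rw [sB_neg hb, s0_zero])
    rw [pd_zero, sB_pos hb]
  · refine (ih h).trans ?_
    rw [← sB_false, sB_le_sB]
    exact .inr ⟨rfl, False.elim⟩

theorem pd_le_pd_right (w : M) {x y : M} (h : x ≤ y) : pd w x ≤ pd w y := by
  refine ind (P := fun w => pd w x ≤ pd w y) (by simpa using h) (fun w b hw ih => ?_) w
  rwa [pd_sB hw, pd_sB hw, s0_le_s0]

theorem le_s0 (x : M) : x ≤ s0 x := by
  refine notation_induction (P := fun x => x ≤ s0 x) (by rw [s0_zero]) (fun x ih b => ?_) x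
  rcases le_iff_lt_or_eq.1 ih with h | h
  · rw [← sB_false (sB b x), sB_le_sB]
    by_cases hb : b
    · rw [sB_pos hb]
      rw [← sc_s0, sc_def] at *
      exact .inl (lt_of_lt_of_le h (by rw [← sc_def]; exact (lt_sc_self _).le))
    · rw [sB_neg hb]
      exact .inl h
  · have hx : x = 0 := by
      refine ind (P := fun x => x = s0 x → x = 0) (fun _ => rfl) (fun x b hx ih h => ?_) x h
      rw [← sB_false (sB b x), sB_inj] at h
      have hb : ¬ b := fun hb => (h.1.1 hb)
      have := ih (by rw [← sB_neg hb]; exact h.2)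
      rw [this, sB_neg hb, s0_zero]
    subst hx
    rw [← sB_false (sB b 0), sB_le_sB]
    by_cases hb : b
    · rw [sB_pos hb]
      exact .inl (pos_iff.2 (s1_ne_zero 0))
    · rw [sB_neg hb, s0_zero]
      exact .inr ⟨rfl, fun h => absurd h hb⟩

theorem pd_le_pd_left {w y : M} (h : lel w y) (x : M) : pd w x ≤ pd y x := by
  refine ind2 (P := fun w y => lel w y → pd w x ≤ pd y x) (fun _ => le_rfl)
    (fun w y a b _ ih h => ?_) w y h
  by_cases hw : sB a w = 0
  · rw [hw, pd_zero]
    refine ind (P := fun z => x ≤ pd z x) (by rw [pd_zero]) (fun z c hz ih => ?_) (sB b y)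
    rw [pd_sB hz]
    exact ih.trans (le_s0 _)
  by_cases hy : sB b y = 0
  · rw [hy, lel_zero] at h
    exact absurd h hw
  rw [pd_sB hw, pd_sB hy, s0_le_s0]
  exact ih ((sB_lel_sB hy a w).1 h)

theorem ln_add_ln_shr {p L : M} (h : lel p L) : ln p + ln (shr L p) = ln L := by
  refine ind2 (P := fun p L => lel p L → ln p + ln (shr L p) = ln L) (fun _ => ?_)
    (fun p L a b _ ih h => ?_) p L h
  · rw [shr_zero, ln_zero, add_zero']
  by_cases hp : sB a p = 0
  · rw [hp, shr_zero, ln_zero, add_comm', add_zero']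
  by_cases hL : sB b L = 0
  · rw [hL, lel_zero] at h
    exact absurd h hp
  rw [sB_shr_sB hp, ln_sB hp, ln_sB hL, add_comm', add_sc, add_comm', ih ((sB_lel_sB hL a p).1 h)]

theorem shr_shr (x y i : M) : shr (shr x y) i = shr x (cat i y) := by
  refine ind (P := fun i => shr (shr x y) i = shr x (cat i y)) ?_ (fun i b hi ih => ?_) i
  · rw [cat_zero, shr_zero]
  · rw [cat_sB hi, shr_sB hi, ← half_shr, ih, shr_s1, half_shr]

theorem shr_congr {y y' : M} (h : eql y y') (x : M) : shr x y = shr x y' := by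
  refine ext_at fun i => ?_
  rw [← od_shr, ← od_shr, shr_shr, shr_shr, od_shr, od_shr]
  refine at_congr ?_ x
  rw [eql_iff] at h ⊢
  rw [ln_cat, ln_cat, h]

/-! ### The maximum principle -/

/-- A property of numbers that holds for some number below `|Z|` holds for a greatest one. -/
theorem exists_greatest {n : ℕ} (F : ALV (n + 1)) (v : Fin n → M) {Z m : M} (hm : m < ln Z)
    (hF : tv F (Matrix.vecCons m v)) :
    ∃ m < ln Z, tv F (Matrix.vecCons m v) ∧
      ∀ m', m < m' → m' < ln Z → ¬ tv F (Matrix.vecCons m' v) := by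
  by_contra! hno
  -- `Q(z)`: the property holds for some `|u|` with `|z| ≤ |u| < |Z|`
  set a : ALV (n + 2) := ALV.conj (ALV.neg (ALV.lenLt (ALV.proj _ 0) (ALV.proj _ 1)))
    (ALV.substHead F (fun i => i.succ.succ) (ALV.comp ALV.len ![ALV.proj _ 0])) with ha
  have hs : ∀ u z : M, tv a (Matrix.vecCons u (Matrix.vecCons z v)) ↔
      lel z u ∧ tv F (Matrix.vecCons (ln u) v) := by
    intro u z
    rw [ha, tv_conj, tv_neg, tv_lenLt, ALV.substHead, not_ltl, tv, ev_comp]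
    refine and_congr (by simp) (Eq.to_iff ?_)
    rw [tv]
    congr 2
    funext i
    refine Fin.cases ?_ (fun i => ?_) i <;> simp
  have hinv : ∀ z, LenInv a (Matrix.vecCons z v) := fun z y y' h => by
    rw [hs, hs, ln_eq_of_eql h, lel_congr h]
  have hQ : ∀ z, tv (ALV.exPrefix a) (Matrix.vecCons Z (Matrix.vecCons z v)) ↔
      ∃ u, ltl u Z ∧ lel z u ∧ tv F (Matrix.vecCons (ln u) v) := fun z => by
    rw [tv_exPrefix (hinv z)]
    simp only [hs]
  have key : ∀ z, tv (ALV.exPrefix a) (Matrix.vecCons Z (Matrix.vecCons z v)) := by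
    refine ind ?_ fun z b hz ih => ?_
    · obtain ⟨u, hu, rfl⟩ := exists_ln_eq hm.le
      exact (hQ 0).2 ⟨u, ltl_iff.2 hm, zero_lel u, hF⟩
    · rw [hQ] at ih ⊢
      obtain ⟨u, hu, hzu, h⟩ := ih
      obtain ⟨m', h1, h2, h3⟩ := hno _ (ltl_iff.1 hu) h
      obtain ⟨u', hu', rfl⟩ := exists_ln_eq h2.le
      exact ⟨u', ltl_iff.2 h2, (sB_lel_iff_ltl hz u').2 (ltl_of_lel_of_ltl hzu (ltl_iff.2 h1)), h3⟩
  obtain ⟨u, hu, hZ, -⟩ := (hQ Z).1 (key Z)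
  exact hu hZ

end Mdl

/-! ### Sharply bounded formulas and linear forms -/

namespace ALV

/-- A term of bounded arithmetic as a function symbol, for a reading `ρ` of its variables. -/
def ofTerm {β : Type} {n : ℕ} (ρ : β → ALV n) : LBA.Term β → ALV n
  | .var a => ρ a
  | .func f ts => comp (ofBA f) fun i => ofTerm ρ (ts i)

theorem treeFree_ofTerm {β : Type} {n : ℕ} {ρ : β → ALV n} (hρ : ∀ b, (ρ b).TreeFree) :
    (t : LBA.Term β) → (ofTerm ρ t).TreeFree
  | .var a => hρ a
  | .func f ts => treeFree_comp (treeFree_ofBA f) fun i => treeFree_ofTerm hρ (ts i)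

end ALV

namespace Mdl

variable {M : Mdl}

theorem ev_ofTerm {β : Type} {n : ℕ} (ρ : β → ALV n) (v : Fin n → M) :
    (t : LBA.Term β) →
      ev (ALV.ofTerm ρ t) v = (QALV.ofTerm t).realize fun b => ev (ρ b) v
  | .var a => rfl
  | .func f ts => by
      rw [ALV.ofTerm, ev_comp, QALV.ofTerm, realize_app]
      congr 1
      funext i
      exact ev_ofTerm ρ v (ts i)

theorem ofTerm_relabel {β γ : Type} (r : β → γ) :
    (t : LBA.Term β) → QALV.ofTerm (t.relabel r) = (QALV.ofTerm t).relabel r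
  | .var a => rfl
  | .func f ts => by
      change QALV.app _ _ = Term.func _ _
      rw [QALV.app]
      congr 1
      funext i
      exact ofTerm_relabel r (ts i)

theorem realize_le {α : Type} {k : ℕ} (s t : LBA.Term (α ⊕ Fin k)) (v : α → M) (xs : Fin k → M) :
    (QALV.ofFormula (BA.le s t)).Realize v xs ↔
      (QALV.ofTerm s).realize (Sum.elim v xs) ≤ (QALV.ofTerm t).realize (Sum.elim v xs) := by
  rw [← monus_eq_zero_iff_le]
  change (QALV.app ALV.monus ![QALV.ofTerm s, QALV.ofTerm t]).realize _ =
    QALV.zero.realize _ ↔ _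
  rw [realize_app2, realize_zero, ev_monus]

theorem realize_bound {α : Type} {k : ℕ} (t : LBA.Term (α ⊕ Fin k)) (v : α → M) (xs : Fin k → M)
    (y : M) : (QALV.ofFormula (BA.bound t)).Realize v (Fin.snoc (α := fun _ => M) xs y) ↔
      y ≤ ln ((QALV.ofTerm t).realize (Sum.elim v xs)) := by
  have e : (QALV.ofTerm (BA.len (BA.lift t))).realize
      (Sum.elim v (Fin.snoc (α := fun _ => M) xs y)) =
      ln ((QALV.ofTerm t).realize (Sum.elim v xs)) := by
    change (QALV.app ALV.len fun i => QALV.ofTerm (![BA.lift t] i)).realize _ = _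
    rw [realize_app, ln]
    congr 1
    funext i
    rw [Subsingleton.elim i 0]
    change (QALV.ofTerm (BA.lift t)).realize _ = (QALV.ofTerm t).realize _
    rw [BA.lift, ofTerm_relabel, Term.realize_relabel]
    congr 1
    funext a
    rcases a with a | i <;> simp
  rw [BA.bound, realize_le, e]
  simp [QALV.ofTerm]

/-- `Σ₀ᵇ`-formulas are decided by symbols without `tree`: in a sharply bounded quantifier, the
number `y ≤ |t|` is replaced by the length of a proper prefix of `s₁(t)`. -/
theorem exists_sigma0_symbol {α : Type} {k : ℕ} {φ : LBA.BoundedFormula α k} (h : BA.IsSigma0 φ) :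
    ∀ {n : ℕ} (ρ : α ⊕ Fin k → ALV n), (∀ b, (ρ b).TreeFree) →
      ∃ F : ALV n, F.TreeFree ∧ ∀ (M : Mdl) (v : Fin n → M), tv F v ↔
        (QALV.ofFormula φ).Realize (fun a => ev (ρ (Sum.inl a)) v)
          (fun i => ev (ρ (Sum.inr i)) v) := by
  have elim_eq : ∀ {k n : ℕ} (ρ : α ⊕ Fin k → ALV n) (M : Mdl) (v : Fin n → M),
      (Sum.elim (fun a => ev (ρ (Sum.inl a)) v) fun i => ev (ρ (Sum.inr i)) v) =
        fun b => ev (ρ b) v := fun ρ M v => by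
    funext b
    rcases b with a | i <;> rfl
  -- the common part of the two quantifiers
  have quant : ∀ {k : ℕ} (t : LBA.Term (α ⊕ Fin k)) (φ : LBA.BoundedFormula α (k + 1)),
      (∀ {n : ℕ} (ρ : α ⊕ Fin (k + 1) → ALV n), (∀ b, (ρ b).TreeFree) →
        ∃ F : ALV n, F.TreeFree ∧ ∀ (M : Mdl) (v : Fin n → M), tv F v ↔
          (QALV.ofFormula φ).Realize (fun a => ev (ρ (Sum.inl a)) v)
            (fun i => ev (ρ (Sum.inr i)) v)) →
      ∀ {n : ℕ} (ρ : α ⊕ Fin k → ALV n), (∀ b, (ρ b).TreeFree) → ∀ pos : Bool,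
      ∃ F : ALV n, F.TreeFree ∧ ∀ (M : Mdl) (v : Fin n → M), tv F v ↔
        ∃ y : M, y ≤ ln ((QALV.ofTerm t).realize
            (Sum.elim (fun a => ev (ρ (Sum.inl a)) v) (fun i => ev (ρ (Sum.inr i)) v))) ∧
          (pos = true ↔ (QALV.ofFormula φ).Realize (fun a => ev (ρ (Sum.inl a)) v)
            (Fin.snoc (α := fun _ => M) (fun i => ev (ρ (Sum.inr i)) v) y)) := by
    intro k t φ ih n ρ hρ pos
    let sh : ALV n → ALV (n + 1) := fun F => ALV.comp F fun i => ALV.proj (n + 1) i.succ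
    have hsh : ∀ (M : Mdl) (F : ALV n) (z : M) (v : Fin n → M),
        ev (sh F) (Matrix.vecCons z v) = ev F v := fun M F z v => by
      rw [ev_comp]
      congr 1
      funext i
      simp
    have hshT : ∀ F : ALV n, F.TreeFree → (sh F).TreeFree := fun F hF => ⟨hF, fun _ => trivial⟩
    obtain ⟨F, hF, hev⟩ := ih (n := n + 1) (Sum.elim (fun a => sh (ρ (Sum.inl a)))
      (Fin.snoc (α := fun _ => ALV (n + 1)) (fun i => sh (ρ (Sum.inr i)))
        (ALV.comp ALV.len ![ALV.proj (n + 1) 0]))) (by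
        rintro (a | i)
        · exact hshT _ (hρ _)
        · refine Fin.lastCases ?_ (fun i => ?_) i
          · simp only [Sum.elim_inr, Fin.snoc_last]
            exact ALV.treeFree_comp1 (f := ALV.len) trivial (ALV.treeFree_proj 0)
          · simpa using hshT _ (hρ _))
    have hev' : ∀ (M : Mdl) (v : Fin n → M) (z : M), tv F (Matrix.vecCons z v) ↔
        (QALV.ofFormula φ).Realize (fun a => ev (ρ (Sum.inl a)) v)
          (Fin.snoc (α := fun _ => M) (fun i => ev (ρ (Sum.inr i)) v) (ln z)) := by
      intro M v z
      rw [hev]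
      refine iff_of_eq (congrArg₂ _ (funext fun a => ?_) (funext fun i => ?_))
      · exact hsh M _ z v
      · refine Fin.lastCases ?_ (fun i => ?_) i
        · simp
        · simpa using hsh M _ z v
    let F' : ALV (n + 1) := if pos then F else ALV.neg F
    have hF' : ∀ (M : Mdl) (v : Fin n → M) (z : M), tv F' (Matrix.vecCons z v) ↔
        (pos = true ↔ (QALV.ofFormula φ).Realize (fun a => ev (ρ (Sum.inl a)) v)
          (Fin.snoc (α := fun _ => M) (fun i => ev (ρ (Sum.inr i)) v) (ln z))) := by
      intro M v z
      cases pos <;> simp [F', hev']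
    refine ⟨ALV.comp (ALV.exPrefix F') (Matrix.vecCons (ALV.comp ALV.s1 ![ALV.ofTerm ρ t])
      fun i => ALV.proj n i), ?_, fun M v => ?_⟩
    · refine ALV.treeFree_comp (ALV.treeFree_exPrefix ?_) (ALV.treeFree_cons
        (ALV.treeFree_comp1 trivial (ALV.treeFree_ofTerm hρ t)) fun _ => trivial)
      cases pos
      · exact ALV.treeFree_neg hF
      · exact hF
    · have e : (fun i => ev (Matrix.vecCons (ALV.comp ALV.s1 ![ALV.ofTerm ρ t])
          (fun i => ALV.proj n i) i) v) = Matrix.vecCons (s1 (ev (ALV.ofTerm ρ t) v)) v := by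
        funext i
        refine Fin.cases ?_ (fun i => ?_) i <;> simp
      rw [tv, ev_comp, e, ← tv, tv_exPrefix, elim_eq, ← ev_ofTerm]
      · constructor
        · rintro ⟨u, hu, h⟩
          rw [← sB_true, ltl_sB (s1_ne_zero' _), lel_iff] at hu
          exact ⟨ln u, hu, (hF' M v u).1 h⟩
        · rintro ⟨y, hy, h⟩
          obtain ⟨u, hu, rfl⟩ := exists_ln_eq hy
          refine ⟨u, ?_, (hF' M v u).2 h⟩
          rwa [← sB_true, ltl_sB (s1_ne_zero' _)]
      · intro z z' hz
        rw [hF', hF', ln_eq_of_eql hz]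
  induction h with
  | falsum =>
    intro n ρ hρ
    exact ⟨ALV.zeroC n, ALV.treeFree_zeroC n, fun M v => iff_of_false (tv_zeroC v) id⟩
  | equal s t =>
    intro n ρ hρ
    refine ⟨ALV.conj (ALV.neg (ALV.comp ALV.monus ![ALV.ofTerm ρ s, ALV.ofTerm ρ t]))
      (ALV.neg (ALV.comp ALV.monus ![ALV.ofTerm ρ t, ALV.ofTerm ρ s])), ?_, fun M v => ?_⟩
    · have hs := ALV.treeFree_ofTerm hρ s
      have ht := ALV.treeFree_ofTerm hρ t
      exact ALV.treeFree_conj (ALV.treeFree_neg (ALV.treeFree_comp2 ALV.treeFree_monus hs ht))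
        (ALV.treeFree_neg (ALV.treeFree_comp2 ALV.treeFree_monus ht hs))
    · rw [tv_conj, tv_neg, tv_neg, tv, tv, not_not, not_not, ev_comp2, ev_comp2, ev_monus, ev_monus,
        monus_eq_zero_iff_le, monus_eq_zero_iff_le, ← le_antisymm_iff, ev_ofTerm, ev_ofTerm,
        ← elim_eq]
      rfl
  | le s t =>
    intro n ρ hρ
    refine ⟨ALV.neg (ALV.comp ALV.monus ![ALV.ofTerm ρ s, ALV.ofTerm ρ t]), ?_, fun M v => ?_⟩
    · exact ALV.treeFree_neg (ALV.treeFree_comp2 ALV.treeFree_monus (ALV.treeFree_ofTerm hρ s)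
        (ALV.treeFree_ofTerm hρ t))
    · rw [tv_neg, tv, not_not, ev_comp2, ev_monus, monus_eq_zero_iff_le, realize_le, ev_ofTerm,
        ev_ofTerm, ← elim_eq]
  | imp _ _ ih1 ih2 =>
    intro n ρ hρ
    obtain ⟨F, hF, hF'⟩ := ih1 ρ hρ
    obtain ⟨G, hG, hG'⟩ := ih2 ρ hρ
    refine ⟨ALV.disj (ALV.neg F) G, ALV.treeFree_disj (ALV.treeFree_neg hF) hG, fun M v => ?_⟩
    rw [tv_disj, tv_neg, hF', hG', QALV.ofFormula, BoundedFormula.realize_imp, imp_iff_not_or]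
  | ball t _ ih =>
    intro n ρ hρ
    obtain ⟨F, hF, hF'⟩ := quant t _ ih ρ hρ false
    refine ⟨ALV.neg F, ALV.treeFree_neg hF, fun M v => ?_⟩
    rw [tv_neg, hF', QALV.ofFormula, QALV.ofFormula, BoundedFormula.realize_all]
    simp only [BoundedFormula.realize_imp, realize_bound]
    push Not
    simp
  | bex t _ ih =>
    intro n ρ hρ
    obtain ⟨F, hF, hF'⟩ := quant t _ ih ρ hρ true
    refine ⟨F, hF, fun M v => ?_⟩
    rw [hF']
    change _ ↔ ¬ ∀ y : M, ¬ ¬ ((QALV.ofFormula (BA.bound t)).Realize _ _ → ¬ _)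
    simp only [realize_bound]
    push Not
    simp

/-- `t` takes as its value the length of a string, and a string exists whose length is at least
exponential in that value. -/
def LogTerm {β : Type} (t : LBA.Term β) : Prop :=
  ∀ {n : ℕ} (ρ : β → ALV n), (∀ b, (ρ b).TreeFree) →
    ∃ L Z : ALV n, L.TreeFree ∧ Z.TreeFree ∧ ∀ (M : Mdl) (v : Fin n → M),
      ln (ev L v) = ((QALV.ofTerm t).realize fun b => ev (ρ b) v) ∧
        pd (ev L v) (s1 0) ≤ ln (ev Z v)

section LogTerm

variable {β : Type}

theorem logTerm_zero : LogTerm (BA.zero : LBA.Term β) := by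
  intro n ρ hρ
  refine ⟨ALV.zeroC n, ALV.oneC n, ALV.treeFree_zeroC n, ALV.treeFree_oneC n, fun M v => ?_⟩
  rw [ev_zeroC, ev_oneC, ln_zero, pd_zero, ln_one]
  refine ⟨?_, le_rfl⟩
  change _ = (QALV.app ALV.zero _).realize _
  rw [realize_app, ev_zero]

theorem logTerm_one : LogTerm (BA.one : LBA.Term β) := by
  intro n ρ hρ
  refine ⟨ALV.oneC n, ALV.comp ALV.s1 ![ALV.oneC n], ALV.treeFree_oneC n,
    ALV.treeFree_comp1 trivial (ALV.treeFree_oneC n), fun M v => ?_⟩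
  rw [ev_comp1, ev_oneC, ev_s1]
  refine ⟨?_, ?_⟩
  · change _ = (QALV.app (ALV.oneC 0) _).realize _
    rw [realize_app, ev_oneC, ln_one]
  · rw [ln_s1, ln_one, sc_s1, sc_zero]
    refine le_of_eq ?_
    conv_lhs => rw [← sB_true, pd_sB (s1_ne_zero' 0), pd_zero]
    rw [sB_true]

theorem logTerm_len_len_var (b : β) : LogTerm (BA.len (BA.len (Term.var b))) := by
  intro n ρ hρ
  refine ⟨ALV.comp ALV.len ![ρ b], ALV.comp ALV.padRec ![ρ b, ALV.comp ALV.padRec ![ρ b, ALV.oneC n]],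
    ALV.treeFree_comp1 trivial (hρ b), ALV.treeFree_comp2 ALV.treeFree_padRec (hρ b)
      (ALV.treeFree_comp2 ALV.treeFree_padRec (hρ b) (ALV.treeFree_oneC n)), fun M v => ⟨?_, ?_⟩⟩
  · change _ = (QALV.app ALV.len fun i => QALV.ofTerm (![BA.len (Term.var b)] i)).realize _
    rw [realize_app, ev_comp1, ev_len, ln]
    congr 1
    funext i
    rw [Subsingleton.elim i 0]
    change _ = (QALV.app ALV.len fun i => QALV.ofTerm (![Term.var b] i)).realize _
    rw [realize_app, Matrix.cons_val_zero, ln]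
    congr 1
    funext i
    rw [Subsingleton.elim i 0]
    rfl
  · rw [ev_comp1, ev_comp2, ev_comp2, ev_oneC, ev_len, ev_padRec, ev_padRec]
    set x := ev (ρ b) v
    rw [ln_pd _ _ (pd_ne_zero x (s1_ne_zero 0)), ln_pd _ _ (s1_ne_zero 0), ln_one, ← sc_zero,
      add_comm' (sc 0), add_sc, add_zero', add_comm', add_sc, add_self, sc_s0]
    by_cases hx : x = 0
    · rw [hx, ln_zero, pd_zero, sc_zero]
    · rw [sc_zero]
      refine (pd_one_le fun h => hx (ln_eq_zero.1 h)).trans ?_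
      rw [← sc_s0]
      exact (lt_sc_self _).le

theorem logTerm_add {s t : LBA.Term β} (hs : LogTerm s) (ht : LogTerm t) :
    LogTerm (BA.add s t) := by
  intro n ρ hρ
  obtain ⟨L, Z, hL, hZ, h⟩ := hs ρ hρ
  obtain ⟨L', Z', hL', hZ', h'⟩ := ht ρ hρ
  refine ⟨ALV.comp ALV.cat ![L', L],
    ALV.comp ALV.smash ![ALV.comp ALV.trunc ![Z, ALV.comp ALV.padRec ![L, ALV.oneC n]],
      ALV.comp ALV.trunc ![Z', ALV.comp ALV.padRec ![L', ALV.oneC n]]],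
    ALV.treeFree_comp2 ALV.treeFree_cat hL' hL,
    ALV.treeFree_comp2 trivial
      (ALV.treeFree_comp2 ALV.treeFree_trunc hZ
        (ALV.treeFree_comp2 ALV.treeFree_padRec hL (ALV.treeFree_oneC n)))
      (ALV.treeFree_comp2 ALV.treeFree_trunc hZ'
        (ALV.treeFree_comp2 ALV.treeFree_padRec hL' (ALV.treeFree_oneC n))), fun M v => ⟨?_, ?_⟩⟩
  · rw [ev_comp2, ev_cat, ln_cat, (h M v).1, (h' M v).1]
    change _ = (QALV.app ALV.add fun i => QALV.ofTerm (![s, t] i)).realize _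
    rw [realize_app, add_def]
    congr 1
    funext i
    fin_cases i <;> rfl
  · simp only [ev_comp2, ev_oneC, ev_cat, ev_smash, ev_trunc, ev_padRec]
    rw [ln_smash (ln_trunc (h' M v).2), ln_trunc (h M v).2, pd_cat]
    exact (lt_sc_self _).le

theorem logTerm_numeral (d : ℕ) : LogTerm (BA.numeral d : LBA.Term β) := by
  induction d with
  | zero => exact logTerm_zero
  | succ d ih => exact logTerm_add ih logTerm_one

theorem logTerm_smul {t : LBA.Term β} (ht : LogTerm t) (c : ℕ) : LogTerm (BA.smul t c) := by
  induction c with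
  | zero => exact logTerm_zero
  | succ c ih => exact logTerm_add ih ht

theorem logTerm_linearForm {n : ℕ} (c : Fin n → ℕ) (t : Fin n → β) (d : ℕ) :
    LogTerm (BA.linearForm c (fun i => Term.var (t i)) d) := by
  induction n with
  | zero => exact logTerm_numeral d
  | succ n ih =>
    exact logTerm_add (logTerm_smul (logTerm_len_len_var _) _)
      (ih (fun i => c i.succ) fun i => t i.succ)

end LogTerm

end Mdl

namespace ALV

/-- `2^{4|a|}` -/
def hexp {n : ℕ} (a : ALV n) : ALV n :=
  comp padRec ![a, comp padRec ![a, comp padRec ![a, comp padRec ![a, oneC n]]]]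

/-- `(t, m, v) ↦` the string that consists of a leading `1` and of the truth values of
`e(m, v), e(m + 1, v), …, e(m + |t| - 1, v)`. -/
def row {n : ℕ} (e : ALV (n + 1)) : ALV (n + 2) :=
  crn (oneC (n + 1))
    (substHead e (fun i => i.succ.succ) (comp add ![comp len ![proj (n + 2) 0], proj (n + 2) 1]))
    (substHead e (fun i => i.succ.succ) (comp add ![comp len ![proj (n + 2) 0], proj (n + 2) 1]))

/-- `e(2c, v) ∧ e(2c + 1, v)` as a function of `c, v` -/
def pairAnd {n : ℕ} (e : ALV (n + 1)) : ALV (n + 1) :=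
  conj (substHead e Fin.succ (comp s0 ![proj (n + 1) 0]))
    (substHead e Fin.succ (comp s1 ![proj (n + 1) 0]))

/-- `e(2c, v) ∨ e(2c + 1, v)` as a function of `c, v` -/
def pairOr {n : ℕ} (e : ALV (n + 1)) : ALV (n + 1) :=
  disj (substHead e Fin.succ (comp s0 ![proj (n + 1) 0]))
    (substHead e Fin.succ (comp s1 ![proj (n + 1) 0]))

/-- Four rounds of the game in which the two players extend `c` by digits, `∨` for the odd rounds
and `∧` for the even ones. -/
def game {n : ℕ} (e : ALV (n + 1)) : ALV (n + 1) := pairOr (pairAnd (pairOr (pairAnd e)))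

theorem treeFree_hexp {n : ℕ} {a : ALV n} (ha : a.TreeFree) : (hexp a).TreeFree :=
  treeFree_comp2 treeFree_padRec ha (treeFree_comp2 treeFree_padRec ha
    (treeFree_comp2 treeFree_padRec ha (treeFree_comp2 treeFree_padRec ha (treeFree_oneC n))))

theorem treeFree_row {n : ℕ} {e : ALV (n + 1)} (he : e.TreeFree) : (row e).TreeFree := by
  have h := treeFree_substHead (fun i : Fin n => i.succ.succ) he
    (treeFree_comp2 treeFree_add (treeFree_comp1 (f := len) trivial (treeFree_proj 0))
      (treeFree_proj (n := n + 2) 1))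
  exact treeFree_crn (treeFree_oneC _) h h

end ALV

namespace Mdl

variable {M : Mdl}

/-! ### Powers of two -/

theorem lt_of_ltl {u v : M} (h : ltl u v) : u < v := by
  refine ind2 (P := fun u v => ltl u v → u < v) (fun h => absurd h (not_ltl_zero 0))
    (fun u v a b _ ih h => ?_) u v h
  have hv := ne_zero_of_ltl h
  by_cases hu : sB a u = 0
  · rw [hu]
    exact pos_iff.2 hv
  · exact sB_mono (ih ((sB_ltl_sB hu v).1 h))

theorem ln_mono {u v : M} (h : u ≤ v) : ln u ≤ ln v := by
  by_contra hlt
  rw [not_le, ← ltl_iff] at hlt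
  exact not_lt.2 h (lt_of_ltl hlt)

/-- `H` is a power of two. -/
def IsPow (H : M) : Prop := H = pd (half H) (s1 0)

instance QD.isPow (f : M → M) [TD f] : QD fun x => IsPow (f x) :=
  QD.eq f fun x => Mdl.pd (Mdl.half (f x)) (Mdl.s1 0)
instance QD.eta_isPow : QD (IsPow : M → Prop) := QD.isPow fun x => x

theorem isPow_one : IsPow (s1 0 : M) := by rw [IsPow, half_s1, pd_zero]

theorem IsPow.ne_zero {H : M} (h : IsPow H) : H ≠ 0 := by
  rw [h]
  exact pd_ne_zero _ (s1_ne_zero 0)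

theorem IsPow.s0_eq {H : M} (h : IsPow H) : s0 H = pd H (s1 0) := by
  conv_rhs => rw [← sB_od_half H, pd_sB (by rw [sB_od_half]; exact h.ne_zero), ← h]

theorem IsPow.pd {H : M} (h : IsPow H) (w : M) : IsPow (pd w H) := by
  refine ind (P := fun w => IsPow (Mdl.pd w H)) (by rwa [pd_zero]) (fun w b hw ih => ?_) w
  rw [pd_sB hw, IsPow, half_s0]
  exact IsPow.s0_eq ih

theorem IsPow.ln_eq {H c : M} (h : IsPow H) (h1 : H ≤ c) (h2 : c < s0 H) : ln c = ln H := by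
  rw [h.s0_eq, lt_pd_iff] at h2
  exact le_antisymm h2 (ln_mono h1)

theorem pd_s0 (w x : M) : pd w (s0 x) = s0 (pd w x) := by
  refine ind (P := fun w => pd w (s0 x) = s0 (pd w x)) (by simp) (fun w b hw ih => ?_) w
  rw [pd_sB hw, pd_sB hw, ih]

/-- `2^{4|w|}` -/
def hexp (w : M) : M := pd w (pd w (pd w (pd w (s1 0))))

instance TD.hexp (f : M → M) [TD f] : TD fun x => hexp (f x) :=
  (inferInstance : TD fun x =>
    Mdl.pd (f x) (Mdl.pd (f x) (Mdl.pd (f x) (Mdl.pd (f x) (Mdl.s1 0)))))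
instance TD.eta_hexp : TD (Mdl.hexp : M → M) := TD.hexp fun x => x

@[simp] theorem ev_hexp {n : ℕ} (a : ALV n) (v : Fin n → M) :
    ev (ALV.hexp a) v = hexp (ev a v) := by
  simp only [ALV.hexp, ev_comp2, ev_oneC, ev_padRec, hexp]

theorem hexp_zero : hexp (0 : M) = s1 0 := by simp [hexp]

theorem hexp_sB {b : Prop} {w : M} (hw : sB b w ≠ 0) :
    hexp (sB b w) = s0 (s0 (s0 (s0 (hexp w)))) := by
  simp only [hexp, pd_sB hw, pd_s0]

theorem isPow_hexp (w : M) : IsPow (hexp w) := (((isPow_one.pd w).pd w).pd w).pd w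

theorem ln_hexp (w : M) : ln (hexp w) = s1 (s0 (ln w)) := by
  refine ind (P := fun w => ln (hexp w) = s1 (s0 (ln w))) ?_ (fun w b hw ih => ?_) w
  · rw [hexp_zero, ln_one, ln_zero, s0_zero]
  · have h := (isPow_hexp w).ne_zero
    have h1 : s0 (hexp w) ≠ 0 := by rwa [Ne, s0_eq_zero]
    have h2 : s0 (s0 (hexp w)) ≠ 0 := by rwa [Ne, s0_eq_zero]
    have h3 : s0 (s0 (s0 (hexp w))) ≠ 0 := by rwa [Ne, s0_eq_zero]
    rw [hexp_sB hw, ln_s0 h3, ln_s0 h2, ln_s0 h1, ln_s0 h, ih, ln_sB hw, sc_s1, sc_s0, sc_s0, sc_s1,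
      sc_s1, sc_s0]

theorem hexp_mono {w y : M} (h : lel w y) : hexp w ≤ hexp y := by
  have key : ∀ {a b : M}, a ≤ b → pd w a ≤ pd y b := fun hab =>
    (pd_le_pd_right w hab).trans (pd_le_pd_left h _)
  exact key (key (key (key le_rfl)))

/-! ### Evaluation of the tree, level by level -/

theorem tv_substHead {n k : ℕ} (f : ALV (n + 1)) (r : Fin n → Fin k) (q : ALV k) (w : Fin k → M) :
    tv (ALV.substHead f r q) w ↔ tv f (Matrix.vecCons (ev q w) fun i => w (r i)) := by
  rw [tv, ALV.substHead, ev_comp, tv]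
  refine Eq.to_iff (congrArg (· ≠ 0) (congrArg _ (funext fun i => ?_)))
  refine Fin.cases ?_ (fun i => ?_) i <;> simp

section row

variable {n : ℕ}

/-- The string with the digits `e(m, v), …, e(m + |t| - 1, v)` after a leading `1`. -/
def row (e : ALV (n + 1)) (v : Fin n → M) (t m : M) : M :=
  ev (ALV.row e) (Matrix.vecCons t (Matrix.vecCons m v))

instance TD.row (e : ALV (n + 1)) (v : Fin n → M) (f g : M → M) [TD f] [TD g] :
    TD fun x => row e v (f x) (g x) :=
  TD.ev (ALV.row e) fun x => Matrix.vecCons (f x) (Matrix.vecCons (g x) v)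
instance TD.eta_row (e : ALV (n + 1)) (v : Fin n → M) (a : M) : TD (Mdl.row e v a) :=
  TD.row e v (fun _ => a) fun x => x

theorem row_zero (e : ALV (n + 1)) (v : Fin n → M) (m : M) : row e v 0 m = s1 0 :=
  (ev_crn_zero _ _ _ _).trans (ev_oneC _)

theorem row_sB (e : ALV (n + 1)) (v : Fin n → M) {b : Prop} {t : M} (ht : sB b t ≠ 0) (m : M) :
    row e v (sB b t) m = sB (tv e (Matrix.vecCons (ln t + m) v)) (row e v t m) := by
  refine (ev_crn_sB _ _ ht _).trans ?_
  rw [← tv, tv_substHead, ev_comp2, ev_comp1]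
  simp only [ev_proj, Matrix.cons_val_zero, Matrix.cons_val_one, Matrix.cons_val_succ, ev_len,
    ev_add]
  rfl

theorem row_s1 (e : ALV (n + 1)) (v : Fin n → M) (t m : M) :
    row e v (s1 t) m = sB (tv e (Matrix.vecCons (ln t + m) v)) (row e v t m) := by
  rw [← sB_true, row_sB e v (s1_ne_zero' t)]

theorem row_ne_zero (e : ALV (n + 1)) (v : Fin n → M) (t m : M) : row e v t m ≠ 0 := by
  refine ind (P := fun t => row e v t m ≠ 0) ?_ (fun t b ht ih => ?_) t
  · rw [row_zero]
    exact s1_ne_zero 0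
  · rw [row_sB e v ht]
    exact sB_ne_zero_of_ne ih _

theorem row_congr_eql (e : ALV (n + 1)) (v : Fin n → M) {t t' : M} (h : eql t t') (m : M) :
    row e v t m = row e v t' m := by
  refine ind2 (P := fun t t' => lel t t' → lel t' t → row e v t m = row e v t' m)
    (fun _ _ => rfl) (fun t t' a b _ ih h1 h2 => ?_) t t' h.1 h.2
  by_cases ht : sB a t = 0
  · rw [ht, lel_zero] at h2
    rw [ht, h2]
  by_cases ht' : sB b t' = 0
  · rw [ht', lel_zero] at h1
    rw [ht', h1]
  rw [sB_lel_sB ht'] at h1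
  rw [sB_lel_sB ht] at h2
  rw [row_sB e v ht, row_sB e v ht', ih h1 h2, ln_eq_of_eql ⟨h1, h2⟩]

theorem row_congr {e e' : ALV (n + 1)} {v : Fin n → M} {t m : M}
    (h : ∀ u, ltl u t → (tv e (Matrix.vecCons (ln u + m) v) ↔ tv e' (Matrix.vecCons (ln u + m) v))) :
    row e v t m = row e' v t m := by
  have key : ∀ s, lel s t → row e v s m = row e' v s m := by
    refine ind (fun _ => by rw [row_zero, row_zero]) fun s b hs ih hl => ?_
    rw [sB_lel_iff_ltl hs] at hl
    rw [row_sB e v hs, row_sB e' v hs, ih (lel_of_ltl hl), propext (h s hl)]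
  exact key t (lel_refl t)

/-- A string of twice the length of `t`. -/
def dbl (t : M) : M := pd t t

instance TD.dbl (f : M → M) [TD f] : TD fun x => dbl (f x) := TD.pd f f
instance TD.eta_dbl : TD (Mdl.dbl : M → M) := TD.dbl fun x => x

theorem ln_dbl (t : M) : ln (dbl t) = s0 (ln t) := by
  by_cases ht : t = 0
  · rw [ht, dbl, pd_zero, ln_zero, s0_zero]
  · rw [dbl, ln_pd _ _ ht, add_self]

theorem dbl_ne_zero {t : M} (ht : t ≠ 0) : dbl t ≠ 0 := pd_ne_zero t ht

theorem dbl_sB {b : Prop} {t : M} (ht : sB b t ≠ 0) : eql (dbl (sB b t)) (s1 (s1 (dbl t))) := by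
  rw [eql_iff, ln_dbl, ln_sB ht, ln_s1, ln_s1, ln_dbl, sc_s0, sc_s1]

theorem row_dbl_sB (e : ALV (n + 1)) (v : Fin n → M) {b : Prop} {t : M} (ht : sB b t ≠ 0) (m : M) :
    row e v (dbl (sB b t)) (s0 m) =
      sB (tv e (Matrix.vecCons (s1 (ln t + m)) v))
        (sB (tv e (Matrix.vecCons (s0 (ln t + m)) v)) (row e v (dbl t) (s0 m))) := by
  rw [row_congr_eql e v (dbl_sB ht), row_s1, row_s1, ln_s1, ln_dbl, add_comm' (sc _), add_sc,
    add_comm' (s0 m), ← s0_add, sc_s0]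

@[simp] theorem tv_pairAnd (e : ALV (n + 1)) (v : Fin n → M) (c : M) :
    tv (ALV.pairAnd e) (Matrix.vecCons c v) ↔
      tv e (Matrix.vecCons (s0 c) v) ∧ tv e (Matrix.vecCons (s1 c) v) := by
  simp [ALV.pairAnd, tv_substHead]

@[simp] theorem tv_pairOr (e : ALV (n + 1)) (v : Fin n → M) (c : M) :
    tv (ALV.pairOr e) (Matrix.vecCons c v) ↔
      tv e (Matrix.vecCons (s0 c) v) ∨ tv e (Matrix.vecCons (s1 c) v) := by
  simp [ALV.pairOr, tv_substHead]

theorem andF_row (e : ALV (n + 1)) (v : Fin n → M) (t m : M) :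
    andF (row e v (dbl t) (s0 m)) = row (ALV.pairAnd e) v t m := by
  refine ind (P := fun t => andF (row e v (dbl t) (s0 m)) = row (ALV.pairAnd e) v t m) ?_
    (fun t b ht ih => ?_) t
  · rw [dbl, pd_zero, row_zero, row_zero, andF_one]
  · rw [row_dbl_sB e v ht, andF_sB (row_ne_zero _ _ _ _), ih, row_sB _ v ht, tv_pairAnd]

theorem orF_row (e : ALV (n + 1)) (v : Fin n → M) (t m : M) :
    orF (row e v (dbl t) (s0 m)) = row (ALV.pairOr e) v t m := by
  refine ind (P := fun t => orF (row e v (dbl t) (s0 m)) = row (ALV.pairOr e) v t m) ?_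
    (fun t b ht ih => ?_) t
  · rw [dbl, pd_zero, row_zero, row_zero, orF_one]
  · rw [row_dbl_sB e v ht, orF_sB (row_ne_zero _ _ _ _), ih, row_sB _ v ht, tv_pairOr]

/-- The four digits are read off `∨`, `∧`, `∨`, `∧`, from the first to the last. -/
theorem tv_game (e : ALV (n + 1)) (v : Fin n → M) (c : M) :
    tv (ALV.game e) (Matrix.vecCons c v) ↔ ∃ a : Prop, ∀ b : Prop, ∃ a' : Prop, ∀ b' : Prop,
      tv e (Matrix.vecCons (sB b' (sB a' (sB b (sB a c)))) v) := by
  simp only [ALV.game, tv_pairAnd, tv_pairOr, Prop.exists_iff, Prop.forall_iff, sB_true, sB_false]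

/-- A row with at least four digits after the leading `1` is at least `16`. -/
theorem half4_row_ne_zero (e : ALV (n + 1)) (v : Fin n → M) {t : M} (ht : t ≠ 0) (m : M) :
    half (half (half (half (row e v (dbl (dbl t)) m)))) ≠ 0 := by
  obtain ⟨b, t, rfl, ht⟩ := exists_sB_ne_zero ht
  have : eql (dbl (dbl (sB b t))) (s1 (s1 (s1 (s1 (dbl (dbl t)))))) := by
    rw [eql_iff]
    simp only [ln_dbl, ln_s1, ln_sB ht, sc_s0, sc_s1]
  rw [row_congr_eql e v this, row_s1, row_s1, row_s1, row_s1, half_sB, half_sB, half_sB, half_sB]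
  exact row_ne_zero _ _ _ _

theorem tree_row_dbl (e : ALV (n + 1)) (v : Fin n → M) {t : M} (ht : t ≠ 0) (m : M) :
    tree (row e v (dbl (dbl t)) (s0 (s0 m))) =
      tree (row (ALV.pairOr (ALV.pairAnd e)) v t m) := by
  rw [tree_large (half4_row_ne_zero e v ht _), andF_row, orF_row]

/-- Two steps of the evaluation of the tree remove four digits of the positions. -/
theorem tree_row (e : ALV (n + 1)) (v : Fin n → M) {T t : M} (ht : t ≠ 0)
    (hT : ln T = s0 (s0 (s0 (s0 (ln t))))) (m : M) :
    tree (row e v T (s0 (s0 (s0 (s0 m))))) = tree (row (ALV.game e) v t m) := by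
  have : eql T (dbl (dbl (dbl (dbl t)))) := by rw [eql_iff, hT, ln_dbl, ln_dbl, ln_dbl, ln_dbl]
  rw [row_congr_eql e v this, tree_row_dbl _ _ (dbl_ne_zero (dbl_ne_zero ht)), tree_row_dbl _ _ ht,
    ALV.game]

/-- The tree of depth zero. -/
theorem tree_row_one (e : ALV (n + 1)) (v : Fin n → M) {t : M} (ht : ln t = s1 0) (m : M) :
    tree (row e v t m) = sB (tv e (Matrix.vecCons m v)) 0 := by
  have : eql t (s1 0) := by rw [eql_iff, ht, ln_one]
  rw [row_congr_eql e v this, row_s1, row_zero, ln_zero, add_comm', add_zero', tree_small]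
  · by_cases h : tv e (Matrix.vecCons m v)
    · rw [sB_pos h, sB_pos h, bt_zero_s1]
    · rw [sB_neg h, sB_neg h, bt_zero_s0, s0_zero]
  · rw [half_sB, half_s1, half_zero, half_zero]

end row

end Mdl

/-! ### The game tree -/

namespace ALV

/-- `(u, c, p) ↦ p` followed by `|u|` digits, the digit for the prefix `y` of `u` being the one of
`c` with which the prefix of `c` of length `4|y| + 3` ends. -/
def walk : ALV 3 :=
  crn (proj 2 1)
    (comp bit ![zeroC 3, comp trunc ![proj 3 1, comp s1 ![comp s1 ![comp len ![proj 3 0]]]]])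
    (comp bit ![zeroC 3, comp trunc ![proj 3 1, comp s1 ![comp s1 ![comp len ![proj 3 0]]]]])

/-- `(c, p) ↦` the node that is reached from the node `p` at the position `c` of the game. A
position is a string with a leading digit `1`, followed by a block of four digits for each step;
the second digit of each block is the digit to be appended to the node. -/
def node : ALV 2 :=
  comp walk ![comp trunc ![proj 2 0, comp half ![comp half ![comp len ![proj 2 0]]]],
    proj 2 0, proj 2 1]

/-- `⌊c / 2^k⌋` for the first argument `c`. -/
def halves (n : ℕ) : ℕ → ALV (n + 1)
  | 0 => proj (n + 1) 0
  | k + 1 => comp half ![halves n k]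

/-- The last digit of `⌊c / 2^k⌋` for the first argument `c`. -/
def digit (n k : ℕ) : ALV (n + 1) := comp bit ![zeroC _, halves n k]

/-- The truth value that is claimed for the node at the position `c`: the value `1` at the root, and
otherwise the first or the third digit of the last block, according as the second digit is `0` or
`1`. -/
def claim (n : ℕ) : ALV (n + 1) :=
  disj (neg (halves n 4))
    (disj (conj (digit n 2) (digit n 1)) (conj (neg (digit n 2)) (digit n 3)))

/-- The length of the first argument is `1` modulo `4`. -/
def block (n : ℕ) : ALV (n + 1) :=
  conj (comp bit ![zeroC _, comp len ![proj (n + 1) 0]])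
    (neg (comp bit ![zeroC _, comp half ![comp len ![proj (n + 1) 0]]]))

variable {n : ℕ}

/-- The last block of the position `c` is consistent: the values claimed in it for the two children
of the node at the previous position are in accordance with the value claimed for that node. The
arguments are `c, p, x`, and `C` is the recursive clause, with the arguments `e₀, e₁, q, x`. -/
def check (C : ALV (n + 3)) : ALV (n + 2) :=
  disj (neg (halves _ 4)) (disj (neg (block _)) (neg (exor
    (comp C (Matrix.vecCons (digit _ 3) (Matrix.vecCons (digit _ 1)
      (Matrix.vecCons (comp node ![halves _ 4, proj (n + 2) 1])
        fun i => proj (n + 2) i.succ.succ))))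
    (substHead (claim (n + 1)) Fin.succ (halves _ 4)))))

/-- All the blocks of the position `c` are consistent. -/
def checkAll (C : ALV (n + 3)) : ALV (n + 2) :=
  neg (comp
    (exPrefix (n := n + 2)
      (neg (substHead (check C) (fun i => i.succ.succ) (comp shr ![proj (n + 3) 1, proj (n + 3) 0]))))
    (Matrix.vecCons (proj (n + 2) 0) fun i => proj (n + 2) i))

/-- The position `c` is consistent, and the value claimed for its node is the one that `F` gives. -/
def verify (C : ALV (n + 3)) (F : ALV (n + 1)) : ALV (n + 2) :=
  conj (checkAll C)
    (neg (exor (substHead F (fun i => i.succ.succ) (comp node ![proj (n + 2) 0, proj (n + 2) 1]))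
      (claim (n + 1))))

theorem treeFree_walk : walk.TreeFree := by
  have h : (comp bit ![zeroC 3, comp trunc
      ![proj 3 1, comp s1 ![comp s1 ![comp len ![proj 3 0]]]]]).TreeFree :=
    treeFree_comp2 trivial (treeFree_zeroC 3) (treeFree_comp2 treeFree_trunc trivial
      (treeFree_comp1 trivial (treeFree_comp1 trivial (treeFree_comp1 trivial trivial))))
  exact treeFree_crn trivial h h

theorem treeFree_node : node.TreeFree :=
  treeFree_comp treeFree_walk (treeFree_cons (treeFree_comp2 treeFree_trunc trivial
    (treeFree_comp1 treeFree_half (treeFree_comp1 treeFree_half (treeFree_comp1 trivial trivial))))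
    (treeFree_cons trivial (treeFree_cons trivial fun i => i.elim0)))

theorem treeFree_halves (n : ℕ) : ∀ k, (halves n k).TreeFree
  | 0 => trivial
  | k + 1 => treeFree_comp1 treeFree_half (treeFree_halves n k)

theorem treeFree_digit (n k : ℕ) : (digit n k).TreeFree :=
  treeFree_comp2 trivial (treeFree_zeroC _) (treeFree_halves n k)

theorem treeFree_claim (n : ℕ) : (claim n).TreeFree :=
  treeFree_disj (treeFree_neg (treeFree_halves n 4))
    (treeFree_disj (treeFree_conj (treeFree_digit n 2) (treeFree_digit n 1))
      (treeFree_conj (treeFree_neg (treeFree_digit n 2)) (treeFree_digit n 3)))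

theorem treeFree_block (n : ℕ) : (block n).TreeFree :=
  treeFree_conj (treeFree_comp2 trivial (treeFree_zeroC _)
      (treeFree_comp1 (f := len) trivial (treeFree_proj 0)))
    (treeFree_neg (treeFree_comp2 trivial (treeFree_zeroC _)
      (treeFree_comp1 treeFree_half (treeFree_comp1 (f := len) trivial (treeFree_proj 0)))))

theorem treeFree_check {C : ALV (n + 3)} (hC : C.TreeFree) : (check C).TreeFree :=
  treeFree_disj (treeFree_neg (treeFree_halves _ 4)) (treeFree_disj (treeFree_neg (treeFree_block _))
    (treeFree_neg (treeFree_exor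
      (treeFree_comp hC (treeFree_cons (treeFree_digit _ 3) (treeFree_cons (treeFree_digit _ 1)
        (treeFree_cons (treeFree_comp2 treeFree_node (treeFree_halves _ 4) (treeFree_proj _))
          fun _ => trivial))))
      (treeFree_substHead _ (treeFree_claim _) (treeFree_halves _ 4)))))

theorem treeFree_checkAll {C : ALV (n + 3)} (hC : C.TreeFree) : (checkAll C).TreeFree :=
  treeFree_neg (treeFree_comp (treeFree_exPrefix (treeFree_neg (treeFree_substHead _
      (treeFree_check hC) (treeFree_comp2 treeFree_shr (treeFree_proj _) (treeFree_proj _)))))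
    (treeFree_cons (treeFree_proj _) fun _ => trivial))

theorem treeFree_verify {C : ALV (n + 3)} {F : ALV (n + 1)} (hC : C.TreeFree) (hF : F.TreeFree) :
    (verify C F).TreeFree :=
  treeFree_conj (treeFree_checkAll hC) (treeFree_neg (treeFree_exor
    (treeFree_substHead _ hF (treeFree_comp2 treeFree_node (treeFree_proj _) (treeFree_proj _)))
    (treeFree_claim _)))

end ALV

namespace Mdl

variable {M : Mdl}

/-- The node `p` followed by digits of the position `c`, one for each digit of `u`. -/
def walk (u c p : M) : M := ev ALV.walk ![u, c, p]

instance TD.walk (f g h : M → M) [TD f] [TD g] [TD h] : TD fun x => walk (f x) (g x) (h x) :=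
  TD.ev ALV.walk fun x => ![f x, g x, h x]
instance TD.eta_walk (a b : M) : TD (Mdl.walk a b) := TD.walk (fun _ => a) (fun _ => b) fun x => x

theorem walk_zero (c p : M) : walk 0 c p = p := (ev_crn_zero _ _ _ ![c, p]).trans (ev_proj _ _)

theorem walk_sB {b : Prop} {u : M} (hu : sB b u ≠ 0) (c p : M) :
    walk (sB b u) c p = sB (od (trunc c (s1 (s1 (ln u))))) (walk u c p) := by
  refine (ev_crn_sB _ _ hu ![c, p]).trans ?_
  simp only [ev_comp2, ev_comp1, ev_zeroC, ev_proj, ev_bit, ev_trunc, ev_s1, ev_len]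
  rfl

theorem ln_walk (u c : M) {p : M} (hp : p ≠ 0) : walk u c p ≠ 0 ∧ ln (walk u c p) = ln p + ln u := by
  refine ind (P := fun u => walk u c p ≠ 0 ∧ ln (walk u c p) = ln p + ln u) ?_
    (fun u b hu ih => ?_) u
  · rw [walk_zero, ln_zero, add_zero']
    exact ⟨hp, rfl⟩
  · have := sB_ne_zero_of_ne ih.1 (od (trunc c (s1 (s1 (ln u)))))
    rw [walk_sB hu, ln_sB this, ih.2, ln_sB hu, add_sc]
    exact ⟨this, rfl⟩

theorem walk_congr_eql {u u' : M} (h : eql u u') (c p : M) : walk u c p = walk u' c p := by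
  refine ind2 (P := fun u u' => lel u u' → lel u' u → walk u c p = walk u' c p)
    (fun _ _ => rfl) (fun t t' a b _ ih h1 h2 => ?_) u u' h.1 h.2
  by_cases ht : sB a t = 0
  · rw [ht, lel_zero] at h2
    rw [ht, h2]
  by_cases ht' : sB b t' = 0
  · rw [ht', lel_zero] at h1
    rw [ht', h1]
  rw [sB_lel_sB ht'] at h1
  rw [sB_lel_sB ht] at h2
  rw [walk_sB ht, walk_sB ht', ih h1 h2, ln_eq_of_eql ⟨h1, h2⟩]

theorem walk_congr {u c c' : M} (p : M)
    (h : ∀ w, ltl w u → trunc c (s1 (s1 (ln w))) = trunc c' (s1 (s1 (ln w)))) :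
    walk u c p = walk u c' p := by
  have key : ∀ s, lel s u → walk s c p = walk s c' p := by
    refine ind (fun _ => by rw [walk_zero, walk_zero]) fun s b hs ih hl => ?_
    rw [sB_lel_iff_ltl hs] at hl
    rw [walk_sB hs, walk_sB hs, ih (lel_of_ltl hl), h s hl]
  exact key u (lel_refl u)

/-- The node that is reached from `p` at the position `c`. -/
def node (c p : M) : M := walk (trunc c (half (half (ln c)))) c p

@[simp] theorem ev_node (c p : M) : ev ALV.node ![c, p] = node c p := by
  simp only [ALV.node, ev_comp3, ev_comp2, ev_comp1, ev_proj]
  rfl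

/-- The position `c` is made of a leading `1` and of `k` blocks of four digits. -/
def Blocks (c k : M) : Prop := ln c = s1 (s0 k)

theorem Blocks.ne_zero {c k : M} (h : Blocks c k) : c ≠ 0 := fun h0 => by
  rw [Blocks, h0, ln_zero] at h
  exact s1_ne_zero _ h.symm

theorem le_s1_s0 (k : M) : k ≤ s1 (s0 k) := by
  rw [← sc_s0]
  exact ((le_s0 k).trans (le_s0 _)).trans (lt_sc_self _).le

theorem blocks_one : Blocks (s1 0 : M) 0 := by rw [Blocks, s0_zero, ln_one]

theorem node_one (p : M) : node (s1 0) p = p := by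
  have h : trunc (s1 0 : M) 0 = 0 := ln_eq_zero.1 (ln_trunc (zero_le' _))
  rw [node, ln_one, half_s1, half_zero, h, walk_zero]

theorem ln_node {c k p : M} (hc : Blocks c k) (hp : p ≠ 0) :
    node c p ≠ 0 ∧ ln (node c p) = ln p + k := by
  have h := ln_walk (trunc c (half (half (ln c)))) c hp
  rw [← node, hc, half_s1, half_s0, ln_trunc (by rw [hc]; exact le_s1_s0 k)] at h
  exact h

theorem ln_sB_sB {c k : M} (hc : Blocks c k) (a b : Prop) :
    ln (sB b (sB a c)) = s1 (s1 k) := by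
  have h0 := sB_ne_zero_of_ne hc.ne_zero a
  rw [ln_sB (sB_ne_zero_of_ne h0 b), ln_sB h0, hc, sc_s1, sc_s0, sc_s0]

theorem Blocks.sB {c k : M} (hc : Blocks c k) (a b a' b' : Prop) :
    Blocks (sB b' (sB a' (sB b (sB a c)))) (sc k) := by
  have h1 := sB_ne_zero_of_ne (sB_ne_zero_of_ne hc.ne_zero a) b
  have h2 := sB_ne_zero_of_ne h1 a'
  rw [Blocks, ln_sB (sB_ne_zero_of_ne h2 b'), ln_sB h2, ln_sB_sB hc, sc_s1, sc_s1, sc_s0]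

theorem node_sB {c k : M} (hc : Blocks c k) (a b a' b' : Prop) (p : M) :
    node (sB b' (sB a' (sB b (sB a c)))) p = sB b (node c p) := by
  set c' := sB b' (sB a' (sB b (sB a c))) with hc'
  have h1 := sB_ne_zero_of_ne hc.ne_zero a
  have h2 := sB_ne_zero_of_ne h1 b
  have h3 := sB_ne_zero_of_ne h2 a'
  have h4 := sB_ne_zero_of_ne h3 b'
  have hB : Blocks c' (sc k) := hc.sB a b a' b'
  have htr : ∀ m, m ≤ s1 (s1 k) → trunc c' m = trunc (sB b (sB a c)) m := fun m hm => by
    rw [hc', trunc_sB h4, trunc_sB h3]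
    · rwa [ln_sB_sB hc]
    · rw [ln_sB h3, ln_sB_sB hc]
      exact hm.trans (lt_sc_self _).le
  have hk : k ≤ ln c := by rw [hc]; exact le_s1_s0 k
  have hlen : eql (trunc c' (sc k)) (s1 (trunc c k)) := by
    rw [eql_iff, ln_s1, ln_trunc hk, ln_trunc]
    rw [hB]
    exact le_s1_s0 _
  rw [node, hB, half_s1, half_s0, walk_congr_eql hlen, ← sB_true, walk_sB (s1_ne_zero' _), ln_trunc hk,
    htr _ le_rfl, trunc_of_le (by rw [ln_sB_sB hc]), node, hc, half_s1, half_s0]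
  have e : walk (trunc c k) c' p = walk (trunc c k) c p := by
    refine walk_congr p fun w hw => ?_
    rw [ltl_iff, ln_trunc hk] at hw
    have e1 : s1 (s1 (ln w)) ≤ ln c := by
      rw [hc, ← sB_true, ← sB_true, ← sB_true, ← sB_false, sB_le_sB]
      exact .inl (sB_mono hw)
    have e2 : s1 (s1 (ln w)) ≤ s1 (s1 k) := by
      rw [← sB_true, ← sB_true, ← sB_true, ← sB_true k]
      exact (sB_mono (sB_mono hw)).le
    rw [htr _ e2, trunc_sB h2, trunc_sB h1 e1]
    rw [ln_sB h1]
    exact e1.trans (lt_sc_self _).le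
  rw [e]
  simp only [od_sB]

/-- The truth value that is claimed for the node at the position `c`. -/
def Claim (c : M) : Prop :=
  half (half (half (half c))) = 0 ∨
    (od (half (half c)) ∧ od (half c) ∨ ¬ od (half (half c)) ∧ od (half (half (half c))))

section

variable {n : ℕ}

theorem ev_halves (k : ℕ) (c : M) (v : Fin n → M) :
    ev (ALV.halves n k) (Matrix.vecCons c v) = half^[k] c := by
  induction k with
  | zero => simp [ALV.halves]
  | succ k ih => rw [ALV.halves, ev_comp1, ev_half, ih, Function.iterate_succ_apply']

theorem tv_digit (k : ℕ) (c : M) (v : Fin n → M) :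
    tv (ALV.digit n k) (Matrix.vecCons c v) ↔ od (half^[k] c) := by
  rw [tv, ALV.digit, ev_comp2, ev_zeroC, ev_halves, ev_bit, od]

theorem tv_claim (c : M) (v : Fin n → M) : tv (ALV.claim n) (Matrix.vecCons c v) ↔ Claim c := by
  rw [ALV.claim, tv_disj, tv_disj, tv_conj, tv_conj, tv_neg, tv_neg, tv_digit, tv_digit, tv_digit,
    tv, ev_halves, not_not]
  rfl

theorem tv_block (c : M) (v : Fin n → M) :
    tv (ALV.block n) (Matrix.vecCons c v) ↔ od (ln c) ∧ ¬ od (half (ln c)) := by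
  rw [ALV.block, tv_conj, tv_neg, tv, tv, ev_comp2, ev_comp2, ev_zeroC, ev_comp1, ev_comp1,
    ev_comp1, ev_proj]
  rfl

/-- The recursive clause `C` at the node `q`, for the truth values `a` and `b` of the children. -/
def Clause (C : ALV (n + 3)) (x : Fin n → M) (a b : Prop) (q : M) : Prop :=
  tv C (Matrix.vecCons (sB a 0) (Matrix.vecCons (sB b 0) (Matrix.vecCons q x)))

/-- Only the truth values of the first two arguments matter to `C`. -/
def _root_.ALV.IsClause (C : ALV (n + 3)) : Prop :=
  ∀ (M : Mdl) (x : Fin n → M) (a b q : M),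
    tv C (Matrix.vecCons a (Matrix.vecCons b (Matrix.vecCons q x))) ↔ Clause C x (a ≠ 0) (b ≠ 0) q

/-- The last block of the position `c` is consistent. -/
def Check (C : ALV (n + 3)) (x : Fin n → M) (p c : M) : Prop :=
  half (half (half (half c))) = 0 ∨ ¬ (od (ln c) ∧ ¬ od (half (ln c))) ∨
    (Clause C x (od (half (half (half c)))) (od (half c)) (node (half (half (half (half c)))) p) ↔
      Claim (half (half (half (half c)))))

end

end Mdl

namespace Mdl

variable {M : Mdl} {n : ℕ} {C : ALV (n + 3)} {x : Fin n → M}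

theorem tv_check (hC : C.IsClause) (p c : M) :
    tv (ALV.check C) (Matrix.vecCons c (Matrix.vecCons p x)) ↔ Check C x p c := by
  have e : tv (ALV.comp C (Matrix.vecCons (ALV.digit (n + 1) 3) (Matrix.vecCons (ALV.digit (n + 1) 1)
      (Matrix.vecCons (ALV.comp ALV.node ![ALV.halves (n + 1) 4, ALV.proj (n + 2) 1])
        fun i => ALV.proj (n + 2) i.succ.succ)))) (Matrix.vecCons c (Matrix.vecCons p x)) ↔
      Clause C x (od (half (half (half c)))) (od (half c))
        (node (half (half (half (half c)))) p) := by
    have h1 := tv_digit (n := n + 1) 3 c (Matrix.vecCons p x)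
    have h2 := tv_digit (n := n + 1) 1 c (Matrix.vecCons p x)
    rw [tv] at h1 h2
    have := hC M x (ev (ALV.digit (n + 1) 3) (Matrix.vecCons c (Matrix.vecCons p x)))
      (ev (ALV.digit (n + 1) 1) (Matrix.vecCons c (Matrix.vecCons p x)))
      (node (half (half (half (half c)))) p)
    rw [propext h1, propext h2] at this
    refine Iff.trans (Eq.to_iff ?_) this
    rw [tv, ev_comp, tv]
    refine congrArg (· ≠ 0) (congrArg _ (funext fun i => ?_))
    refine Fin.cases rfl (fun i => ?_) i
    refine Fin.cases rfl (fun i => ?_) i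
    refine Fin.cases ?_ (fun i => ?_) i
    · simp only [Matrix.cons_val_succ, Matrix.cons_val_zero, ev_comp2, ev_halves, ev_proj,
        Matrix.cons_val_one, ev_node]
      rfl
    · simp
  rw [ALV.check, tv_disj, tv_disj, tv_neg, tv_neg, tv_neg, tv_exor, e, tv_block, tv_substHead,
    ev_halves, tv_claim, tv, ev_halves, not_not, not_not]
  rfl

theorem tv_checkAll (hC : C.IsClause) (p c : M) :
    tv (ALV.checkAll C) (Matrix.vecCons c (Matrix.vecCons p x)) ↔
      ∀ y, ltl y c → Check C x p (shr c y) := by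
  have h : ∀ y : M, tv (ALV.neg (ALV.substHead (ALV.check C) (fun i => i.succ.succ)
      (ALV.comp ALV.shr ![ALV.proj (n + 3) 1, ALV.proj (n + 3) 0])))
      (Matrix.vecCons y (Matrix.vecCons c (Matrix.vecCons p x))) ↔ ¬ Check C x p (shr c y) := by
    intro y
    rw [tv_neg, tv_substHead, ← tv_check hC]
    simp
  rw [ALV.checkAll, tv_neg, tv, ev_comp]
  have e : (fun i => ev ((Matrix.vecCons (ALV.proj (n + 2) 0) fun i => ALV.proj (n + 2) i :
      Fin (n + 3) → ALV (n + 2)) i) (Matrix.vecCons c (Matrix.vecCons p x))) =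
      Matrix.vecCons c (Matrix.vecCons c (Matrix.vecCons p x)) := by
    funext i
    refine Fin.cases ?_ (fun i => ?_) i <;> simp
  rw [e, ← tv, tv_exPrefix fun y y' hy => by rw [h, h, shr_congr hy]]
  simp only [h]
  push Not
  rfl

/-- The consistency of a position, digit by digit. -/
theorem checkAll_sB (hC : C.IsClause) (p : M) {b : Prop} {c : M} (hc : sB b c ≠ 0) :
    tv (ALV.checkAll C) (Matrix.vecCons (sB b c) (Matrix.vecCons p x)) ↔
      Check C x p (sB b c) ∧ tv (ALV.checkAll C) (Matrix.vecCons c (Matrix.vecCons p x)) := by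
  rw [tv_checkAll hC, tv_checkAll hC]
  constructor
  · intro h
    refine ⟨?_, fun y hy => ?_⟩
    · have := h 0 (zero_ltl.2 hc)
      rwa [shr_zero] at this
    · have := h (s1 y) (by rw [← sB_true]; exact (sB_ltl_sB (s1_ne_zero' y) c).2 hy)
      rwa [shr_s1, half_sB] at this
  · rintro ⟨h0, h⟩ y hy
    obtain ⟨a, y, rfl⟩ := exists_sB y
    by_cases hy0 : sB a y = 0
    · rwa [hy0, shr_zero]
    · rw [shr_sB hy0, half_sB]
      exact h y ((sB_ltl_sB hy0 c).1 hy)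

theorem checkAll_one (hC : C.IsClause) (p : M) :
    tv (ALV.checkAll C) (Matrix.vecCons (s1 0) (Matrix.vecCons p x)) := by
  rw [← sB_true, checkAll_sB hC p (s1_ne_zero' 0), tv_checkAll hC]
  refine ⟨.inl ?_, fun y hy => absurd hy (not_ltl_zero y)⟩
  rw [half_sB, half_zero, half_zero, half_zero]

theorem claim_one : Claim (s1 0 : M) := by
  left
  rw [half_s1, half_zero, half_zero, half_zero]

theorem claim_sB {c : M} (hc : c ≠ 0) (a b a' b' : Prop) :
    Claim (sB b' (sB a' (sB b (sB a c)))) ↔ b ∧ a' ∨ ¬ b ∧ a := by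
  rw [Claim]
  simp only [half_sB, od_sB]
  exact or_iff_right hc

/-- Within a block nothing is checked, and at its end the block is. -/
theorem checkAll_block (hC : C.IsClause) (p : M) {c k : M} (hc : Blocks c k) (a b a' b' : Prop) :
    tv (ALV.checkAll C) (Matrix.vecCons (sB b' (sB a' (sB b (sB a c)))) (Matrix.vecCons p x)) ↔
      (Clause C x a a' (node c p) ↔ Claim c) ∧
        tv (ALV.checkAll C) (Matrix.vecCons c (Matrix.vecCons p x)) := by
  have h1 := sB_ne_zero_of_ne hc.ne_zero a
  have h2 := sB_ne_zero_of_ne h1 b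
  have h3 := sB_ne_zero_of_ne h2 a'
  have h4 := sB_ne_zero_of_ne h3 b'
  have l1 : ln (sB a c) = s0 (s1 k) := by rw [ln_sB h1, hc, sc_s1, sc_s0]
  have l2 := ln_sB_sB hc a b
  have l3 : ln (sB a' (sB b (sB a c))) = s0 (sc (s1 k)) := by rw [ln_sB h3, l2, sc_s1]
  have l4 := hc.sB a b a' b'
  rw [checkAll_sB hC p h4, checkAll_sB hC p h3, checkAll_sB hC p h2, checkAll_sB hC p h1]
  have c1 : Check C x p (sB a c) := .inr (.inl (by rw [l1, ← sB_false, od_sB]; exact fun h => h.1))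
  have c2 : Check C x p (sB b (sB a c)) :=
    .inr (.inl (by rw [l2, half_s1, ← sB_true k, od_sB]; exact fun h => h.2 trivial))
  have c3 : Check C x p (sB a' (sB b (sB a c))) :=
    .inr (.inl (by rw [l3, ← sB_false, od_sB]; exact fun h => h.1))
  have c4 : Check C x p (sB b' (sB a' (sB b (sB a c)))) ↔
      (Clause C x a a' (node c p) ↔ Claim c) := by
    rw [Check, l4, half_s1, ← sB_true, od_sB, ← sB_false, od_sB, half_sB, half_sB, half_sB, half_sB,
      od_sB, od_sB]
    simp [hc.ne_zero]
  rw [c4]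
  simp only [c1, c2, c3, true_and]

theorem tv_verify (C : ALV (n + 3)) (F : ALV (n + 1)) (p c : M) :
    tv (ALV.verify C F) (Matrix.vecCons c (Matrix.vecCons p x)) ↔
      tv (ALV.checkAll C) (Matrix.vecCons c (Matrix.vecCons p x)) ∧
        (tv F (Matrix.vecCons (node c p) x) ↔ Claim c) := by
  rw [ALV.verify, tv_conj, tv_neg, tv_exor, not_not, tv_claim, tv_substHead]
  simp

/-- The value of the four rounds of the game after the position `c`: the first player has to claim
the true values `a`, `a'` for the two children, since the second player decides which one of them
is checked. -/
theorem tv_game_verify (hC : C.IsClause) (F : ALV (n + 1)) (p : M) {c k : M} (hc : Blocks c k) :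
    tv (ALV.game (ALV.verify C F)) (Matrix.vecCons c (Matrix.vecCons p x)) ↔
      tv (ALV.checkAll C) (Matrix.vecCons c (Matrix.vecCons p x)) ∧
        (Clause C x (tv F (Matrix.vecCons (s0 (node c p)) x))
          (tv F (Matrix.vecCons (s1 (node c p)) x)) (node c p) ↔ Claim c) := by
  rw [tv_game]
  simp only [tv_verify, checkAll_block hC p hc, node_sB hc, claim_sB hc.ne_zero]
  constructor
  · rintro ⟨a, h⟩
    obtain ⟨a1, h1⟩ := h False
    obtain ⟨a2, h2⟩ := h True
    have h1 := h1 True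
    have h2 := h2 True
    simp only [sB_false, sB_true, false_and, not_false_eq_true, true_and, false_or, not_true_eq_false,
      or_false] at h1 h2
    rw [← propext h1.2, ← propext h2.2] at h2
    exact ⟨h2.1.2, h2.1.1⟩
  · rintro ⟨h1, h2⟩
    refine ⟨_, fun b => ⟨_, fun _ => ⟨⟨h2, h1⟩, ?_⟩⟩⟩
    by_cases hb : b <;> simp [hb]

end Mdl

/-! ### The function symbol of an inductively defined predicate -/

namespace ALV

variable {n : ℕ}

/-- The digits of the last level of the game tree for the node `p`: `L(x)` is a string whose length
is the length of the leaves, `B` gives their values, and `Z(x)` is a string from which strings of the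
length of the levels can be cut. The arguments are `p, x`, and the value is `0` unless
`0 < |p| ≤ |L(x)|`. -/
def lastLevel (B : ALV (n + 1)) (C : ALV (n + 3)) (L Z : ALV n) : ALV (n + 1) :=
  mask (conj (proj (n + 1) 0) (neg (lenLt (comp L fun i => proj (n + 1) i.succ) (proj (n + 1) 0))))
    (comp (row (verify C B)) (Matrix.vecCons
      (comp trunc ![comp Z fun i => proj (n + 1) i.succ,
        hexp (comp shr ![comp L fun i => proj (n + 1) i.succ, proj (n + 1) 0])])
      (Matrix.vecCons (hexp (comp shr ![comp L fun i => proj (n + 1) i.succ, proj (n + 1) 0]))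
        fun i => proj (n + 1) i)))

/-- The value of the node `p`, by evaluation of the game tree. -/
def value (B : ALV (n + 1)) (C : ALV (n + 3)) (L Z : ALV n) : ALV (n + 1) :=
  comp tree ![lastLevel B C L Z]

theorem treeFree_lastLevel {B : ALV (n + 1)} {C : ALV (n + 3)} {L Z : ALV n} (hB : B.TreeFree)
    (hC : C.TreeFree) (hL : L.TreeFree) (hZ : Z.TreeFree) : (lastLevel B C L Z).TreeFree := by
  have hL' : (comp L fun i => proj (n + 1) i.succ).TreeFree := ⟨hL, fun _ => trivial⟩
  have hZ' : (comp Z fun i => proj (n + 1) i.succ).TreeFree := ⟨hZ, fun _ => trivial⟩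
  have hh := treeFree_hexp (treeFree_comp2 treeFree_shr hL' (treeFree_proj (n := n + 1) 0))
  exact treeFree_mask
    (treeFree_conj (treeFree_proj _) (treeFree_neg (treeFree_lenLt hL' (treeFree_proj _))))
    (treeFree_comp (treeFree_row (treeFree_verify hC hB))
      (treeFree_cons (treeFree_comp2 treeFree_trunc hZ' hh) (treeFree_cons hh fun _ => trivial)))

end ALV

namespace Mdl

variable {M : Mdl} {n : ℕ}

theorem ev_mask_of_tv {c a : ALV n} {v : Fin n → M} (h : tv c v) : ev (ALV.mask c a) v = ev a v := by
  rw [ALV.mask, ev_comp2]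
  refine ind (P := fun z => ev (ALV.crn (ALV.zeroC 1) (ALV.zeroC 2) (ALV.proj 2 1)) ![z, ev c v] = z)
    ?_ (fun z b hz ih => ?_) (ev a v)
  · exact (ev_crn_zero _ _ _ ![ev c v]).trans (ev_zeroC _)
  · refine (ev_crn_sB' _ _ _ hz ![ev c v]).trans ?_
    rw [ih]
    by_cases hb : b
    · simp [hb, show ev c v ≠ 0 from h]
    · simp [hb]

theorem ev_mask_of_not {c a : ALV n} {v : Fin n → M} (h : ¬ tv c v) : ev (ALV.mask c a) v = 0 := by
  rw [tv, not_not] at h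
  rw [ALV.mask, ev_comp2, h]
  refine ind (P := fun z => ev (ALV.crn (ALV.zeroC 1) (ALV.zeroC 2) (ALV.proj 2 1)) ![z, 0] = 0)
    ?_ (fun z b hz ih => ?_) (ev a v)
  · exact (ev_crn_zero _ _ _ ![0]).trans (ev_zeroC _)
  · refine (ev_crn_sB' _ _ _ hz ![0]).trans ?_
    rw [ih]
    by_cases hb : b <;> simp [hb, s0_zero]

theorem ev_comp_succ (F : ALV n) (p : M) (x : Fin n → M) :
    ev (ALV.comp F fun i => ALV.proj (n + 1) i.succ) (Matrix.vecCons p x) = ev F x := by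
  rw [ev_comp]
  simp

theorem tree_zero : tree (0 : M) = 0 := by
  rw [tree_small (by simp only [half_zero]), bt_zero_right]

section value

variable {B : ALV (n + 1)} {C : ALV (n + 3)} {L Z : ALV n} {x : Fin n → M}

theorem ev_value_of_not {p : M} (h : ¬ (p ≠ 0 ∧ lel p (ev L x))) :
    ev (ALV.value B C L Z) (Matrix.vecCons p x) = 0 := by
  rw [ALV.value, ev_comp1, ALV.lastLevel, ev_mask_of_not, ev_tree, tree_zero]
  rwa [tv_conj, tv_neg, tv_lenLt, ev_comp_succ, tv, ev_proj, Matrix.cons_val_zero, not_ltl]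

theorem ev_value {p : M} (hp : p ≠ 0) (hpL : lel p (ev L x)) :
    ev (ALV.value B C L Z) (Matrix.vecCons p x) =
      tree (row (ALV.verify C B) (Matrix.vecCons p x)
        (trunc (ev Z x) (hexp (shr (ev L x) p))) (hexp (shr (ev L x) p))) := by
  have e : ev (ALV.hexp (ALV.comp ALV.shr
      ![ALV.comp L fun i => ALV.proj (n + 1) i.succ, ALV.proj (n + 1) 0])) (Matrix.vecCons p x) =
      hexp (shr (ev L x) p) := by
    rw [ev_hexp, ev_comp2, ev_comp_succ, ev_proj, ev_shr]
    rfl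
  rw [ALV.value, ev_comp1, ALV.lastLevel, ev_mask_of_tv, ev_tree, row, ev_comp]
  · refine congrArg _ (congrArg _ (funext fun i => ?_))
    refine Fin.cases ?_ (fun i => ?_) i
    · simp only [Matrix.cons_val_zero, ev_comp2, ev_comp_succ, e, ev_trunc]
    refine Fin.cases ?_ (fun i => ?_) i
    · simpa only [Matrix.cons_val_succ, Matrix.cons_val_zero] using e
    · simp
  · rw [tv_conj, tv_neg, tv_lenLt, ev_comp_succ, tv, ev_proj, Matrix.cons_val_zero, not_ltl]
    exact ⟨hp, hpL⟩

/-- The positions of the level `w` of the game tree. -/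
theorem blocks_of_level {w t u : M} (ht : ln t = hexp w) (hu : ltl u t) :
    Blocks (ln u + hexp w) (ln w) := by
  have hlt : ln u < hexp w := by rw [← ht]; exact ltl_iff.1 hu
  rw [Blocks, ← ln_hexp]
  refine (isPow_hexp w).ln_eq ?_ ?_
  · exact le_add_left' _ _
  · rw [← add_self]
    exact add_lt_add_left' hlt _

theorem ln_level (hZ : hexp (ev L x) ≤ ln (ev Z x)) {w : M} (hw : lel w (ev L x)) :
    ln (trunc (ev Z x) (hexp w)) = hexp w :=
  ln_trunc ((hexp_mono hw).trans hZ)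

theorem ev_value_leaf (hC : C.IsClause) (hZ : hexp (ev L x) ≤ ln (ev Z x)) {p : M} (hp : p ≠ 0)
    (hpL : eql p (ev L x)) :
    ev (ALV.value B C L Z) (Matrix.vecCons p x) = sB (tv B (Matrix.vecCons p x)) 0 := by
  have h0 : shr (ev L x) p = 0 := hpL.2
  rw [ev_value hp hpL.1, h0, tree_row_one, hexp_zero, tv_verify, node_one]
  · simp only [claim_one, checkAll_one hC, iff_true, true_and]
  · rw [ln_level hZ (zero_lel _), hexp_zero]

/-- The recursion of the inductively defined predicate, as long as it holds for longer nodes. -/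
theorem ev_value_inner (hC : C.IsClause) (hZ : hexp (ev L x) ≤ ln (ev Z x)) {p : M} (hp : p ≠ 0)
    (hpL : ltl p (ev L x))
    (hrec : ∀ q, ltl p q → ltl q (ev L x) →
      (tv (ALV.value B C L Z) (Matrix.vecCons q x) ↔
        Clause C x (tv (ALV.value B C L Z) (Matrix.vecCons (s0 q) x))
          (tv (ALV.value B C L Z) (Matrix.vecCons (s1 q) x)) q)) :
    ev (ALV.value B C L Z) (Matrix.vecCons p x) =
      sB (Clause C x (tv (ALV.value B C L Z) (Matrix.vecCons (s0 p) x))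
        (tv (ALV.value B C L Z) (Matrix.vecCons (s1 p) x)) p) 0 := by
  set F := ALV.value B C L Z with hF
  set h := shr (ev L x) p with hh
  have hlen : ln p + ln h = ln (ev L x) := ln_add_ln_shr (lel_of_ltl hpL)
  have hhL : lel h (ev L x) := shr_lel _ _
  have hh0 : h ≠ 0 := hpL
  -- at the last level, the values given by `F` are those given by `B`
  have hlast : ev F (Matrix.vecCons p x) =
      tree (row (ALV.verify C F) (Matrix.vecCons p x) (trunc (ev Z x) (hexp h)) (hexp h)) := by
    rw [hF, ev_value hp (lel_of_ltl hpL), ← hh]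
    refine congrArg _ (row_congr fun u hu => ?_)
    have hb := blocks_of_level (ln_level hZ hhL) hu
    have hn := ln_node hb hp
    rw [hlen, ← eql_iff] at hn
    have hv : tv F (Matrix.vecCons (node (ln u + hexp h) p) x) ↔
        tv B (Matrix.vecCons (node (ln u + hexp h) p) x) := by
      rw [tv, hF, ev_value_leaf hC hZ hn.1 hn.2, Ne, sB_eq_zero]
      tauto
    rw [tv_verify, tv_verify, hv]
  -- four digits at a time, the level above is evaluated by means of the game
  have hstep : ∀ {b : Prop} {w : M}, sB b w ≠ 0 → lel (sB b w) h →
      tree (row (ALV.verify C F) (Matrix.vecCons p x) (trunc (ev Z x) (hexp (sB b w)))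
        (hexp (sB b w))) =
      tree (row (ALV.game (ALV.verify C F)) (Matrix.vecCons p x) (trunc (ev Z x) (hexp w))
        (hexp w)) := by
    intro b w hw hl
    have hwL : lel w (ev L x) :=
      lel_trans (lel_of_ltl ((ltl_sB hw w).2 (lel_refl w))) (lel_trans hl hhL)
    have h1 := ln_level hZ (lel_trans hl hhL)
    have h2 := ln_level hZ hwL
    rw [hexp_sB hw] at h1 ⊢
    refine tree_row _ _ (fun h0 => (isPow_hexp w).ne_zero ?_) ?_ _
    · rw [← h2, h0, ln_zero]
    · rw [h1, h2]
  have hone : lel (s1 0) h := by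
    rw [← sB_true, sB_lel_iff_ltl (s1_ne_zero' 0), zero_ltl]
    exact hh0
  have hdown : ∀ w, lel w h → w ≠ 0 →
      tree (row (ALV.verify C F) (Matrix.vecCons p x) (trunc (ev Z x) (hexp w)) (hexp w)) =
      tree (row (ALV.verify C F) (Matrix.vecCons p x) (trunc (ev Z x) (hexp (s1 0)))
        (hexp (s1 0))) := by
    refine ind (fun _ h => absurd rfl h) fun w b hw ih hl _ => ?_
    by_cases hw0 : w = 0
    · subst hw0
      have hb : b := by
        by_contra hb
        exact hw (by rw [sB_neg hb, s0_zero])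
      rw [sB_pos hb]
    have hlw : ltl w h := (sB_lel_iff_ltl hw h).1 hl
    rw [hstep hw hl, ← ih (lel_of_ltl hlw) hw0]
    refine congrArg _ (row_congr fun u hu => ?_)
    have hb := blocks_of_level (ln_level hZ (lel_trans (lel_of_ltl hlw) hhL)) hu
    have hn := (ln_node hb hp).2
    rw [tv_game_verify hC F p hb, tv_verify, hrec (node (ln u + hexp w) p)]
    · rw [ltl_iff, hn]
      have := add_lt_add_left' (pos_iff.2 fun h => hw0 (ln_eq_zero.1 h)) (ln p)
      rwa [add_comm', add_zero', add_comm'] at this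
    · rw [ltl_iff, hn, ← hlen, add_comm' _ (ln w), add_comm' _ (ln h)]
      exact add_lt_add_left' (ltl_iff.1 hlw) _
  rw [hlast, hdown h (lel_refl h) hh0, ← sB_true 0, hstep (s1_ne_zero' 0) (by rwa [sB_true]),
    tree_row_one, hexp_zero, tv_game_verify hC F p blocks_one, node_one]
  · simp only [claim_one, checkAll_one hC, iff_true, true_and]
  · rw [ln_level hZ (zero_lel _), hexp_zero]

/-- The recursion of the inductively defined predicate: a longest counterexample is impossible. -/
theorem tv_value_iff (hC : C.IsClause) (hZ : hexp (ev L x) ≤ ln (ev Z x)) {p : M} (hp : p ≠ 0)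
    (hpL : ltl p (ev L x)) :
    tv (ALV.value B C L Z) (Matrix.vecCons p x) ↔
      Clause C x (tv (ALV.value B C L Z) (Matrix.vecCons (s0 p) x))
        (tv (ALV.value B C L Z) (Matrix.vecCons (s1 p) x)) p := by
  set F := ALV.value B C L Z with hF
  by_contra hne
  set R : ALV (n + 1) := ALV.conj (ALV.proj (n + 1) 0)
    (ALV.conj (ALV.lenLt (ALV.proj (n + 1) 0) (ALV.comp L fun i => ALV.proj (n + 1) i.succ))
      (ALV.exor F (ALV.comp C (Matrix.vecCons
        (ALV.substHead F Fin.succ (ALV.comp ALV.s0 ![ALV.proj (n + 1) 0]))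
        (Matrix.vecCons (ALV.substHead F Fin.succ (ALV.comp ALV.s1 ![ALV.proj (n + 1) 0]))
          fun i => ALV.proj (n + 1) i))))) with hR
  have hRiff : ∀ q, tv R (Matrix.vecCons q x) ↔ q ≠ 0 ∧ ltl q (ev L x) ∧
      ¬ (tv F (Matrix.vecCons q x) ↔ Clause C x (tv F (Matrix.vecCons (s0 q) x))
        (tv F (Matrix.vecCons (s1 q) x)) q) := by
    intro q
    have e0 := tv_substHead F Fin.succ (ALV.comp ALV.s0 ![ALV.proj (n + 1) 0]) (Matrix.vecCons q x)
    have e1 := tv_substHead F Fin.succ (ALV.comp ALV.s1 ![ALV.proj (n + 1) 0]) (Matrix.vecCons q x)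
    have e := hC M x
      (ev (ALV.substHead F Fin.succ (ALV.comp ALV.s0 ![ALV.proj (n + 1) 0])) (Matrix.vecCons q x))
      (ev (ALV.substHead F Fin.succ (ALV.comp ALV.s1 ![ALV.proj (n + 1) 0])) (Matrix.vecCons q x)) q
    simp only [tv] at e0 e1
    rw [propext e0, propext e1] at e
    simp only [ev_comp1, ev_proj, Matrix.cons_val_zero, ev_s0, ev_s1, Matrix.cons_val_succ] at e
    have e' : tv (ALV.comp C (Matrix.vecCons
        (ALV.substHead F Fin.succ (ALV.comp ALV.s0 ![ALV.proj (n + 1) 0]))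
        (Matrix.vecCons (ALV.substHead F Fin.succ (ALV.comp ALV.s1 ![ALV.proj (n + 1) 0]))
          fun i => ALV.proj (n + 1) i))) (Matrix.vecCons q x) ↔
        Clause C x (tv F (Matrix.vecCons (s0 q) x)) (tv F (Matrix.vecCons (s1 q) x)) q := by
      refine Iff.trans (Eq.to_iff ?_) e
      rw [tv, ev_comp, tv]
      refine congrArg (· ≠ 0) (congrArg _ (funext fun i => ?_))
      refine Fin.cases rfl (fun i => ?_) i
      refine Fin.cases rfl (fun i => ?_) i
      simp
    rw [hR, tv_conj, tv_conj, tv_exor, e', tv_lenLt, ev_comp_succ, tv, ev_proj, Matrix.cons_val_zero]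
  have hbound : ∀ q, ltl q (ev L x) → q < ln (ev Z x) := fun q hq => by
    refine lt_of_lt_of_le ?_ hZ
    refine lt_of_lt_of_le (lt_pd_iff.2 (ltl_iff.1 hq).le) (pd_le_pd_right _ ?_)
    rw [← sc_zero, sc_le_iff, pos_iff, sc_zero]
    exact pd_ne_zero _ (pd_ne_zero _ (pd_ne_zero _ (s1_ne_zero 0)))
  obtain ⟨m, -, hm, hmax⟩ := exists_greatest R x (hbound p hpL) ((hRiff p).2 ⟨hp, hpL, hne⟩)
  obtain ⟨hm0, hmL, hm⟩ := (hRiff m).1 hm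
  refine hm ?_
  have := ev_value_inner (B := B) hC hZ hm0 hmL fun q hmq hqL => by
    have h := hmax q (lt_of_ltl hmq) (hbound q hqL)
    rw [hRiff] at h
    by_contra hne
    exact h ⟨ne_zero_of_ltl hmq, hqL, hne⟩
  rw [← hF] at this
  rw [tv, this, Ne, sB_eq_zero]
  tauto

/-- The values are truth values. -/
theorem exists_ev_value_eq (hC : C.IsClause) (hZ : hexp (ev L x) ≤ ln (ev Z x)) (p : M) :
    ∃ b : Prop, ev (ALV.value B C L Z) (Matrix.vecCons p x) = sB b 0 := by
  by_cases h : p ≠ 0 ∧ lel p (ev L x)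
  · rcases lel_iff_ltl_or_eql.1 h.2 with hl | hl
    · exact ⟨_, ev_value_inner hC hZ h.1 hl fun q hq hqL => tv_value_iff hC hZ (ne_zero_of_ltl hq) hqL⟩
    · exact ⟨_, ev_value_leaf hC hZ h.1 hl⟩
  · exact ⟨False, by rw [ev_value_of_not h, sB_false, s0_zero]⟩

end value

end Mdl

/-! ### Translation of the defining axioms -/

namespace BoolFormula

variable {A : Type}

/-- The truth value of a boolean formula. -/
def Holds (v : A → Prop) : BoolFormula A → Prop
  | atom a => v a
  | tru => True
  | fls => False
  | neg I => ¬ I.Holds v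
  | and I J => I.Holds v ∧ J.Holds v
  | or I J => I.Holds v ∨ J.Holds v
  | imp I J => I.Holds v → J.Holds v

/-- A boolean formula, with symbols for its atoms, as a symbol for its truth value. -/
def symbol {n : ℕ} (v : A → ALV n) : BoolFormula A → ALV n
  | atom a => v a
  | tru => ALV.oneC n
  | fls => ALV.zeroC n
  | neg I => ALV.neg (I.symbol v)
  | and I J => ALV.conj (I.symbol v) (J.symbol v)
  | or I J => ALV.disj (I.symbol v) (J.symbol v)
  | imp I J => ALV.disj (ALV.neg (I.symbol v)) (J.symbol v)

theorem treeFree_symbol {n : ℕ} {v : A → ALV n} (hv : ∀ a, (v a).TreeFree) :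
    (I : BoolFormula A) → (I.symbol v).TreeFree
  | atom a => hv a
  | tru => ALV.treeFree_oneC n
  | fls => ALV.treeFree_zeroC n
  | neg I => ALV.treeFree_neg (treeFree_symbol hv I)
  | and I J => ALV.treeFree_conj (treeFree_symbol hv I) (treeFree_symbol hv J)
  | or I J => ALV.treeFree_disj (treeFree_symbol hv I) (treeFree_symbol hv J)
  | imp I J => ALV.treeFree_disj (ALV.treeFree_neg (treeFree_symbol hv I)) (treeFree_symbol hv J)

theorem tv_symbol {M : Mdl} {n : ℕ} (v : A → ALV n) (w : Fin n → M) (I : BoolFormula A) :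
    Mdl.tv (I.symbol v) w ↔ I.Holds fun a => Mdl.tv (v a) w := by
  induction I with
  | atom a => rfl
  | tru => simp [symbol, Holds]
  | fls => simp [symbol, Holds]
  | neg I ih => simp [symbol, Holds, ih]
  | and I J ih1 ih2 => simp [symbol, Holds, ih1, ih2]
  | or I J ih1 ih2 => simp [symbol, Holds, ih1, ih2]
  | imp I J ih1 ih2 => simp [symbol, Holds, ih1, ih2, imp_iff_not_or]

theorem realize_subst {M : Mdl} {α : Type} (v : A → LALV.Formula α) (w : α → M)
    (I : BoolFormula A) : (I.subst v).Realize w ↔ I.Holds fun a => (v a).Realize w := by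
  induction I with
  | atom a => rfl
  | tru => simp [subst, Holds, Formula.Realize]
  | fls => simp [subst, Holds, Formula.Realize]
  | neg I ih => simp [subst, Holds, ih, Formula.realize_not]
  | and I J ih1 ih2 => simp [subst, Holds, ih1, ih2, Formula.realize_inf]
  | or I J ih1 ih2 => simp [subst, Holds, ih1, ih2, Formula.realize_sup]
  | imp I J ih1 ih2 => simp [subst, Holds, ih1, ih2, Formula.realize_imp]

end BoolFormula

namespace Mdl

variable {M : Mdl}

theorem proves_univClosure {k : ℕ} (φ : LALV.Formula (Fin k))
    (h : ∀ (M : Mdl) (v : Fin k → M), φ.Realize v) :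
    FOL.Proves QALV.theory (FOL.univClosure φ) :=
  FOL.proves_univClosure φ fun N _ _ hN v => h ⟨N, hN⟩ v

theorem pd_congr {y y' : M} (h : eql y y') (x : M) : pd y x = pd y' x :=
  le_antisymm (pd_le_pd_left h.1 x) (pd_le_pd_left h.2 x)

section terms

variable {α : Type} (v : α → M)

theorem realize_ofTerm_zero : (QALV.ofTerm BA.zero : LALV.Term α).realize v = 0 := by
  change (QALV.app ALV.zero _).realize v = _
  rw [realize_app, ev_zero]

theorem realize_ofTerm_one : (QALV.ofTerm BA.one : LALV.Term α).realize v = s1 0 := by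
  change (QALV.app (ALV.oneC 0) _).realize v = _
  rw [realize_app, ev_oneC]

theorem realize_ofTerm_add (s t : LBA.Term α) : (QALV.ofTerm (BA.add s t)).realize v =
    (QALV.ofTerm s).realize v + (QALV.ofTerm t).realize v := by
  change (QALV.app ALV.add fun i => QALV.ofTerm (![s, t] i)).realize v = _
  rw [realize_app, add_def]
  congr 1
  funext i
  fin_cases i <;> rfl

theorem realize_ofTerm_len (t : LBA.Term α) :
    (QALV.ofTerm (BA.len t)).realize v = ln ((QALV.ofTerm t).realize v) := by
  change (QALV.app ALV.len fun i => QALV.ofTerm (![t] i)).realize v = _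
  rw [realize_app, ln]
  congr 1
  funext i
  rw [Subsingleton.elim i 0]
  rfl

theorem realize_ofFormula_leF (s t : LBA.Term α) : Formula.Realize (QALV.ofFormula (BA.leF s t)) v ↔
    (QALV.ofTerm s).realize v ≤ (QALV.ofTerm t).realize v := by
  rw [← monus_eq_zero_iff_le]
  change (QALV.app ALV.monus ![QALV.ofTerm (s.relabel Sum.inl), QALV.ofTerm (t.relabel Sum.inl)] :
    LALV.Term (α ⊕ Fin 0)).realize _ = QALV.zero.realize _ ↔ _
  rw [realize_app2, realize_zero, ev_monus, ofTerm_relabel, ofTerm_relabel, Term.realize_relabel,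
    Term.realize_relabel, Sum.elim_comp_inl]

theorem realize_ofFormula_equal (s t : LBA.Term α) : Formula.Realize (QALV.ofFormula (s.equal t)) v ↔
    (QALV.ofTerm s).realize v = (QALV.ofTerm t).realize v := by
  change (QALV.ofTerm (s.relabel Sum.inl) : LALV.Term (α ⊕ Fin 0)).realize _ =
    (QALV.ofTerm (t.relabel Sum.inl) : LALV.Term (α ⊕ Fin 0)).realize _ ↔ _
  rw [ofTerm_relabel, ofTerm_relabel, Term.realize_relabel, Term.realize_relabel,
    Sum.elim_comp_inl]

theorem realize_ofFormula_inf (φ ψ : LBA.Formula α) : Formula.Realize (QALV.ofFormula (φ ⊓ ψ)) v ↔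
    Formula.Realize (QALV.ofFormula φ) v ∧ Formula.Realize (QALV.ofFormula ψ) v :=
  Formula.realize_inf (φ := QALV.ofFormula φ) (ψ := QALV.ofFormula ψ)

theorem realize_ofFormula_not (φ : LBA.Formula α) : Formula.Realize (QALV.ofFormula φ.not) v ↔
    ¬ Formula.Realize (QALV.ofFormula φ) v :=
  Formula.realize_not (φ := QALV.ofFormula φ)

end terms

end Mdl

namespace BA

variable {α β : Type}

theorem relabel_add (r : α → β) (s t : LBA.Term α) :
    (add s t).relabel r = add (s.relabel r) (t.relabel r) := by
  simp only [add, Term.relabel]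
  congr 1
  funext i
  fin_cases i <;> rfl

theorem relabel_len (r : α → β) (t : LBA.Term α) : (len t).relabel r = len (t.relabel r) := by
  simp only [len, Term.relabel]
  congr 1
  funext i
  rw [Subsingleton.elim i 0]
  rfl

theorem relabel_zero (r : α → β) : (zero : LBA.Term α).relabel r = zero := by
  simp only [zero, Term.relabel]
  congr 1
  exact Subsingleton.elim _ _

theorem relabel_one (r : α → β) : (one : LBA.Term α).relabel r = one := by
  simp only [one, Term.relabel]
  congr 1
  exact Subsingleton.elim _ _

theorem relabel_numeral (r : α → β) (d : ℕ) : (numeral d : LBA.Term α).relabel r = numeral d := by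
  induction d with
  | zero => exact relabel_zero r
  | succ d ih => rw [numeral, relabel_add, ih, relabel_one, numeral]

theorem relabel_smul (r : α → β) (t : LBA.Term α) (c : ℕ) :
    (smul t c).relabel r = smul (t.relabel r) c := by
  induction c with
  | zero => exact relabel_zero r
  | succ c ih => rw [smul, relabel_add, ih, smul]

theorem relabel_linearForm (r : α → β) {n : ℕ} (c : Fin n → ℕ) (t : Fin n → LBA.Term α) (d : ℕ) :
    (linearForm c t d).relabel r = linearForm c (fun i => (t i).relabel r) d := by
  induction n with
  | zero => exact relabel_numeral r d
  | succ n ih => rw [linearForm, relabel_add, relabel_smul, relabel_len, relabel_len, ih, linearForm]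

end BA

theorem theorem9p3 (A : IndPred) :
    ∃ (f g : ALV (A.n + 1)), f = ALV.comp ALV.tree ![g] ∧ g.TreeFree ∧
      FOL.Proves QALV.theory (FOL.univClosure (A.zeroOne f)) ∧
      FOL.Proves QALV.theory (FOL.univClosure (A.ax0 f)) ∧
      FOL.Proves QALV.theory (FOL.univClosure (A.ax1 f)) ∧
      FOL.Proves QALV.theory (FOL.univClosure (A.ax2 f)) := by
  -- symbols for the formulas `B` and `Dᵢ`, with `p` as the first argument
  have hρ : ∀ b, ((Sum.elim (Fin.snoc (α := fun _ => ALV (A.n + 1))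
      (fun i => ALV.proj (A.n + 1) i.succ) (ALV.proj (A.n + 1) 0)) Fin.elim0 :
      Fin (A.n + 1) ⊕ Fin 0 → ALV (A.n + 1)) b).TreeFree := by
    rintro (i | i)
    · refine Fin.lastCases ?_ (fun i => ?_) i
      · simp only [Sum.elim_inl, Fin.snoc_last]
        trivial
      · simp only [Sum.elim_inl, Fin.snoc_castSucc]
        trivial
    · exact i.elim0
  have hsym : ∀ φ : LBA.Formula (Fin (A.n + 1)), BA.IsSigma0 φ → ∃ F : ALV (A.n + 1), F.TreeFree ∧
      ∀ (M : Mdl) (p : M) (x : Fin A.n → M), Mdl.tv F (Matrix.vecCons p x) ↔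
        (QALV.ofFormula φ).Realize (Fin.snoc (α := fun _ => M) x p) default := by
    intro φ hφ
    obtain ⟨F, hF, h⟩ := Mdl.exists_sigma0_symbol hφ _ hρ
    refine ⟨F, hF, fun M p x => (h M _).trans (iff_of_eq (congrArg₂ _ (funext fun i => ?_)
      (Subsingleton.elim _ _)))⟩
    refine Fin.lastCases ?_ (fun i => ?_) i <;> simp
  obtain ⟨B, hB, hBv⟩ := hsym A.B A.B_sigma0
  choose D hD hDv using fun i => hsym (A.D i) (A.D_sigma0 i)
  set C : ALV (A.n + 3) := A.I.symbol (Sum.elim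
    (fun i => ALV.comp (D i) fun j => ALV.proj (A.n + 3) j.succ.succ)
    ![ALV.proj (A.n + 3) 0, ALV.proj (A.n + 3) 1]) with hC
  have hCtree : C.TreeFree := by
    refine BoolFormula.treeFree_symbol ?_ _
    rintro (i | i)
    · exact ⟨hD i, fun _ => trivial⟩
    · fin_cases i <;> trivial
  have hCv : ∀ (M : Mdl) (x : Fin A.n → M) (a b q : M),
      Mdl.tv C (Matrix.vecCons a (Matrix.vecCons b (Matrix.vecCons q x))) ↔
        A.I.Holds (Sum.elim
          (fun i => (QALV.ofFormula (A.D i)).Realize (Fin.snoc (α := fun _ => M) x q) default)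
          ![a ≠ 0, b ≠ 0]) := by
    intro M x a b q
    rw [hC, BoolFormula.tv_symbol]
    refine iff_of_eq (congrArg (fun w => A.I.Holds w) (funext fun j => propext ?_))
    rcases j with i | i
    · rw [Sum.elim_inl, Sum.elim_inl, ← hDv, Mdl.tv, Mdl.ev_comp]
      simp [Mdl.tv]
    · fin_cases i
      · simp [Mdl.tv]
      · simp [Mdl.tv]
  have hCc : C.IsClause := by
    intro M x a b q
    rw [Mdl.Clause, hCv, hCv]
    have e : ∀ P : Prop, (Mdl.sB P (0 : M) ≠ 0) = P := fun P => by
      rw [Ne, Mdl.sB_eq_zero]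
      simp
    rw [e, e]
  -- strings whose lengths are the linear form and an exponential of it
  have hlog : Mdl.LogTerm (BA.linearForm A.c (fun i => Term.var i) A.d) :=
    Mdl.logTerm_linearForm A.c id A.d
  obtain ⟨L, Z₀, hL, -, hLv⟩ := hlog (fun i => ALV.proj A.n i) fun _ => trivial
  obtain ⟨L', Z, hL', hZ, hLv'⟩ := Mdl.logTerm_smul hlog 4 (fun i => ALV.proj A.n i) fun _ => trivial
  have hell : ∀ (M : Mdl) (v : Fin (A.n + 1) → M),
      (QALV.ofTerm A.ell).realize v = Mdl.ln (Mdl.ev L fun i => v i.castSucc) := by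
    intro M v
    have e : A.ell = (BA.linearForm A.c (fun i => Term.var i) A.d).relabel Fin.castSucc :=
      (BA.relabel_linearForm Fin.castSucc A.c (fun i => Term.var i) A.d).symm
    rw [e, Mdl.ofTerm_relabel, Term.realize_relabel, (hLv M _).1]
    simp only [Mdl.ev_proj]
    rfl
  have hexp : ∀ (M : Mdl) (x : Fin A.n → M),
      Mdl.hexp (Mdl.ev L x) ≤ Mdl.ln (Mdl.ev Z x) := by
    intro M x
    have h := hLv' M x
    set l := Mdl.ev L x with hl
    have e : Mdl.eql (Mdl.cat l (Mdl.cat l (Mdl.cat l (Mdl.cat l 0)))) (Mdl.ev L' x) := by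
      rw [Mdl.eql_iff, h.1]
      simp only [BA.smul, Mdl.realize_ofTerm_add, Mdl.realize_ofTerm_zero, Mdl.ln_cat, Mdl.ln_zero,
        ← (hLv M x).1, hl]
    have e' : Mdl.hexp l =
        Mdl.pd (Mdl.cat l (Mdl.cat l (Mdl.cat l (Mdl.cat l 0)))) (Mdl.s1 0) := by
      simp only [Mdl.hexp, Mdl.pd_cat, Mdl.pd_zero]
    rw [e', Mdl.pd_congr e]
    exact h.2
  set g : ALV (A.n + 1) := ALV.comp (ALV.lastLevel B C L Z)
    (Matrix.vecCons (ALV.proj (A.n + 1) (Fin.last A.n)) fun i => ALV.proj (A.n + 1) i.castSucc)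
    with hg
  have hf : ∀ (M : Mdl) (x : Fin A.n → M) (p : M),
      Mdl.ev (ALV.comp ALV.tree ![g]) (Fin.snoc (α := fun _ => M) x p) =
        Mdl.ev (ALV.value B C L Z) (Matrix.vecCons p x) := by
    intro M x p
    rw [ALV.value, Mdl.ev_comp1, Mdl.ev_comp1, hg, Mdl.ev_comp]
    congr 3
    funext i
    refine Fin.cases ?_ (fun i => ?_) i <;> simp
  have hone : ∀ (M : Mdl) (x : Fin A.n → M) (p : M),
      Mdl.ev (ALV.value B C L Z) (Matrix.vecCons p x) = Mdl.s1 0 ↔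
        Mdl.tv (ALV.value B C L Z) (Matrix.vecCons p x) := by
    intro M x p
    obtain ⟨b, hb⟩ := Mdl.exists_ev_value_eq (B := B) hCc (hexp M x) p
    rw [Mdl.tv, hb, Ne, Mdl.sB_eq_zero, ← Mdl.sB_true, Mdl.sB_inj]
    tauto
  have hholds : ∀ (M : Mdl) (v : Fin (A.n + 1) → M) (t : LBA.Term (Fin (A.n + 1))),
      (A.holds (ALV.comp ALV.tree ![g]) t).Realize v ↔
        Mdl.tv (ALV.value B C L Z)
          (Matrix.vecCons ((QALV.ofTerm t).realize v) fun i => v i.castSucc) := by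
    intro M v t
    rw [IndPred.holds, Formula.realize_equal, Mdl.realize_app, Mdl.realize_one, ← hone, ← hf]
    refine iff_of_eq (congrArg (· = _) (congrArg _ (funext fun i => ?_)))
    refine Fin.lastCases ?_ (fun i => ?_) i <;> simp
  have hp : ∀ (M : Mdl) (v : Fin (A.n + 1) → M),
      (QALV.ofTerm A.p).realize v = v (Fin.last A.n) := fun M v => rfl
  have hpos : ∀ (M : Mdl) (v : Fin (A.n + 1) → M),
      Formula.Realize (QALV.ofFormula A.pos) v ↔ v (Fin.last A.n) ≠ 0 := by
    intro M v
    rw [IndPred.pos, Mdl.realize_ofFormula_not, Mdl.realize_ofFormula_equal, Mdl.realize_ofTerm_len,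
      Mdl.realize_ofTerm_zero, eq_comm, Mdl.ln_eq_zero, hp]
  have hsnoc : ∀ (M : Mdl) (v : Fin (A.n + 1) → M),
      Fin.snoc (α := fun _ => M) (fun i => v i.castSucc) (v (Fin.last A.n)) = v := by
    intro M v
    funext i
    refine Fin.lastCases ?_ (fun i => ?_) i <;> simp
  refine ⟨_, g, rfl, ALV.treeFree_comp (ALV.treeFree_lastLevel hB hCtree hL hZ)
    (ALV.treeFree_cons trivial fun _ => trivial), ?_, ?_, ?_, ?_⟩
  all_goals
    refine Mdl.proves_univClosure _ fun M v => ?_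
    have hM := hexp M fun i => v i.castSucc
  · rw [IndPred.zeroOne, Formula.realize_sup, Formula.realize_equal, Formula.realize_equal,
      Mdl.realize_app, Mdl.realize_zero, Mdl.realize_one]
    have e : (fun i => (Term.var i : LALV.Term (Fin (A.n + 1))).realize v) =
        Fin.snoc (α := fun _ => M) (fun i => v i.castSucc) (v (Fin.last A.n)) := (hsnoc M v).symm
    rw [e, hf, hone, Mdl.tv]
    exact em _
  · rw [IndPred.ax0, Formula.realize_imp, hholds, Mdl.realize_ofFormula_inf, hpos,
      Mdl.realize_ofFormula_leF, Mdl.realize_ofTerm_len, hell, hp, ← Mdl.lel_iff]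
    intro h
    by_contra hne
    exact h (Mdl.ev_value_of_not hne)
  · rw [IndPred.ax1, Formula.realize_imp, Formula.realize_iff, hholds, Mdl.realize_ofFormula_inf,
      hpos, Mdl.realize_ofFormula_equal, Mdl.realize_ofTerm_len, hell, hp, ← Mdl.eql_iff]
    rintro ⟨h0, h⟩
    rw [Mdl.tv, Mdl.ev_value_leaf hCc hM h0 h, Ne, Mdl.sB_eq_zero, hBv, hsnoc, Formula.Realize]
    tauto
  · rw [IndPred.ax2, Formula.realize_imp, Formula.realize_iff, hholds, Mdl.realize_ofFormula_inf,
      hpos, BA.ltF, Mdl.realize_ofFormula_inf, Mdl.realize_ofFormula_not, Mdl.realize_ofFormula_leF,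
      Mdl.realize_ofFormula_equal, Mdl.realize_ofTerm_len, hell, hp, ← lt_iff_le_and_ne,
      ← Mdl.ltl_iff, BoolFormula.realize_subst]
    rintro ⟨h0, h⟩
    rw [Mdl.tv_value_iff hCc hM h0 h, Mdl.Clause, hCv]
    have e0 : (QALV.ofTerm (BA.app0 A.p)).realize v = Mdl.s0 (v (Fin.last A.n)) := by
      rw [BA.app0, Mdl.realize_ofTerm_add, Mdl.realize_ofTerm_add, Mdl.realize_ofTerm_zero,
        Mdl.add_zero', hp, Mdl.add_self]
    have e1 : (QALV.ofTerm (BA.app1 A.p)).realize v = Mdl.s1 (v (Fin.last A.n)) := by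
      rw [BA.app1, Mdl.realize_ofTerm_add, Mdl.realize_ofTerm_add, Mdl.realize_ofTerm_one, hp,
        Mdl.add_self, ← Mdl.sc_def, Mdl.sc_s0]
    refine iff_of_eq (congrArg (fun w => A.I.Holds w) (funext fun j => propext ?_))
    rcases j with i | i
    · rw [Sum.elim_inl, Sum.elim_inl, hsnoc, Formula.Realize]
    · rw [Sum.elim_inr, Sum.elim_inr]
      fin_cases i
      · change Mdl.sB _ 0 ≠ 0 ↔ Formula.Realize (A.holds _ (BA.app0 A.p)) v
        rw [hholds, e0, Ne, Mdl.sB_eq_zero]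
        tauto
      · change Mdl.sB _ 0 ≠ 0 ↔ Formula.Realize (A.holds _ (BA.app1 A.p)) v
        rw [hholds, e1, Ne, Mdl.sB_eq_zero]
        tauto
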